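/- **Setting.** Let $M^n$ be a connected smooth $n$-manifold and $x:M^n\to\mathbb R^{n+1}$ a locally strongly convex centroaffine hypersurface: $x$ is a smooth immersion whose position vector is everywhere transversal to the tangent plane, and, for a suitable $\varepsilon\in\{1,-1\}$, the centroaffine metric $h$ in the Gauss formula $D_Xx_*(Y)=x_*(\nabla_XY)+h(X,Y)(-\varepsilon x)$ is positive definite. Let $\hat\nabla$ be the Levi-Civita connection of $h$, $K_XY=\nabla_XY-\hat\nabla_XY$ the difference tensor and $C=\nabla h$ the cubic form. Assume that $C$ is parallel, $\hat\nabla C=0$, and vanishes at no point. **Case $\mathfrak C_m$ ($2\le m\le n-1$).** Let $p\in M$ and let $e_1,\dots,e_n$ be an $h$-orthonormal basis of $T_pM$ such that $e_1$ is an absolute maximum of $u\mapsto h(K_uu,u)$ on the unit sphere $\{u\in T_pM: h(u,u)=1\}$ and $K_{e_1}e_i=\lambda_ie_i$ for all $i$. Assume that $\lambda_1^2-4\varepsilon>0$, $\lambda_2=\dots=\lambda_m=\tfrac12\lambda_1$ and $\lambda_{m+1}=\dots=\lambda_n=\tfrac12\big(\lambda_1-\sqrt{\lambda_1^2-4\varepsilon}\big)$.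 **The integer $k_0$.** Put $\mathcal D_2=\mathrm{span}\{e_2,\dots,e_m\}$, $L(v,v')=K_vv'-\tfrac12\lambda_1h(v,v')e_1$ and $P_vv'=K_vL(v,v')$ for $v,v'\in\mathcal D_2$, and for a unit vector $v\in\mathcal D_2$ let $V_v(0)=\{u\in\mathcal D_2: h(u,v)=0,\ P_vu=0\}$. Let $v_1,\dots,v_{k_0}\in\mathcal D_2$ be unit vectors with $$\mathcal D_2=\{v_1\}\oplus V_{v_1}(0)\oplus\dots\oplus\{v_{k_0}\}\oplus V_{v_{k_0}}(0),$$ where $\{v_j\}$ denotes the line spanned by $v_j$. **Theorem 7.1.** If $k_0=1$, then $M^n$ is locally a Calabi product. More precisely, one of the following holds. 1. Every point of $M$ has an open neighbourhood, diffeomorphic to a product $I\times M_1\times M_2$ with $I\subseteq\mathbb R$ open, on which, up to a linear transformation of $\mathbb R^{n+1}$, $$x(u,p_1,p_2)=\big(e^{u}\psi_1(p_1),\,e^{-\lambda u}\psi_2(p_2)\big)$$ for a constant $\lambda\ne0,-1$ and locally strongly convex centroaffine hypersurfaces $\psi_i:M_i\to\mathbb R^{n_i+1}$ with parallel cubic form,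 where $n_i=\dim M_i\ge1$ and $n_1+n_2+1=n$. 2. Every point of $M$ has an open neighbourhood, diffeomorphic to a product $I\times M_1$ with $I\subseteq\mathbb R$ open, on which, up to a linear transformation of $\mathbb R^{n+1}$, $$x(u,p_1)=\big(e^{u}\psi_1(p_1),\,e^{-\lambda u}\big)$$ for a constant $\lambda\ne0,-1$ and a locally strongly convex centroaffine hypersurface $\psi_1:M_1\to\mathbb R^{n}$ with parallel cubic form, where $\dim M_1=n-1$. -/

import Mathlib

open scoped Manifold ContDiff

namespace Centroaffine

noncomputable section

/-- The standard `k`-dimensional real space. -/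
abbrev Eu (k : ℕ) : Type := EuclideanSpace ℝ (Fin k)

/-! ### Local centroaffine geometry of a parametrized hypersurface `f : U ⊆ E → V` -/

section Local

variable {E V : Type*} [NormedAddCommGroup E] [NormedSpace ℝ E]
  [NormedAddCommGroup V] [NormedSpace ℝ V]

/-- `(u, t) ↦ df_y(u) + t f(y)`. If `dim V = dim E + 1`, this is an isomorphism exactly when `f` is
an immersion at `y` whose position vector `f y` is transversal to the tangent plane. -/
def frame (f : E → V) (y : E) : E × ℝ →L[ℝ] V :=
  (fderiv ℝ f y).coprod (ContinuousLinearMap.toSpanSingleton ℝ (f y))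

/-- The induced connection `∇` in the coordinates of `E` (its Christoffel map): the tangential part
in the Gauss formula `D²f(u, v) = df(Γ(u, v)) + h(u, v) (-ε f)`. -/
def inducedConn (f : E → V) (y : E) : E →L[ℝ] E →L[ℝ] E :=
  (ContinuousLinearMap.compL ℝ E V E
    ((ContinuousLinearMap.fst ℝ E ℝ).comp (frame f y).inverse)).comp
      (fderiv ℝ (fderiv ℝ f) y)

/-- The centroaffine metric `h` induced by the centroaffine normal `-ε f`, `ε = ±1`, i.e. the
coefficient of `-ε f` in the Gauss formula `D²f(u, v) = df(Γ(u, v)) + h(u, v) (-ε f)`. -/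
def metric (ε : ℝ) (f : E → V) (y : E) : E →L[ℝ] E →L[ℝ] ℝ :=
  (-ε) • (ContinuousLinearMap.compL ℝ E V ℝ
    ((ContinuousLinearMap.snd ℝ E ℝ).comp (frame f y).inverse)).comp
      (fderiv ℝ (fderiv ℝ f) y)

/-- The Levi-Civita connection `∇̂` of a field `h` of nondegenerate symmetric bilinear forms
(its Christoffel map `Γ̂`), given by
`h(Γ̂(u, v), w) = ½ (∂_u h(v, w) + ∂_v h(u, w) - ∂_w h(u, v))`.
Here `R` raises the last index of a trilinear form by means of `h_y`. -/
def leviCivita (h : E → E →L[ℝ] E →L[ℝ] ℝ) (y : E) : E →L[ℝ] E →L[ℝ] E :=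
  let R : (E →L[ℝ] E →L[ℝ] ℝ) →L[ℝ] (E →L[ℝ] E) :=
    ContinuousLinearMap.compL ℝ E (E →L[ℝ] ℝ) E (h y).inverse
  let B : E →L[ℝ] E →L[ℝ] E →L[ℝ] ℝ := fderiv ℝ h y
  let swap : (E →L[ℝ] E →L[ℝ] ℝ) →L[ℝ] (E →L[ℝ] E →L[ℝ] ℝ) :=
    (ContinuousLinearMap.flipₗᵢ ℝ E E ℝ).toContinuousLinearEquiv.toContinuousLinearMap
  (1 / 2 : ℝ) • (R.comp B + R.comp B.flip - R.comp (swap.comp B.flip))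

/-- The difference tensor `K = ∇ - ∇̂`. -/
def diffTensor (ε : ℝ) (f : E → V) (y : E) : E →L[ℝ] E →L[ℝ] E :=
  inducedConn f y - leviCivita (metric ε f) y

/-- The cubic form `C = ∇h`, `C(u, v, w) = (∇_u h)(v, w)`. -/
def cubicForm (ε : ℝ) (f : E → V) (y u v w : E) : ℝ :=
  fderiv ℝ (metric ε f) y u v w
    - metric ε f y (inducedConn f y u v) w - metric ε f y v (inducedConn f y u w)

/-- The covariant derivative `(∇̂_z C)(u, v, w)` of the cubic form. -/
def covDerivCubicForm (ε : ℝ) (f : E → V) (y z u v w : E) : ℝ :=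
  fderiv ℝ (fun y' => cubicForm ε f y' u v w) y z
    - cubicForm ε f y (leviCivita (metric ε f) y z u) v w
    - cubicForm ε f y u (leviCivita (metric ε f) y z v) w
    - cubicForm ε f y u v (leviCivita (metric ε f) y z w)

/-- `f` is, on the open set `U`, a smooth centroaffine immersion (an immersion with transversal
position vector) whose centroaffine metric with respect to `-ε f`, `ε = ±1`, is positive definite.
It is used with `dim V = dim E + 1`. -/
structure IsConvexOn (ε : ℝ) (f : E → V) (U : Set E) : Prop where
  sign : ε = 1 ∨ ε = -1
  isOpen : IsOpen U
  smooth : ContDiffOn ℝ ∞ f U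
  immersion : ∀ y ∈ U, Function.Injective (fderiv ℝ f y)
  transversal : ∀ y ∈ U, ∀ u : E, fderiv ℝ f y u ≠ f y
  metric_pos : ∀ y ∈ U, ∀ u : E, u ≠ 0 → 0 < metric ε f y u u

/-- `∇̂C = 0` on `U`. -/
def IsParallelOn (ε : ℝ) (f : E → V) (U : Set E) : Prop :=
  ∀ y ∈ U, ∀ z u v w : E, covDerivCubicForm ε f y z u v w = 0

end Local

/-! ### Hypersurfaces `x : M → ℝⁿ⁺¹` on a manifold -/

section Manifold

variable {n : ℕ} {M : Type*} [TopologicalSpace M] [ChartedSpace (Eu n) M]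

/-- `x : M → ℝⁿ⁺¹` is a locally strongly convex centroaffine hypersurface and its centroaffine
metric with respect to `-ε x` is positive definite (expressed in all smooth charts of `M`). -/
def IsConvexHypersurface (ε : ℝ) (x : M → Eu (n + 1)) : Prop :=
  ∀ φ ∈ IsManifold.maximalAtlas (𝓡 n) ∞ M, IsConvexOn ε (x ∘ φ.symm) φ.target

/-- The cubic form of `x` is parallel, `∇̂C = 0` (expressed in all smooth charts of `M`). -/
def HasParallelCubicForm (ε : ℝ) (x : M → Eu (n + 1)) : Prop :=
  ∀ φ ∈ IsManifold.maximalAtlas (𝓡 n) ∞ M, IsParallelOn ε (x ∘ φ.symm) φ.target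

/-- The cubic form of `x` vanishes at no point (expressed in all smooth charts of `M`). -/
def HasNonvanishingCubicForm (ε : ℝ) (x : M → Eu (n + 1)) : Prop :=
  ∀ φ ∈ IsManifold.maximalAtlas (𝓡 n) ∞ M, ∀ y ∈ φ.target,
    ∃ u v w : Eu n, cubicForm ε (x ∘ φ.symm) y u v w ≠ 0

/-- The centroaffine metric on `T_pM`, where `T_pM` is identified with `ℝⁿ` by the preferred
chart at `p`. -/
def metricAt (ε : ℝ) (x : M → Eu (n + 1)) (p : M) : Eu n →L[ℝ] Eu n →L[ℝ] ℝ :=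
  metric ε (x ∘ (chartAt (Eu n) p).symm) (chartAt (Eu n) p p)

/-- The difference tensor on `T_pM`, where `T_pM` is identified with `ℝⁿ` by the preferred
chart at `p`. -/
def diffTensorAt (ε : ℝ) (x : M → Eu (n + 1)) (p : M) : Eu n →L[ℝ] Eu n →L[ℝ] Eu n :=
  diffTensor ε (x ∘ (chartAt (Eu n) p).symm) (chartAt (Eu n) p p)

end Manifold

/-! ### The typical basis, the cases `ℭ_m` and the decomposition of `𝒟₂`

Here `h` and `K` are the centroaffine metric and the difference tensor on one tangent space `E`.
The indices `1, …, n` of the text are `0, …, n - 1` here, so `e 0` is `e₁`. -/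

section Pointwise

variable {E : Type*} [NormedAddCommGroup E] [NormedSpace ℝ E]

/-- Typical basis: `e` is `h`-orthonormal, `e₁` is an absolute maximum of `f(u) = h(K_u u, u)` on
the `h`-unit sphere, and `K_{e₁} e_i = λ_i e_i` for all `i`. -/
structure IsTypicalBasis {n : ℕ} [NeZero n] (h : E →L[ℝ] E →L[ℝ] ℝ) (K : E →L[ℝ] E →L[ℝ] E)
    (e : Fin n → E) (lam : Fin n → ℝ) : Prop where
  orthonormal : ∀ i j, h (e i) (e j) = if i = j then 1 else 0
  isMax : ∀ u : E, h u u = 1 → h (K u u) u ≤ h (K (e 0) (e 0)) (e 0)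
  eigen : ∀ i, K (e 0) (e i) = lam i • e i

/-- Case `ℭ_m` (for `2 ≤ m ≤ n - 1`): `λ₁² - 4ε > 0`, `λ_2 = ⋯ = λ_m = λ₁ / 2` and
`λ_{m+1} = ⋯ = λ_n = μ = (λ₁ - √(λ₁² - 4ε)) / 2`, for a typical basis `e`. -/
structure IsCaseC {n : ℕ} [NeZero n] (ε : ℝ) (h : E →L[ℝ] E →L[ℝ] ℝ) (K : E →L[ℝ] E →L[ℝ] E)
    (m : ℕ) (e : Fin n → E) (lam : Fin n → ℝ) : Prop where
  typical : IsTypicalBasis h K e lam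
  discr_pos : 0 < lam 0 ^ 2 - 4 * ε
  eig_D2 : ∀ i : Fin n, 1 ≤ (i : ℕ) → (i : ℕ) < m → lam i = lam 0 / 2
  eig_D3 : ∀ i : Fin n, m ≤ (i : ℕ) → lam i = (lam 0 - √(lam 0 ^ 2 - 4 * ε)) / 2

/-- `𝒟₂ = span {e_2, …, e_m}`. -/
def D2 {n : ℕ} (m : ℕ) (e : Fin n → E) : Submodule ℝ E :=
  Submodule.span ℝ (e '' {i : Fin n | 1 ≤ (i : ℕ) ∧ (i : ℕ) < m})

/-- `L(v, ·)`, where `L(v, v') = K_v v' - (λ₁ / 2) h(v, v') e₁` (for `v, v' ∈ 𝒟₂`). -/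
def isoL (h : E →L[ℝ] E →L[ℝ] ℝ) (K : E →L[ℝ] E →L[ℝ] E) (lam1 : ℝ) (e1 v : E) : E →L[ℝ] E :=
  K v - (lam1 / 2) • (h v).smulRight e1

/-- `P_v v' = K_v L(v, v')`. -/
def opP (h : E →L[ℝ] E →L[ℝ] ℝ) (K : E →L[ℝ] E →L[ℝ] E) (lam1 : ℝ) (e1 v : E) : E →L[ℝ] E :=
  (K v).comp (isoL h K lam1 e1 v)

/-- `V_v(0)`: the eigenspace for the eigenvalue `0` of `P_v` in the `h`-orthogonal complement of
`v` in `D = 𝒟₂`. -/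
def nullV (h : E →L[ℝ] E →L[ℝ] ℝ) (K : E →L[ℝ] E →L[ℝ] E) (lam1 : ℝ) (e1 : E)
    (D : Submodule ℝ E) (v : E) : Submodule ℝ E :=
  D ⊓ LinearMap.ker (h v : E →ₗ[ℝ] ℝ) ⊓ LinearMap.ker (opP h K lam1 e1 v : E →ₗ[ℝ] E)

/-- The unit vectors `v_1, …, v_{k₀} ∈ D = 𝒟₂` give the direct sum decomposition
`𝒟₂ = {v_1} ⊕ V_{v_1}(0) ⊕ ⋯ ⊕ {v_{k₀}} ⊕ V_{v_{k₀}}(0)`. The sum `{v_j} ⊕ V_{v_j}(0)` is direct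
in any case, by orthogonality. -/
structure IsD2Decomposition (h : E →L[ℝ] E →L[ℝ] ℝ) (K : E →L[ℝ] E →L[ℝ] E) (lam1 : ℝ) (e1 : E)
    (D : Submodule ℝ E) {k₀ : ℕ} (v : Fin k₀ → E) : Prop where
  mem : ∀ j, v j ∈ D
  unit : ∀ j, h (v j) (v j) = 1
  indep : iSupIndep fun j => Submodule.span ℝ {v j} ⊔ nullV h K lam1 e1 D (v j)
  sum : ⨆ j, (Submodule.span ℝ {v j} ⊔ nullV h K lam1 e1 D (v j)) = D

end Pointwise

/-! ### Local decomposition as a Calabi product -/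

section Calabi

variable {n : ℕ} {M : Type*} [TopologicalSpace M] [ChartedSpace (Eu n) M]

/-- Near `q`, the hypersurface `x` is, up to a linear transformation of `ℝⁿ⁺¹`, the Calabi product
`(u, p, r) ↦ (e^u ψ₁(p), e^{-λu} ψ₂(r))`, `λ ≠ 0, -1`, of two locally strongly convex centroaffine
hypersurfaces `ψ₁ : U₁ → ℝ^{n₁+1}`, `ψ₂ : U₂ → ℝ^{n₂+1}` of positive dimensions `n₁`, `n₂` with
parallel cubic form; `Φ` is a diffeomorphism from `I × U₁ × U₂` onto a neighbourhood of `q`. -/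
def IsCalabiProductNear (x : M → Eu (n + 1)) (q : M) : Prop :=
  ∃ n₁ n₂ : ℕ, 1 ≤ n₁ ∧ 1 ≤ n₂ ∧ n₁ + n₂ + 1 = n ∧
  ∃ lam : ℝ, lam ≠ 0 ∧ lam ≠ -1 ∧
  ∃ (I : Set ℝ) (U₁ : Set (Eu n₁)) (U₂ : Set (Eu n₂))
    (ψ₁ : Eu n₁ → Eu (n₁ + 1)) (ψ₂ : Eu n₂ → Eu (n₂ + 1))
    (A : (Eu (n₁ + 1) × Eu (n₂ + 1)) ≃L[ℝ] Eu (n + 1))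
    (Φ : OpenPartialHomeomorph (ℝ × Eu n₁ × Eu n₂) M),
    (∃ ε₁ : ℝ, IsConvexOn ε₁ ψ₁ U₁ ∧ IsParallelOn ε₁ ψ₁ U₁) ∧
    (∃ ε₂ : ℝ, IsConvexOn ε₂ ψ₂ U₂ ∧ IsParallelOn ε₂ ψ₂ U₂) ∧
    Φ.source = I ×ˢ U₁ ×ˢ U₂ ∧ q ∈ Φ.target ∧
    ContMDiffOn 𝓘(ℝ, ℝ × Eu n₁ × Eu n₂) (𝓡 n) ∞ Φ Φ.source ∧
    ContMDiffOn (𝓡 n) 𝓘(ℝ, ℝ × Eu n₁ × Eu n₂) ∞ Φ.symm Φ.target ∧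
    ∀ u ∈ I, ∀ p ∈ U₁, ∀ r ∈ U₂,
      x (Φ (u, p, r)) = A (Real.exp u • ψ₁ p, Real.exp (-lam * u) • ψ₂ r)

/-- Near `q`, the hypersurface `x` is, up to a linear transformation of `ℝⁿ⁺¹`, the Calabi product
`(u, p) ↦ (e^u ψ₁(p), e^{-λu})`, `λ ≠ 0, -1`, of a locally strongly convex centroaffine
hypersurface `ψ₁ : U₁ → ℝ^{n₁+1}`, `n₁ = n - 1`, with parallel cubic form and a point;
`Φ` is a diffeomorphism from `I × U₁` onto a neighbourhood of `q`. -/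
def IsCalabiProductWithPointNear (x : M → Eu (n + 1)) (q : M) : Prop :=
  ∃ n₁ : ℕ, 1 ≤ n₁ ∧ n₁ + 1 = n ∧
  ∃ lam : ℝ, lam ≠ 0 ∧ lam ≠ -1 ∧
  ∃ (I : Set ℝ) (U₁ : Set (Eu n₁)) (ψ₁ : Eu n₁ → Eu (n₁ + 1))
    (A : (Eu (n₁ + 1) × ℝ) ≃L[ℝ] Eu (n + 1))
    (Φ : OpenPartialHomeomorph (ℝ × Eu n₁) M),
    (∃ ε₁ : ℝ, IsConvexOn ε₁ ψ₁ U₁ ∧ IsParallelOn ε₁ ψ₁ U₁) ∧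
    Φ.source = I ×ˢ U₁ ∧ q ∈ Φ.target ∧
    ContMDiffOn 𝓘(ℝ, ℝ × Eu n₁) (𝓡 n) ∞ Φ Φ.source ∧
    ContMDiffOn (𝓡 n) 𝓘(ℝ, ℝ × Eu n₁) ∞ Φ.symm Φ.target ∧
    ∀ u ∈ I, ∀ p ∈ U₁,
      x (Φ (u, p)) = A (Real.exp u • ψ₁ p, Real.exp (-lam * u))

end Calabi

end

end Centroaffine

set_option maxSynthPendingDepth 3

/-!
Let `D` be the flat connection along the immersion `f` and let `∇̂` be the Levi-Civita connection of
`h`, extended by `∇̂ f = 0`. The operators `N_z = D_z - ∇̂_z` act on the ambient space by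
`N_z (df u) = df (K_z u) - ε h(z, u) f` and `N_z f = df z`. The cubic form is parallel exactly when
`∂_w N_z = N_{∇̂_w z} + [N_w, N_z]`, so at every point they form a Lie triple system, whose triple
product is the curvature.

If `k₀ = 1`, this forces `K_v z = h(v, z) t + h(t, z) v` with `v = v₁` and `t = K_v v`, and then
`A = N_t` commutes with every `N_z` and satisfies `(A - α) (A - ε) = 0` for `α = h(t, t)`. Here
`α ≥ λ₁² / 4 > max 0 ε` by the Cauchy-Schwarz inequality. By uniqueness for linear differential
equations the constant operator `A` keeps these properties along curves, hence on all of `M`. So the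
ambient space is the sum of the eigenspaces of `A`. The form `h(t, ·)` is closed; rescaling the
projections of `f` to the eigenspaces by exponentials of its potential makes each of them constant
in the direction of `t` and of the other factor, which is the Calabi product decomposition.
-/

namespace Centroaffine

/-! ### Frames and the Gauss formula -/

section Calculus

variable {E F G H : Type*} [NormedAddCommGroup E] [NormedSpace ℝ E] [NormedAddCommGroup F]
  [NormedSpace ℝ F] [NormedAddCommGroup G] [NormedSpace ℝ G] [NormedAddCommGroup H]
  [NormedSpace ℝ H] {U : Set E} {y : E} {f f' : E → F}

lemma fderiv_eval {A : E → F →L[ℝ] G} {b : E → F} (hA : DifferentiableAt ℝ A y)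
    (hb : DifferentiableAt ℝ b y) (w : E) :
    fderiv ℝ (fun y => A y (b y)) y w = fderiv ℝ A y w (b y) + A y (fderiv ℝ b y w) := by
  rw [fderiv_clm_apply hA hb]
  simp [add_comm]

lemma fderiv_eval_const {A : E → F →L[ℝ] G} (hA : DifferentiableAt ℝ A y) (b : F) (w : E) :
    fderiv ℝ (fun y => A y b) y w = fderiv ℝ A y w b := by
  rw [fderiv_eval hA (differentiableAt_const b)]
  simp

lemma fderiv_eval_const₂ {A : E → F →L[ℝ] G →L[ℝ] H} (hA : DifferentiableAt ℝ A y) (b : F)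
    (c : G) (w : E) : fderiv ℝ (fun y => A y b c) y w = fderiv ℝ A y w b c := by
  rw [fderiv_eval_const (hA.clm_apply (differentiableAt_const b)), fderiv_eval_const hA]

lemma fderiv_lie {R : Type*} [NormedRing R] [NormedAlgebra ℝ R] {a b : E → R}
    (ha : DifferentiableAt ℝ a y) (hb : DifferentiableAt ℝ b y) (w : E) :
    fderiv ℝ (fun y => ⁅a y, b y⁆) y w = ⁅fderiv ℝ a y w, b y⁆ + ⁅a y, fderiv ℝ b y w⁆ := by
  simp only [Ring.lie_def]
  rw [fderiv_fun_sub (ha.fun_mul hb) (hb.fun_mul ha), fderiv_fun_mul' ha hb, fderiv_fun_mul' hb ha]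
  simp only [sub_apply, add_apply, smul_apply, smul_eq_mul, MulOpposite.smul_eq_mul_unop,
    MulOpposite.unop_op]
  abel

lemma lie_clm_apply (A B : F →L[ℝ] F) (x : F) : ⁅A, B⁆ x = A (B x) - B (A x) := by
  simp [Ring.lie_def]

lemma fderiv_congr_on (hU : IsOpen U) (hy : y ∈ U) (h : ∀ y ∈ U, f y = f' y) :
    fderiv ℝ f y = fderiv ℝ f' y :=
  Filter.EventuallyEq.fderiv_eq (Filter.eventually_of_mem (hU.mem_nhds hy) h)

lemma differentiableAt_of_contDiffOn (hf : ContDiffOn ℝ ∞ f U) (hU : IsOpen U) (hy : y ∈ U) :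
    DifferentiableAt ℝ f y :=
  (hf.differentiableOn (by simp)).differentiableAt (hU.mem_nhds hy)

lemma contDiffOn_fderiv (hf : ContDiffOn ℝ ∞ f U) (hU : IsOpen U) :
    ContDiffOn ℝ ∞ (fderiv ℝ f) U :=
  hf.fderiv_of_isOpen hU (by simp)

lemma fderiv_fderiv_symm (hf : ContDiffOn ℝ ∞ f U) (hU : IsOpen U) (hy : y ∈ U) (u v : E) :
    fderiv ℝ (fderiv ℝ f) y u v = fderiv ℝ (fderiv ℝ f) y v u :=
  ((hf.contDiffAt (hU.mem_nhds hy)).isSymmSndFDerivAt (by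
    rw [minSmoothness_of_isRCLikeNormedField]; exact WithTop.coe_le_coe.2 le_top)) u v

lemma isInvertible_of_injective [FiniteDimensional ℝ E] [FiniteDimensional ℝ F] {L : E →L[ℝ] F}
    (hL : Function.Injective L) (hd : Module.finrank ℝ E = Module.finrank ℝ F) :
    L.IsInvertible :=
  ⟨(LinearEquiv.ofInjectiveOfFinrankEq L.toLinearMap hL hd).toContinuousLinearEquiv, by
    ext; rfl⟩

end Calculus

section Frame

variable {E V : Type*} [NormedAddCommGroup E] [NormedSpace ℝ E]
  [NormedAddCommGroup V] [NormedSpace ℝ V] {ε : ℝ} {f : E → V} {U : Set E} {y : E}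

@[simp] lemma frame_apply (f : E → V) (y : E) (p : E × ℝ) :
    frame f y p = fderiv ℝ f y p.1 + p.2 • f y := by
  simp [frame]

lemma isInvertible_frame [FiniteDimensional ℝ E] [FiniteDimensional ℝ V]
    (hd : Module.finrank ℝ V = Module.finrank ℝ E + 1)
    (hinj : ∀ u : E, ∀ s : ℝ, fderiv ℝ f y u + s • f y = 0 → u = 0 ∧ s = 0) :
    (frame f y).IsInvertible := by
  refine isInvertible_of_injective ((injective_iff_map_eq_zero _).2 fun p hp => ?_) ?_
  · exact Prod.ext_iff.2 (hinj p.1 p.2 (by simpa using hp))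
  · rw [Module.finrank_prod, hd, Module.finrank_self]

lemma IsConvexOn.eq_zero_of_frame_eq_zero (hf : IsConvexOn ε f U) (hy : y ∈ U) (u : E) (s : ℝ)
    (h : fderiv ℝ f y u + s • f y = 0) : u = 0 ∧ s = 0 := by
  have hs : s = 0 := by
    by_contra hs
    refine hf.transversal y hy (-s⁻¹ • u) ?_
    rw [map_smul, eq_neg_of_add_eq_zero_left h, smul_neg, neg_smul, neg_neg, smul_smul,
      inv_mul_cancel₀ hs, one_smul]
  subst hs
  exact ⟨hf.immersion y hy (by simpa using h), rfl⟩

lemma IsConvexOn.isInvertible_frame [FiniteDimensional ℝ E] [FiniteDimensional ℝ V]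
    (hf : IsConvexOn ε f U) (hd : Module.finrank ℝ V = Module.finrank ℝ E + 1) (hy : y ∈ U) :
    (frame f y).IsInvertible :=
  Centroaffine.isInvertible_frame hd (hf.eq_zero_of_frame_eq_zero hy)

lemma IsConvexOn.sign_mul_self (hf : IsConvexOn ε f U) : ε * ε = 1 := by
  rcases hf.sign with h | h <;> simp [h]

lemma frame_inverse_eq (hinv : (frame f y).IsInvertible) {w : V} {a : E} {s : ℝ}
    (h : w = fderiv ℝ f y a + s • f y) : (frame f y).inverse w = (a, s) := by
  have : w = frame f y (a, s) := by simpa using h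
  rw [this, hinv.inverse_apply_self]

lemma frame_eq_iff (hinv : (frame f y).IsInvertible) {a b : E} {s r : ℝ}
    (h : fderiv ℝ f y a + s • f y = fderiv ℝ f y b + r • f y) : a = b ∧ s = r := by
  have := hinv.injective (a₁ := (a, s)) (a₂ := (b, r)) (by simpa using h)
  simpa using this

lemma exists_frame_coord (hinv : (frame f y).IsInvertible) (w : V) :
    w = fderiv ℝ f y ((frame f y).inverse w).1 + ((frame f y).inverse w).2 • f y := by
  have := hinv.self_apply_inverse w
  rw [frame_apply] at this
  exact this.symm

lemma inducedConn_apply (u v : E) : inducedConn f y u v =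
    ((frame f y).inverse (fderiv ℝ (fderiv ℝ f) y u v)).1 := by
  simp [inducedConn]

lemma metric_apply (u v : E) : metric ε f y u v =
    -ε * ((frame f y).inverse (fderiv ℝ (fderiv ℝ f) y u v)).2 := by
  simp [metric]

lemma gauss_formula (hε : ε * ε = 1) (hinv : (frame f y).IsInvertible) (u v : E) :
    fderiv ℝ (fderiv ℝ f) y u v =
      fderiv ℝ f y (inducedConn f y u v) + (-ε * metric ε f y u v) • f y := by
  rw [metric_apply, inducedConn_apply, ← mul_assoc, neg_mul_neg, hε, one_mul]
  exact exists_frame_coord hinv _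

lemma gauss_unique (hε : ε * ε = 1) (hinv : (frame f y).IsInvertible) {u v a : E} {s : ℝ}
    (h : fderiv ℝ (fderiv ℝ f) y u v = fderiv ℝ f y a + (-ε * s) • f y) :
    inducedConn f y u v = a ∧ metric ε f y u v = s := by
  rw [inducedConn_apply, metric_apply, frame_inverse_eq hinv h]
  refine ⟨rfl, ?_⟩
  simp only
  rw [← mul_assoc, neg_mul_neg, hε, one_mul]

lemma IsConvexOn.inducedConn_symm (hf : IsConvexOn ε f U) (hy : y ∈ U) (u v : E) :
    inducedConn f y u v = inducedConn f y v u := by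
  rw [inducedConn_apply, inducedConn_apply, fderiv_fderiv_symm hf.smooth hf.isOpen hy]

lemma IsConvexOn.metric_symm (hf : IsConvexOn ε f U) (hy : y ∈ U) (u v : E) :
    metric ε f y u v = metric ε f y v u := by
  rw [metric_apply, metric_apply, fderiv_fderiv_symm hf.smooth hf.isOpen hy]

end Frame

section Smoothness

variable {E V : Type*} [NormedAddCommGroup E] [NormedSpace ℝ E]
  [NormedAddCommGroup V] [NormedSpace ℝ V] {ε : ℝ} {f : E → V} {U : Set E}

lemma contDiffOn_frame (hf : ContDiffOn ℝ ∞ f U) (hU : IsOpen U) :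
    ContDiffOn ℝ ∞ (frame f) U := by
  have h1 := contDiffOn_fderiv hf hU
  have : frame f = fun y => (fderiv ℝ f y).comp (ContinuousLinearMap.fst ℝ E ℝ) +
      ((ContinuousLinearMap.toSpanSingletonCLE (𝕜 := ℝ) (E := V)) (f y)).comp
        (ContinuousLinearMap.snd ℝ E ℝ) := by
    ext y p <;> simp
  rw [this]
  exact (h1.clm_comp contDiffOn_const).add
    (((ContinuousLinearEquiv.contDiff _).comp_contDiffOn hf).clm_comp contDiffOn_const)

variable [FiniteDimensional ℝ E] [FiniteDimensional ℝ V]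

lemma IsConvexOn.contDiffOn_inverse_frame (hf : IsConvexOn ε f U)
    (hd : Module.finrank ℝ V = Module.finrank ℝ E + 1) :
    ContDiffOn ℝ ∞ (fun y => (frame f y).inverse) U := fun y hy =>
  ((hf.isInvertible_frame hd hy).contDiffAt_map_inverse (n := ∞)).comp_contDiffWithinAt y
    (contDiffOn_frame hf.smooth hf.isOpen y hy)

lemma IsConvexOn.contDiffOn_inducedConn (hf : IsConvexOn ε f U)
    (hd : Module.finrank ℝ V = Module.finrank ℝ E + 1) :
    ContDiffOn ℝ ∞ (inducedConn f) U := by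
  have h1 := hf.contDiffOn_inverse_frame hd
  have h2 := contDiffOn_fderiv (contDiffOn_fderiv hf.smooth hf.isOpen) hf.isOpen
  exact ((ContinuousLinearMap.contDiff _).comp_contDiffOn
    (contDiffOn_const.clm_comp h1)).clm_comp h2

lemma IsConvexOn.contDiffOn_metric (hf : IsConvexOn ε f U)
    (hd : Module.finrank ℝ V = Module.finrank ℝ E + 1) :
    ContDiffOn ℝ ∞ (metric ε f) U := by
  have h1 := hf.contDiffOn_inverse_frame hd
  have h2 := contDiffOn_fderiv (contDiffOn_fderiv hf.smooth hf.isOpen) hf.isOpen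
  exact ContDiffOn.const_smul _ (((ContinuousLinearMap.contDiff _).comp_contDiffOn
    (contDiffOn_const.clm_comp h1)).clm_comp h2)

lemma isInvertible_of_pos {h : E →L[ℝ] E →L[ℝ] ℝ} (hpos : ∀ u, u ≠ 0 → 0 < h u u) :
    h.IsInvertible := by
  refine isInvertible_of_injective ((injective_iff_map_eq_zero h).2 fun u hu => ?_) ?_
  · by_contra hne
    simpa [hu] using hpos u hne
  · rw [← (LinearMap.toContinuousLinearMap (𝕜 := ℝ) (E := E) (F' := ℝ)).finrank_eq]
    exact Subspace.dual_finrank_eq.symm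

lemma contDiffOn_leviCivita {h : E → E →L[ℝ] E →L[ℝ] ℝ} (hh : ContDiffOn ℝ ∞ h U)
    (hU : IsOpen U) (hpos : ∀ y ∈ U, ∀ u, u ≠ 0 → 0 < h y u u) :
    ContDiffOn ℝ ∞ (leviCivita h) U := by
  have h1 : ContDiffOn ℝ ∞ (fun y => (h y).inverse) U := fun y hy =>
    ((isInvertible_of_pos (hpos y hy)).contDiffAt_map_inverse (n := ∞)).comp_contDiffWithinAt y
      (hh y hy)
  have h2 : ContDiffOn ℝ ∞ (fun y => ContinuousLinearMap.compL ℝ E (E →L[ℝ] ℝ) E (h y).inverse) U :=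
    (ContinuousLinearMap.contDiff _).comp_contDiffOn h1
  have h3 := contDiffOn_fderiv hh hU
  have h4 : ContDiffOn ℝ ∞ (fun y => (fderiv ℝ h y).flip) U :=
    (ContinuousLinearMap.flipₗᵢ ℝ E E (E →L[ℝ] ℝ)).contDiff.comp_contDiffOn h3
  exact ContDiffOn.const_smul _ (((h2.clm_comp h3).add (h2.clm_comp h4)).sub
    (h2.clm_comp (contDiffOn_const.clm_comp h4)))

lemma IsConvexOn.contDiffOn_leviCivita (hf : IsConvexOn ε f U)
    (hd : Module.finrank ℝ V = Module.finrank ℝ E + 1) :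
    ContDiffOn ℝ ∞ (leviCivita (metric ε f)) U :=
  Centroaffine.contDiffOn_leviCivita (hf.contDiffOn_metric hd) hf.isOpen hf.metric_pos

lemma IsConvexOn.contDiffOn_diffTensor (hf : IsConvexOn ε f U)
    (hd : Module.finrank ℝ V = Module.finrank ℝ E + 1) :
    ContDiffOn ℝ ∞ (diffTensor ε f) U :=
  (hf.contDiffOn_inducedConn hd).sub (hf.contDiffOn_leviCivita hd)

end Smoothness

section Riemannian

variable {E : Type*} [NormedAddCommGroup E] [NormedSpace ℝ E] {U : Set E} {y : E}

lemma ext_of_pos {h : E →L[ℝ] E →L[ℝ] ℝ} (hpos : ∀ u, u ≠ 0 → 0 < h u u) {a b : E}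
    (hab : ∀ w, h a w = h b w) : a = b := by
  by_contra hne
  refine (hpos (a - b) (sub_ne_zero.2 hne)).ne' ?_
  rw [map_sub h, sub_apply, hab, sub_self]

lemma fderiv_symm_of_symm {h : E → E →L[ℝ] E →L[ℝ] ℝ} (hU : IsOpen U) (hy : y ∈ U)
    (hh : ContDiffOn ℝ ∞ h U) (hsymm : ∀ y ∈ U, ∀ u v, h y u v = h y v u) (w u v : E) :
    fderiv ℝ h y w u v = fderiv ℝ h y w v u := by
  have hd := differentiableAt_of_contDiffOn hh hU hy
  rw [← fderiv_eval_const₂ hd, ← fderiv_eval_const₂ hd,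
    fderiv_congr_on hU hy fun y hy => hsymm y hy u v]

/-- `h` is a smooth Riemannian metric on the open set `U`. -/
structure IsRiemannianOn (h : E → E →L[ℝ] E →L[ℝ] ℝ) (U : Set E) : Prop where
  isOpen : IsOpen U
  smooth : ContDiffOn ℝ ∞ h U
  symm : ∀ y ∈ U, ∀ u v, h y u v = h y v u
  pos : ∀ y ∈ U, ∀ u, u ≠ 0 → 0 < h y u u

lemma IsConvexOn.isRiemannianOn {V : Type*} [NormedAddCommGroup V] [NormedSpace ℝ V]
    [FiniteDimensional ℝ E] [FiniteDimensional ℝ V] {ε : ℝ} {f : E → V} (hf : IsConvexOn ε f U)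
    (hd : Module.finrank ℝ V = Module.finrank ℝ E + 1) : IsRiemannianOn (metric ε f) U :=
  ⟨hf.isOpen, hf.contDiffOn_metric hd, fun _ hy => hf.metric_symm hy, hf.metric_pos⟩

variable [FiniteDimensional ℝ E] {h : E → E →L[ℝ] E →L[ℝ] ℝ}

lemma leviCivita_inner (hpos : ∀ u, u ≠ 0 → 0 < h y u u)
    (u v w : E) :
    h y (leviCivita h y u v) w = 1 / 2 * (fderiv ℝ h y u v w + fderiv ℝ h y v u w
      - fderiv ℝ h y w u v) := by
  have hi := isInvertible_of_pos hpos
  simp only [leviCivita]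
  simp [ContinuousLinearMap.flipₗᵢ, hi.self_apply_inverse]

lemma IsRiemannianOn.leviCivita_symm (hh : IsRiemannianOn h U) (hy : y ∈ U) (u v : E) :
    leviCivita h y u v = leviCivita h y v u := by
  have hs := fderiv_symm_of_symm hh.isOpen hy hh.smooth hh.symm
  refine ext_of_pos (hh.pos y hy) fun w => ?_
  rw [leviCivita_inner (hh.pos y hy), leviCivita_inner (hh.pos y hy),
    hs w u v]
  ring

lemma IsRiemannianOn.fderiv_apply (hh : IsRiemannianOn h U) (hy : y ∈ U) (w u v : E) :
    fderiv ℝ h y w u v = h y (leviCivita h y w u) v + h y u (leviCivita h y w v) := by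
  have hs := fderiv_symm_of_symm hh.isOpen hy hh.smooth hh.symm
  rw [hh.symm y hy u, leviCivita_inner (hh.pos y hy),
    leviCivita_inner (hh.pos y hy), hs w v u]
  ring

lemma IsRiemannianOn.leviCivita_unique (hh : IsRiemannianOn h U) (hy : y ∈ U) {G : E → E → E}
    (hG : ∀ u v, G u v = G v u)
    (hc : ∀ w u v, fderiv ℝ h y w u v = h y (G w u) v + h y u (G w v)) (u v : E) :
    leviCivita h y u v = G u v := by
  refine ext_of_pos (hh.pos y hy) fun w => ?_
  rw [leviCivita_inner (hh.pos y hy), hc, hc, hc, hG v u, hG w u, hG w v,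
    hh.symm y hy v, hh.symm y hy u (G v w)]
  ring

end Riemannian

section Codazzi

variable {E V : Type*} [NormedAddCommGroup E] [NormedSpace ℝ E]
  [NormedAddCommGroup V] [NormedSpace ℝ V] {ε : ℝ} {f : E → V} {U : Set E} {y : E}

lemma inducedConn_eq (u v : E) : inducedConn f y u v =
    leviCivita (metric ε f) y u v + diffTensor ε f y u v := by
  simp [diffTensor]

variable [FiniteDimensional ℝ E] [FiniteDimensional ℝ V]

lemma IsConvexOn.fderiv_fderiv_fderiv (hf : IsConvexOn ε f U)
    (hd : Module.finrank ℝ V = Module.finrank ℝ E + 1) (hy : y ∈ U) (w u v : E) :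
    fderiv ℝ (fderiv ℝ (fderiv ℝ f)) y w u v =
      fderiv ℝ f y (inducedConn f y w (inducedConn f y u v) + fderiv ℝ (inducedConn f) y w u v +
        (-ε * metric ε f y u v) • w) +
      (-ε * (metric ε f y w (inducedConn f y u v) + fderiv ℝ (metric ε f) y w u v)) • f y := by
  have d0 := differentiableAt_of_contDiffOn hf.smooth hf.isOpen hy
  have s1 := contDiffOn_fderiv hf.smooth hf.isOpen
  have d1 := differentiableAt_of_contDiffOn s1 hf.isOpen hy
  have d2 := differentiableAt_of_contDiffOn (contDiffOn_fderiv s1 hf.isOpen) hf.isOpen hy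
  have dG := differentiableAt_of_contDiffOn (hf.contDiffOn_inducedConn hd) hf.isOpen hy
  have dh := differentiableAt_of_contDiffOn (hf.contDiffOn_metric hd) hf.isOpen hy
  have dG1 : DifferentiableAt ℝ (fun y => inducedConn f y u v) y := by fun_prop
  have dh1 : DifferentiableAt ℝ (fun y => metric ε f y u v) y := by fun_prop
  rw [← fderiv_eval_const₂ d2, fderiv_congr_on hf.isOpen hy fun y hy =>
    gauss_formula hf.sign_mul_self (hf.isInvertible_frame hd hy) u v,
    fderiv_fun_add (d1.clm_apply dG1) ((dh1.const_mul (-ε)).fun_smul d0), add_apply,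
    fderiv_eval d1 dG1, fderiv_eval_const₂ dG, fderiv_fun_smul (dh1.const_mul (-ε)) d0,
    fderiv_const_mul dh1]
  simp only [add_apply, smul_apply, ContinuousLinearMap.smulRight_apply,
    fderiv_eval_const₂ dh]
  rw [gauss_formula hf.sign_mul_self (hf.isInvertible_frame hd hy)]
  simp only [map_add, map_smul, smul_eq_mul]
  module

lemma IsConvexOn.cubicForm_symm_left (hf : IsConvexOn ε f U)
    (hd : Module.finrank ℝ V = Module.finrank ℝ E + 1) (hy : y ∈ U) (u v w : E) :
    cubicForm ε f y u v w = cubicForm ε f y v u w := by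
  have hs := fderiv_fderiv_symm (contDiffOn_fderiv hf.smooth hf.isOpen) hf.isOpen hy u v
  have hs' := congrArg (fun L => L w) hs
  simp only [hf.fderiv_fderiv_fderiv hd hy] at hs'
  have h1 := (frame_eq_iff (hf.isInvertible_frame hd hy) hs').2
  have hε : -ε ≠ 0 := by rcases hf.sign with h | h <;> simp [h]
  have h2 := mul_left_cancel₀ hε h1
  simp only [cubicForm]
  rw [hf.inducedConn_symm hy v u]
  linarith

lemma IsConvexOn.cubicForm_symm_right (hf : IsConvexOn ε f U)
    (hd : Module.finrank ℝ V = Module.finrank ℝ E + 1) (hy : y ∈ U) (u v w : E) :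
    cubicForm ε f y u v w = cubicForm ε f y u w v := by
  have hs := fderiv_symm_of_symm hf.isOpen hy (hf.contDiffOn_metric hd)
    (fun y hy => hf.metric_symm hy) u v w
  simp only [cubicForm]
  rw [hs, hf.metric_symm hy _ w, hf.metric_symm hy v]
  ring

lemma IsConvexOn.diffTensor_symm (hf : IsConvexOn ε f U)
    (hd : Module.finrank ℝ V = Module.finrank ℝ E + 1) (hy : y ∈ U) (u v : E) :
    diffTensor ε f y u v = diffTensor ε f y v u := by
  simp only [diffTensor, sub_apply]
  rw [hf.inducedConn_symm hy, (hf.isRiemannianOn hd).leviCivita_symm hy]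

lemma IsConvexOn.cubicForm_eq (hf : IsConvexOn ε f U)
    (hd : Module.finrank ℝ V = Module.finrank ℝ E + 1) (hy : y ∈ U) (u v w : E) :
    cubicForm ε f y u v w = -2 * metric ε f y (diffTensor ε f y u v) w := by
  have key : ∀ u v w, cubicForm ε f y u v w = -metric ε f y (diffTensor ε f y u v) w
      - metric ε f y (diffTensor ε f y u w) v := by
    intro u v w
    simp only [cubicForm, (hf.isRiemannianOn hd).fderiv_apply hy u v w, diffTensor, sub_apply]
    rw [hf.metric_symm hy v, hf.metric_symm hy v, map_sub, map_sub, sub_apply, sub_apply]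
    ring
  have k1 := key u v w
  have k2 := key v w u
  have k3 := key w u v
  have s1 := hf.cubicForm_symm_left hd hy w u v
  have s2 := hf.cubicForm_symm_right hd hy u w v
  have s3 := hf.cubicForm_symm_right hd hy v w u
  have s4 := hf.cubicForm_symm_left hd hy v u w
  rw [hf.diffTensor_symm hd hy v u] at k2
  rw [hf.diffTensor_symm hd hy w v, hf.diffTensor_symm hd hy w u] at k3
  linarith

lemma IsConvexOn.diffTensor_adjoint (hf : IsConvexOn ε f U)
    (hd : Module.finrank ℝ V = Module.finrank ℝ E + 1) (hy : y ∈ U) (u v w : E) :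
    metric ε f y (diffTensor ε f y u v) w = metric ε f y v (diffTensor ε f y u w) := by
  have h1 := hf.cubicForm_eq hd hy u v w
  have h2 := hf.cubicForm_eq hd hy u w v
  have h3 := hf.cubicForm_symm_right hd hy u v w
  rw [hf.metric_symm hy v]
  linarith

lemma IsConvexOn.fderiv_metric_eval (hf : IsConvexOn ε f U)
    (hd : Module.finrank ℝ V = Module.finrank ℝ E + 1) (hy : y ∈ U) {a : E → E}
    (ha : DifferentiableAt ℝ a y) (z w : E) :
    fderiv ℝ (fun y => metric ε f y (a y) w) y z =
      metric ε f y (fderiv ℝ a y z + leviCivita (metric ε f) y z (a y)) w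
        + metric ε f y (a y) (leviCivita (metric ε f) y z w) := by
  have dh := differentiableAt_of_contDiffOn (hf.contDiffOn_metric hd) hf.isOpen hy
  rw [fderiv_eval_const (dh.clm_apply ha), fderiv_eval dh ha, add_apply,
    (hf.isRiemannianOn hd).fderiv_apply hy, map_add, add_apply]
  ring

lemma IsConvexOn.fderiv_diffTensor (hf : IsConvexOn ε f U) (hp : IsParallelOn ε f U)
    (hd : Module.finrank ℝ V = Module.finrank ℝ E + 1) (hy : y ∈ U) (z u v : E) :
    fderiv ℝ (diffTensor ε f) y z u v =
      diffTensor ε f y (leviCivita (metric ε f) y z u) v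
      + diffTensor ε f y u (leviCivita (metric ε f) y z v)
      - leviCivita (metric ε f) y z (diffTensor ε f y u v) := by
  have dK := differentiableAt_of_contDiffOn (hf.contDiffOn_diffTensor hd) hf.isOpen hy
  have dh := differentiableAt_of_contDiffOn (hf.contDiffOn_metric hd) hf.isOpen hy
  have dK1 : DifferentiableAt ℝ (fun y => diffTensor ε f y u v) y :=
    (dK.clm_apply (differentiableAt_const u)).clm_apply (differentiableAt_const v)
  refine ext_of_pos (hf.metric_pos y hy) fun w => ?_
  have h := hp y hy z u v w
  have dm : DifferentiableAt ℝ (fun y => metric ε f y (diffTensor ε f y u v) w) y :=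
    (dh.clm_apply dK1).clm_apply (differentiableAt_const w)
  simp only [covDerivCubicForm] at h
  rw [fderiv_congr_on hf.isOpen hy (fun y hy => hf.cubicForm_eq hd hy u v w),
    fderiv_const_mul dm, smul_apply, hf.fderiv_metric_eval hd hy dK1,
    fderiv_eval_const₂ dK] at h
  simp only [hf.cubicForm_eq hd hy, smul_eq_mul, map_add, add_apply] at h
  simp only [map_add, map_sub, add_apply, sub_apply]
  linarith

end Codazzi

/-! ### The operators `D - ∇̂` -/

section GaussOp

variable {E V : Type*} [NormedAddCommGroup E] [NormedSpace ℝ E]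
  [NormedAddCommGroup V] [NormedSpace ℝ V] {ε : ℝ} {f : E → V} {U : Set E} {y : E}

/-- The operator `(u, s) ↦ (K_z u + s z, -ε h(z, u))`, in the frame `(df, f)`. -/
noncomputable def frameOp (ε : ℝ) (f : E → V) (y : E) : E →L[ℝ] (E × ℝ →L[ℝ] E × ℝ) :=
  (ContinuousLinearMap.compL ℝ (E × ℝ) E (E × ℝ) (ContinuousLinearMap.inl ℝ E ℝ)).comp
    (((ContinuousLinearMap.compL ℝ (E × ℝ) E E).flip (ContinuousLinearMap.fst ℝ E ℝ)).comp
        (diffTensor ε f y) +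
      ContinuousLinearMap.smulRightL ℝ (E × ℝ) E (ContinuousLinearMap.snd ℝ E ℝ)) +
  (-ε) • (ContinuousLinearMap.compL ℝ (E × ℝ) ℝ (E × ℝ) (ContinuousLinearMap.inr ℝ E ℝ)).comp
    (((ContinuousLinearMap.compL ℝ (E × ℝ) E ℝ).flip (ContinuousLinearMap.fst ℝ E ℝ)).comp
      (metric ε f y))

lemma frameOp_apply (z u : E) (s : ℝ) :
    frameOp ε f y z (u, s) = (diffTensor ε f y z u + s • z, -ε * metric ε f y z u) := by
  simp [frameOp]

/-- The difference `D_z - ∇̂_z` of the flat connection and the Levi-Civita connection (extended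
trivially to the line spanned by the position vector), as an endomorphism of the ambient space. -/
noncomputable def gaussOp (ε : ℝ) (f : E → V) (y : E) : E →L[ℝ] V →L[ℝ] V :=
  (ContinuousLinearMap.compL ℝ V (E × ℝ) V (frame f y)).comp
    (((ContinuousLinearMap.compL ℝ V (E × ℝ) (E × ℝ)).flip (frame f y).inverse).comp
      (frameOp ε f y))

lemma gaussOp_fderiv (hinv : (frame f y).IsInvertible) (z u : E) :
    gaussOp ε f y z (fderiv ℝ f y u) =
      fderiv ℝ f y (diffTensor ε f y z u) + (-ε * metric ε f y z u) • f y := by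
  simp only [gaussOp, ContinuousLinearMap.comp_apply, ContinuousLinearMap.compL_apply,
    ContinuousLinearMap.flip_apply]
  rw [frame_inverse_eq hinv (a := u) (s := 0) (by simp), frameOp_apply, frame_apply]
  simp

lemma gaussOp_self (hinv : (frame f y).IsInvertible) (z : E) :
    gaussOp ε f y z (f y) = fderiv ℝ f y z := by
  simp only [gaussOp, ContinuousLinearMap.comp_apply, ContinuousLinearMap.compL_apply,
    ContinuousLinearMap.flip_apply]
  rw [frame_inverse_eq hinv (a := 0) (s := 1) (by simp), frameOp_apply, frame_apply]
  simp

lemma gaussOp_fderiv' (hε : ε * ε = 1) (hinv : (frame f y).IsInvertible) (z u : E) :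
    gaussOp ε f y z (fderiv ℝ f y u) =
      fderiv ℝ (fderiv ℝ f) y z u - fderiv ℝ f y (leviCivita (metric ε f) y z u) := by
  rw [gaussOp_fderiv hinv, gauss_formula hε hinv, inducedConn_eq (ε := ε), map_add]
  abel

lemma frame_hom_ext (hinv : (frame f y).IsInvertible) {A B : V →L[ℝ] V}
    (h1 : ∀ u, A (fderiv ℝ f y u) = B (fderiv ℝ f y u)) (h2 : A (f y) = B (f y)) : A = B := by
  ext x
  rw [exists_frame_coord hinv x, map_add, map_add, map_smul, map_smul, h1, h2]

variable [FiniteDimensional ℝ E] [FiniteDimensional ℝ V]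

lemma IsConvexOn.contDiffOn_gaussOp (hf : IsConvexOn ε f U)
    (hd : Module.finrank ℝ V = Module.finrank ℝ E + 1) :
    ContDiffOn ℝ ∞ (gaussOp ε f) U := by
  have h1 := contDiffOn_frame hf.smooth hf.isOpen
  have h2 := hf.contDiffOn_inverse_frame hd
  have h3 : ContDiffOn ℝ ∞ (frameOp ε f) U :=
    (contDiffOn_const.clm_comp ((contDiffOn_const.clm_comp (hf.contDiffOn_diffTensor hd)).add
      contDiffOn_const)).add (ContDiffOn.const_smul _ (contDiffOn_const.clm_comp
        (contDiffOn_const.clm_comp (hf.contDiffOn_metric hd))))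
  exact ((ContinuousLinearMap.contDiff _).comp_contDiffOn h1).clm_comp
    (((ContinuousLinearMap.contDiff _).comp_contDiffOn h2).clm_comp h3)

lemma IsConvexOn.fderiv_gaussOp_self (hf : IsConvexOn ε f U)
    (hd : Module.finrank ℝ V = Module.finrank ℝ E + 1) (hy : y ∈ U) (w z : E) :
    fderiv ℝ (gaussOp ε f) y w z (f y) = gaussOp ε f y (leviCivita (metric ε f) y w z) (f y)
      + ⁅gaussOp ε f y w, gaussOp ε f y z⁆ (f y) := by
  have hinv := hf.isInvertible_frame hd hy
  have d0 := differentiableAt_of_contDiffOn hf.smooth hf.isOpen hy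
  have d1 := differentiableAt_of_contDiffOn (contDiffOn_fderiv hf.smooth hf.isOpen) hf.isOpen hy
  have dN := differentiableAt_of_contDiffOn (hf.contDiffOn_gaussOp hd) hf.isOpen hy
  have dNz : DifferentiableAt ℝ (fun y => gaussOp ε f y z) y := by fun_prop
  have h1 : fderiv ℝ (fun y => gaussOp ε f y z (f y)) y w = fderiv ℝ (fderiv ℝ f) y w z := by
    rw [fderiv_congr_on hf.isOpen hy fun y hy => gaussOp_self (hf.isInvertible_frame hd hy) z,
      fderiv_eval_const d1]
  rw [fderiv_eval dNz d0, fderiv_eval_const dN] at h1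
  simp only [lie_clm_apply, gaussOp_self hinv]
  rw [gaussOp_fderiv' hf.sign_mul_self hinv, ← h1]
  abel

lemma IsConvexOn.fderiv_gaussOp_fderiv (hf : IsConvexOn ε f U) (hp : IsParallelOn ε f U)
    (hd : Module.finrank ℝ V = Module.finrank ℝ E + 1) (hy : y ∈ U) (w z u : E) :
    fderiv ℝ (gaussOp ε f) y w z (fderiv ℝ f y u) =
      gaussOp ε f y (leviCivita (metric ε f) y w z) (fderiv ℝ f y u)
        + ⁅gaussOp ε f y w, gaussOp ε f y z⁆ (fderiv ℝ f y u) := by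
  have hinv := hf.isInvertible_frame hd hy
  have d0 := differentiableAt_of_contDiffOn hf.smooth hf.isOpen hy
  have d1 := differentiableAt_of_contDiffOn (contDiffOn_fderiv hf.smooth hf.isOpen) hf.isOpen hy
  have dN := differentiableAt_of_contDiffOn (hf.contDiffOn_gaussOp hd) hf.isOpen hy
  have dh := differentiableAt_of_contDiffOn (hf.contDiffOn_metric hd) hf.isOpen hy
  have dK := differentiableAt_of_contDiffOn (hf.contDiffOn_diffTensor hd) hf.isOpen hy
  have dNz : DifferentiableAt ℝ (fun y => gaussOp ε f y z) y := by fun_prop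
  have dK1 : DifferentiableAt ℝ (fun y => diffTensor ε f y z u) y := by fun_prop
  have dh1 : DifferentiableAt ℝ (fun y => metric ε f y z u) y := by fun_prop
  have d1u : DifferentiableAt ℝ (fun y => fderiv ℝ f y u) y := by fun_prop
  have h1 := DFunLike.congr_fun (fderiv_congr_on hf.isOpen hy fun y hy =>
    gaussOp_fderiv (ε := ε) (hf.isInvertible_frame hd hy) z u) w
  rw [fderiv_fun_add (d1.clm_apply dK1) ((dh1.const_mul (-ε)).fun_smul d0), add_apply,
    fderiv_eval d1 dK1, fderiv_eval_const₂ dK, fderiv_fun_smul (dh1.const_mul (-ε)) d0,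
    fderiv_const_mul dh1, fderiv_eval dNz d1u, fderiv_eval_const dN, fderiv_eval_const d1,
    hf.fderiv_diffTensor hp hd hy] at h1
  simp only [add_apply, smul_apply, ContinuousLinearMap.smulRight_apply,
    fderiv_eval_const₂ dh, (hf.isRiemannianOn hd).fderiv_apply hy,
    gauss_formula hf.sign_mul_self hinv, inducedConn_eq (ε := ε), map_add, map_smul, map_sub,
    gaussOp_fderiv hinv, gaussOp_self hinv, smul_eq_mul] at h1
  simp only [lie_clm_apply, gaussOp_fderiv hinv, gaussOp_self hinv, map_add, map_smul]
  rw [← sub_eq_zero] at h1 ⊢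
  rw [← h1]
  module

lemma IsConvexOn.fderiv_gaussOp (hf : IsConvexOn ε f U) (hp : IsParallelOn ε f U)
    (hd : Module.finrank ℝ V = Module.finrank ℝ E + 1) (hy : y ∈ U) (w z : E) :
    fderiv ℝ (gaussOp ε f) y w z =
      gaussOp ε f y (leviCivita (metric ε f) y w z) + ⁅gaussOp ε f y w, gaussOp ε f y z⁆ :=
  frame_hom_ext (hf.isInvertible_frame hd hy) (hf.fderiv_gaussOp_fderiv hp hd hy w z)
    (hf.fderiv_gaussOp_self hd hy w z)

lemma IsConvexOn.fderiv_fderiv_gaussOp (hf : IsConvexOn ε f U) (hp : IsParallelOn ε f U)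
    (hd : Module.finrank ℝ V = Module.finrank ℝ E + 1) (hy : y ∈ U) (v w z : E) :
    fderiv ℝ (fderiv ℝ (gaussOp ε f)) y v w z =
      fderiv ℝ (gaussOp ε f) y v (leviCivita (metric ε f) y w z)
        + gaussOp ε f y (fderiv ℝ (leviCivita (metric ε f)) y v w z)
        + (⁅fderiv ℝ (gaussOp ε f) y v w, gaussOp ε f y z⁆
          + ⁅gaussOp ε f y w, fderiv ℝ (gaussOp ε f) y v z⁆) := by
  have sN := hf.contDiffOn_gaussOp hd
  have dN := differentiableAt_of_contDiffOn sN hf.isOpen hy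
  have dN' := differentiableAt_of_contDiffOn (contDiffOn_fderiv sN hf.isOpen) hf.isOpen hy
  have dL := differentiableAt_of_contDiffOn (hf.contDiffOn_leviCivita hd) hf.isOpen hy
  have dN₁ (a : E) : DifferentiableAt ℝ (fun y => gaussOp ε f y a) y := by fun_prop
  have dL₂ : DifferentiableAt ℝ (fun y => leviCivita (metric ε f) y w z) y := by fun_prop
  have dB : DifferentiableAt ℝ (fun y => ⁅gaussOp ε f y w, gaussOp ε f y z⁆) y :=
    ((dN₁ w).mul (dN₁ z)).sub ((dN₁ z).mul (dN₁ w))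
  rw [← fderiv_eval_const₂ dN', fderiv_congr_on hf.isOpen hy
      fun y hy => hf.fderiv_gaussOp hp hd hy w z, fderiv_fun_add (dN.clm_apply dL₂) dB,
    add_apply, fderiv_eval dN dL₂, fderiv_lie (dN₁ w) (dN₁ z), fderiv_eval_const₂ dL,
    fderiv_eval_const dN, fderiv_eval_const dN]

lemma IsConvexOn.exists_gaussOp_eq_lie_lie (hf : IsConvexOn ε f U) (hp : IsParallelOn ε f U)
    (hd : Module.finrank ℝ V = Module.finrank ℝ E + 1) (hy : y ∈ U) (v w z : E) :
    ∃ r : E, gaussOp ε f y r =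
      ⁅gaussOp ε f y z, ⁅gaussOp ε f y v, gaussOp ε f y w⁆⁆ := by
  set L := leviCivita (metric ε f)
  refine ⟨fderiv ℝ L y v w z - fderiv ℝ L y w v z + L y v (L y w z) - L y w (L y v z), ?_⟩
  have hs := congrArg (fun A => A z)
    (fderiv_fderiv_symm (hf.contDiffOn_gaussOp hd) hf.isOpen hy v w)
  simp only [hf.fderiv_fderiv_gaussOp hp hd hy, hf.fderiv_gaussOp hp hd hy,
    (hf.isRiemannianOn hd).leviCivita_symm hy v w] at hs
  simp only [map_add, map_sub]
  rw [← sub_eq_zero] at hs ⊢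
  rw [← hs]
  simp only [Ring.lie_def]
  noncomm_ring

end GaussOp

/-! ### The pointwise algebra -/

section Algebra

variable {E : Type*} [NormedAddCommGroup E] [NormedSpace ℝ E]

/-- The curvature operator of `h`, in the form given by the Gauss equation. -/
noncomputable def curv (ε : ℝ) (h : E →L[ℝ] E →L[ℝ] ℝ) (K : E →L[ℝ] E →L[ℝ] E) (v w z : E) : E :=
  ε • (h w z • v - h v z • w) - K v (K w z) + K w (K v z)

/-- The algebraic properties of the metric and the difference tensor at a point of a locally
strongly convex centroaffine hypersurface with parallel cubic form. -/
structure IsCubicModel (ε : ℝ) (h : E →L[ℝ] E →L[ℝ] ℝ) (K : E →L[ℝ] E →L[ℝ] E) : Prop where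
  symm : ∀ u v, h u v = h v u
  pos : ∀ u, u ≠ 0 → 0 < h u u
  apply_symm : ∀ u v, K u v = K v u
  adjoint : ∀ u v w, h (K u v) w = h v (K u w)
  curv_apply : ∀ v w z u, curv ε h K v w (K z u) =
    K (curv ε h K v w z) u + K z (curv ε h K v w u)

/-- The tangent space is `ℝ e₁ ⊕ D ⊕ D'`, `h`-orthogonally, and `K_{e₁}` is multiplication by `l`,
`l / 2` and `κ` on the three summands: the common shape of the cases `ℭ_m`. -/
structure IsTypicalSplitting (ε : ℝ) (h : E →L[ℝ] E →L[ℝ] ℝ) (K : E →L[ℝ] E →L[ℝ] E)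
    (e₁ : E) (D : Submodule ℝ E) (l κ : ℝ) : Prop where
  unit : h e₁ e₁ = 1
  apply_self : K e₁ e₁ = l • e₁
  ne_zero : l ≠ 0
  discr_pos : 0 < l ^ 2 - 4 * ε
  inner_mem : ∀ d ∈ D, h e₁ d = 0
  apply_mem : ∀ d ∈ D, K e₁ d = (l / 2) • d
  apply_orth : ∀ y, h e₁ y = 0 → (∀ d ∈ D, h d y = 0) → K e₁ y = κ • y
  exists_proj : ∀ z, ∃ d ∈ D, ∀ d' ∈ D, h d' (z - d) = 0

/-- `K_t` is determined by a decomposition of the tangent space as for a Calabi product, `t` being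
tangent to the `u`-lines. -/
structure IsSplitVector (ε : ℝ) (h : E →L[ℝ] E →L[ℝ] ℝ) (K : E →L[ℝ] E →L[ℝ] E) (t : E) : Prop where
  apply_self : K t t = (h t t + ε) • t
  commute : ∀ z u, K t (K z u) - K z (K t u) = ε • (h z u • t - h t u • z)
  apply_apply : ∀ z, K t (K t z) = (h t t + ε) • K t z - (h t t * ε) • z + (ε * h t z) • t

/-- The symmetric operator `K_t - ε - h(·, t) t`. -/
noncomputable def splitOp (ε : ℝ) (h : E →L[ℝ] E →L[ℝ] ℝ) (K : E →L[ℝ] E →L[ℝ] E) (t : E) :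
    E →L[ℝ] E :=
  K t - ε • ContinuousLinearMap.id ℝ E - (h t).smulRight t

variable {ε : ℝ} {h : E →L[ℝ] E →L[ℝ] ℝ} {K : E →L[ℝ] E →L[ℝ] E}

lemma splitOp_apply (t y : E) : splitOp ε h K t y = K t y - ε • y - h t y • t := by
  simp [splitOp]

namespace IsCubicModel

lemma eq_zero (hM : IsCubicModel ε h K) {x : E} (hx : h x x = 0) : x = 0 := by
  by_contra hne
  exact (hM.pos x hne).ne' hx

lemma inner_apply_right_comm (hM : IsCubicModel ε h K) (u v w : E) :
    h (K u v) w = h (K u w) v := by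
  rw [hM.adjoint, hM.symm]

lemma inner_apply_of_eigen (hM : IsCubicModel ε h K) {e a : E} {c : ℝ} (ha : K e a = c • a)
    (x : E) : h (K e x) a = c * h x a := by
  rw [hM.adjoint, ha, map_smul, smul_eq_mul]

lemma sq_inner_le (hM : IsCubicModel ε h K) {e : E} (he : h e e = 1) (x : E) :
    h x e ^ 2 ≤ h x x := by
  have hnonneg : 0 ≤ h (x - h x e • e) (x - h x e • e) := by
    rcases eq_or_ne (x - h x e • e) 0 with h0 | h0
    · simp [h0]
    · exact (hM.pos _ h0).le
  simp only [map_sub, map_smul, sub_apply, smul_apply, smul_eq_mul, he, hM.symm e x] at hnonneg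
  linarith

section TypicalSplitting

variable {D : Submodule ℝ E} {e₁ v : E} {l κ : ℝ}

lemma curv_apply_self (hM : IsCubicModel ε h K) (hT : IsTypicalSplitting ε h K e₁ D l κ)
    (hv : v ∈ D) : curv ε h K e₁ v e₁ = (l ^ 2 / 4 - ε) • v := by
  simp only [curv, hT.unit, hT.apply_self, hM.symm v e₁, hT.inner_mem v hv, hM.apply_symm v e₁,
    hT.apply_mem v hv, map_smul]
  module

lemma inner_apply_eq_zero_of_eigen (hM : IsCubicModel ε h K)
    (hT : IsTypicalSplitting ε h K e₁ D l κ) (hv : v ∈ D) {a b : E} {c : ℝ}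
    (ha : K e₁ a = c • a) (hb : K e₁ b = c • b) (hea : h e₁ a = 0) (heb : h e₁ b = 0) :
    h (K v a) b = 0 := by
  have hcurv : h (curv ε h K e₁ v a) b = 0 := by
    simp only [curv, ha, hea, map_add, map_sub, map_smul, add_apply, sub_apply, smul_apply,
      smul_eq_mul, hM.inner_apply_of_eigen hb, heb]
    ring
  have hsmul : curv ε h K e₁ v (c • a) = c • curv ε h K e₁ v a := by
    simp only [curv, map_smul, smul_eq_mul]
    module
  have hact := congrArg (fun x => h x b) (hM.curv_apply e₁ v e₁ a)
  simp only [hM.curv_apply_self hT hv, ha, hsmul, hcurv, map_add, map_smul, add_apply, smul_apply,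
    hM.inner_apply_of_eigen hb, smul_eq_mul, mul_zero, add_zero] at hact
  refine (mul_eq_zero.1 hact.symm).resolve_left ?_
  linarith [hT.discr_pos]

lemma inner_apply_eq_zero_of_orth (hM : IsCubicModel ε h K)
    (hT : IsTypicalSplitting ε h K e₁ D l κ) (hv : v ∈ D) {y z : E}
    (hy : ∀ d ∈ D, h d y = 0) (hz : ∀ d ∈ D, h d z = 0) : h (K v y) z = 0 := by
  have decomp (x : E) (hx : ∀ d ∈ D, h d x = 0) :
      ∃ x', x = h e₁ x • e₁ + x' ∧ h e₁ x' = 0 ∧ ∀ d ∈ D, h d x' = 0 := by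
    refine ⟨x - h e₁ x • e₁, by abel, by simp [hT.unit], fun d hd => ?_⟩
    simp [hx d hd, hM.symm d e₁, hT.inner_mem d hd]
  obtain ⟨y', hyy', hey, hDy⟩ := decomp y hy
  obtain ⟨z', hzz', hez, hDz⟩ := decomp z hz
  have hve : K v e₁ = (l / 2) • v := by rw [hM.apply_symm, hT.apply_mem v hv]
  have hyz := hM.inner_apply_eq_zero_of_eigen hT hv (hT.apply_orth y' hey hDy)
    (hT.apply_orth z' hez hDz) hey hez
  have hye : h (K v y') e₁ = 0 := by
    rw [hM.adjoint, hve, map_smul, hM.symm, hDy v hv, smul_zero]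
  rw [hyy', map_add, map_smul, map_add, add_apply, hve, map_smul, map_smul, smul_apply,
    smul_apply, hz v hv, hzz', map_add, map_smul, hye, hyz]
  simp

lemma inner_apply_self_eq_zero (hM : IsCubicModel ε h K)
    (hT : IsTypicalSplitting ε h K e₁ D l κ) (hv : v ∈ D) {d : E} (hd : d ∈ D) :
    h d (K v v) = 0 := by
  rw [hM.symm]
  exact hM.inner_apply_eq_zero_of_eigen hT hv (hT.apply_mem v hv) (hT.apply_mem d hd)
    (hT.inner_mem v hv) (hT.inner_mem d hd)

/-- `K_v` maps the orthogonal complement of `D` to `D`, hence is known there by symmetry. -/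
lemma apply_eq_of_forall_apply_eq_zero (hM : IsCubicModel ε h K)
    (hT : IsTypicalSplitting ε h K e₁ D l κ) (hv : v ∈ D) (hvv : h v v = 1)
    (hnull : ∀ u ∈ D, h v u = 0 → K v u = 0) (z : E) :
    K v z = h v z • K v v + h (K v v) z • v := by
  have hDK (d : E) (hd : d ∈ D) : K v d = h v d • K v v := by
    have h0 := hnull (d - h v d • v) (D.sub_mem hd (D.smul_mem _ hv)) (by simp [hvv])
    rwa [map_sub, map_smul, sub_eq_zero] at h0
  obtain ⟨d, hd, hzd⟩ := hT.exists_proj z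
  obtain ⟨y, rfl⟩ : ∃ y, z = d + y := ⟨z - d, by abel⟩
  rw [add_sub_cancel_left] at hzd
  obtain ⟨x, hx⟩ : ∃ x, x = K v y - h (K v v) y • v := ⟨_, rfl⟩
  have hxD (d' : E) (hd' : d' ∈ D) : h d' x = 0 := by
    rw [hM.symm, hx, map_sub, sub_apply, map_smul, smul_apply, hM.inner_apply_right_comm,
      hDK d' hd', map_smul, smul_apply, smul_eq_mul, smul_eq_mul, mul_comm, sub_self]
  have hx0 : x = 0 := hM.eq_zero <| by
    nth_rewrite 1 [hx]
    rw [map_sub, sub_apply, map_smul, smul_apply, hxD v hv,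
      hM.inner_apply_eq_zero_of_orth hT hv hzd hxD, smul_zero, sub_zero]
  have hdv : h (K v v) d = 0 := by rw [hM.symm, hM.inner_apply_self_eq_zero hT hv hd]
  simp only [map_add, hDK d hd, sub_eq_zero.1 (hx ▸ hx0), hzd v hv, hdv]
  module

lemma sq_div_four_le_inner (hM : IsCubicModel ε h K) (hT : IsTypicalSplitting ε h K e₁ D l κ)
    (hv : v ∈ D) (hvv : h v v = 1) : l ^ 2 / 4 ≤ h (K v v) (K v v) := by
  have hve : h (K v v) e₁ = l / 2 := by
    rw [hM.adjoint, hM.apply_symm, hT.apply_mem v hv, map_smul, hvv, smul_eq_mul, mul_one]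
  have hle := hM.sq_inner_le hT.unit (K v v)
  rw [hve] at hle
  linarith

end TypicalSplitting

section SplitVector

variable {t v : E}

lemma inner_splitOp_left (hM : IsCubicModel ε h K) (t y z : E) :
    h (splitOp ε h K t y) z = h y (splitOp ε h K t z) := by
  simp only [splitOp_apply, map_sub, map_smul, sub_apply, smul_apply, smul_eq_mul, hM.adjoint,
    hM.symm y t]
  ring

lemma splitOp_apply_of_apply_eq (hM : IsCubicModel ε h K) (htv : h t v = 0)
    (hKv : ∀ z, K v z = h v z • t + h t z • v) :
    splitOp ε h K t v = (h t t - ε) • v := by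
  rw [splitOp_apply, hM.apply_symm, hKv, hM.symm v t, htv]
  module

lemma inner_splitOp_of_apply_eq (hM : IsCubicModel ε h K) (htv : h t v = 0)
    (hKv : ∀ z, K v z = h v z • t + h t z • v) (y : E) :
    h v (splitOp ε h K t y) = (h t t - ε) * h v y := by
  rw [← hM.inner_splitOp_left, hM.splitOp_apply_of_apply_eq htv hKv, map_smul, smul_apply,
    smul_eq_mul]

lemma curv_apply_eq_splitOp (hM : IsCubicModel ε h K) (hvv : h v v = 1) (htv : h t v = 0)
    (hKv : ∀ z, K v z = h v z • t + h t z • v) {y : E} (hy : h v y = 0) :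
    curv ε h K v y v = splitOp ε h K t y := by
  simp only [curv, splitOp_apply, hM.symm y v, hM.apply_symm y v, hM.apply_symm y t, hKv v, hKv y,
    hvv, htv, hy, map_add, map_smul]
  module

lemma curv_apply_eq_neg_inner_smul (hM : IsCubicModel ε h K)
    (hKv : ∀ z, K v z = h v z • t + h t z • v) {y z : E} (hy : h v y = 0) (hz : h v z = 0) :
    curv ε h K v y z = -h (splitOp ε h K t y) z • v := by
  have hvK : h v (K y z) = 0 := by
    rw [hM.symm, hM.inner_apply_right_comm, hM.apply_symm, hKv, hy, map_add, map_smul, map_smul,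
      add_apply, smul_apply, smul_apply, hz]
    simp
  have htK : h t (K y z) = h (K t y) z := by
    rw [hM.symm, hM.inner_apply_right_comm, hM.apply_symm]
  simp only [curv, hM.apply_symm y v, splitOp_apply, hKv (K y z), hKv z, hKv y, hvK, htK, hy, hz,
    map_add, map_sub, map_smul, sub_apply, smul_apply, smul_eq_mul]
  module

lemma splitOp_self (hM : IsCubicModel ε h K) (hvv : h v v = 1) (htv : h t v = 0)
    (hKv : ∀ z, K v z = h v z • t + h t z • v) : splitOp ε h K t t = 0 := by
  have hvt : h v t = 0 := by rw [hM.symm, htv]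
  have inner_t (y : E) (hy : h v y = 0) : h (splitOp ε h K t y) t = 0 := by
    have hvB : h v (splitOp ε h K t y) = 0 := by
      rw [hM.inner_splitOp_of_apply_eq htv hKv, hy, mul_zero]
    have hact := congrArg (h v) (hM.curv_apply v y v v)
    simp only [hM.curv_apply_eq_splitOp hvv htv hKv hy, hM.apply_symm _ v, hKv v, hvv, htv,
      one_smul, zero_smul, add_zero, hM.curv_apply_eq_neg_inner_smul hKv hy hvt, hKv, hvB,
      hM.symm t, map_add, map_smul, smul_eq_mul, mul_one, zero_add] at hact
    linarith
  refine hM.eq_zero ?_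
  rw [hM.inner_splitOp_left, hM.symm, inner_t]
  rw [hM.inner_splitOp_of_apply_eq htv hKv, hvt, mul_zero]

lemma apply_splitOp (hM : IsCubicModel ε h K) (hvv : h v v = 1) (htv : h t v = 0)
    (hKv : ∀ z, K v z = h v z • t + h t z • v) (y z : E) :
    K (splitOp ε h K t y) z =
      h (splitOp ε h K t y) z • t + h t z • splitOp ε h K t y := by
  set B := splitOp ε h K t
  have decomp (x : E) : ∃ (c : ℝ) (x' : E), x = c • v + x' ∧ h v x' = 0 :=
    ⟨h v x, x - h v x • v, by abel, by simp [hvv]⟩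
  obtain ⟨a, y, rfl, hy⟩ := decomp y
  obtain ⟨b, z, rfl, hz⟩ := decomp z
  have hBv : B v = (h t t - ε) • v := hM.splitOp_apply_of_apply_eq htv hKv
  have hvB : h v (B y) = 0 := by rw [hM.inner_splitOp_of_apply_eq htv hKv, hy, mul_zero]
  have htB : h t (B y) = 0 := by
    rw [← hM.inner_splitOp_left, hM.splitOp_self hvv htv hKv, map_zero, zero_apply]
  have hByv : K (B y) v = 0 := by
    rw [hM.apply_symm, hKv, hvB, htB, zero_smul, zero_smul, add_zero]
  have hByz : K (B y) z = h (B y) z • t + h t z • B y := by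
    have hsmul : curv ε h K v y (h t z • v) = h t z • curv ε h K v y v := by
      simp only [curv, map_smul, smul_eq_mul]
      module
    have hact := hM.curv_apply v y v z
    rw [hKv z, hz, zero_smul, zero_add, hsmul, hM.curv_apply_eq_splitOp hvv htv hKv hy,
      hM.curv_apply_eq_neg_inner_smul hKv hy hz, map_smul, hKv v, hvv, htv] at hact
    rw [eq_sub_of_add_eq hact.symm]
    module
  simp only [map_add, map_smul, add_apply, smul_apply, hBv, hByv, hByz, hKv, hvv, htv,
    hM.symm _ v, hvB, smul_eq_mul]
  module

lemma splitOp_apply_eq_add (hM : IsCubicModel ε h K)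
    (hB : ∀ y z, K (splitOp ε h K t y) z =
      h (splitOp ε h K t y) z • t + h t z • splitOp ε h K t y) (z u : E) :
    splitOp ε h K t (K z u) = h t z • splitOp ε h K t u + h t u • splitOp ε h K t z := by
  refine ext_of_pos hM.pos fun w => ?_
  rw [hM.inner_splitOp_left, hM.adjoint, hM.apply_symm z, hB]
  simp only [map_add, map_smul, add_apply, smul_apply, smul_eq_mul,
    hM.inner_splitOp_left t u, hM.inner_splitOp_left t z, hM.symm u t, hM.symm z]
  ring

/-- In terms of `B = splitOp ε h K t`, both `K_t = B + ε + h(·, t) t` and the action of `B` on the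
tensor `K` are explicit. -/
lemma isSplitVector_of_splitOp (hM : IsCubicModel ε h K) (hBt : splitOp ε h K t t = 0)
    (hB : ∀ y z, K (splitOp ε h K t y) z =
      h (splitOp ε h K t y) z • t + h t z • splitOp ε h K t y) :
    IsSplitVector ε h K t := by
  have hKt (y : E) : K t y = splitOp ε h K t y + ε • y + h t y • t := by
    rw [splitOp_apply]; abel
  have htB (y : E) : h t (splitOp ε h K t y) = 0 := by
    rw [← hM.inner_splitOp_left, hBt, map_zero, zero_apply]
  have hKB (y : E) : K t (splitOp ε h K t y) = h t t • splitOp ε h K t y := by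
    rw [hM.apply_symm, hB, hM.symm, htB]
    module
  have htt : K t t = (h t t + ε) • t := by
    rw [hKt, hBt]
    module
  refine ⟨htt, fun z u => ?_, fun z => ?_⟩
  · have htK : h t (K z u) = h (K t z) u := by
      rw [hM.symm, hM.inner_apply_right_comm, hM.apply_symm]
    have hBu : h (splitOp ε h K t u) z = h (splitOp ε h K t z) u := by
      rw [hM.inner_splitOp_left, hM.symm]
    rw [hKt (K z u), hM.splitOp_apply_eq_add hB, hKt u, map_add, map_add,
      hM.apply_symm z (splitOp ε h K t u), hB, map_smul, map_smul, hM.apply_symm z t,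
      htK, hKt z, hBu]
    simp only [map_add, map_smul, add_apply, smul_apply, smul_eq_mul]
    module
  · nth_rewrite 1 [hKt z]
    rw [map_add, map_add, hKB, map_smul, map_smul, htt, hKt z]
    module

end SplitVector

lemma isSplitVector_apply_self (hM : IsCubicModel ε h K) {D : Submodule ℝ E} {e₁ v : E} {l κ : ℝ}
    (hT : IsTypicalSplitting ε h K e₁ D l κ) (hv : v ∈ D) (hvv : h v v = 1)
    (hnull : ∀ u ∈ D, h v u = 0 → K v u = 0) : IsSplitVector ε h K (K v v) := by
  have htv : h (K v v) v = 0 := by rw [hM.symm, hM.inner_apply_self_eq_zero hT hv hv]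
  have hKv := hM.apply_eq_of_forall_apply_eq_zero hT hv hvv hnull
  exact hM.isSplitVector_of_splitOp (hM.splitOp_self hvv htv hKv) (hM.apply_splitOp hvv htv hKv)

end IsCubicModel

end Algebra

section Model

variable {E V : Type*} [NormedAddCommGroup E] [NormedSpace ℝ E] [FiniteDimensional ℝ E]
  [NormedAddCommGroup V] [NormedSpace ℝ V] [FiniteDimensional ℝ V]
  {ε : ℝ} {f : E → V} {U : Set E} {y : E}

lemma IsConvexOn.lie_gaussOp_fderiv (hf : IsConvexOn ε f U)
    (hd : Module.finrank ℝ V = Module.finrank ℝ E + 1) (hy : y ∈ U) (v w a : E) :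
    ⁅gaussOp ε f y v, gaussOp ε f y w⁆ (fderiv ℝ f y a) =
      -fderiv ℝ f y (curv ε (metric ε f y) (diffTensor ε f y) v w a) := by
  have hinv := hf.isInvertible_frame hd hy
  have hhK : metric ε f y w (diffTensor ε f y v a) = metric ε f y v (diffTensor ε f y w a) := by
    rw [← hf.diffTensor_adjoint hd hy, ← hf.diffTensor_adjoint hd hy, hf.diffTensor_symm hd hy]
  simp only [lie_clm_apply, gaussOp_fderiv hinv, gaussOp_self hinv, map_add, map_smul, curv,
    map_sub, hhK]
  module

lemma IsConvexOn.lie_gaussOp_self (hf : IsConvexOn ε f U)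
    (hd : Module.finrank ℝ V = Module.finrank ℝ E + 1) (hy : y ∈ U) (v w : E) :
    ⁅gaussOp ε f y v, gaussOp ε f y w⁆ (f y) = 0 := by
  have hinv := hf.isInvertible_frame hd hy
  rw [lie_clm_apply, gaussOp_self hinv, gaussOp_self hinv, gaussOp_fderiv hinv,
    gaussOp_fderiv hinv, hf.diffTensor_symm hd hy v, hf.metric_symm hy v, sub_self]

lemma IsConvexOn.gaussOp_curv (hf : IsConvexOn ε f U) (hp : IsParallelOn ε f U)
    (hd : Module.finrank ℝ V = Module.finrank ℝ E + 1) (hy : y ∈ U) (v w z : E) :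
    gaussOp ε f y (curv ε (metric ε f y) (diffTensor ε f y) v w z) =
      ⁅gaussOp ε f y z, ⁅gaussOp ε f y v, gaussOp ε f y w⁆⁆ := by
  have hinv := hf.isInvertible_frame hd hy
  obtain ⟨r, hr⟩ := hf.exists_gaussOp_eq_lie_lie hp hd hy v w z
  rw [← hr]
  congr 1
  apply hf.immersion y hy
  have hrf := congrArg (fun A => A (f y)) hr
  simp only [lie_clm_apply (gaussOp ε f y z), hf.lie_gaussOp_self hd hy, gaussOp_self hinv,
    hf.lie_gaussOp_fderiv hd hy, map_zero, zero_sub, neg_neg] at hrf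
  exact hrf.symm

lemma IsConvexOn.curv_diffTensor (hf : IsConvexOn ε f U) (hp : IsParallelOn ε f U)
    (hd : Module.finrank ℝ V = Module.finrank ℝ E + 1) (hy : y ∈ U) (v w z u : E) :
    curv ε (metric ε f y) (diffTensor ε f y) v w (diffTensor ε f y z u) =
      diffTensor ε f y (curv ε (metric ε f y) (diffTensor ε f y) v w z) u +
        diffTensor ε f y z (curv ε (metric ε f y) (diffTensor ε f y) v w u) := by
  have hinv := hf.isInvertible_frame hd hy
  set R := curv ε (metric ε f y) (diffTensor ε f y) v w with hR
  have hact := congrArg (fun A => A (fderiv ℝ f y u)) (hf.gaussOp_curv hp hd hy v w z)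
  simp only [lie_clm_apply (gaussOp ε f y z), hf.lie_gaussOp_fderiv hd hy, gaussOp_fderiv hinv,
    map_add, map_smul, map_neg, hf.lie_gaussOp_self hd hy, smul_zero, ← hR] at hact
  refine (frame_eq_iff hinv (s := 0) (r := -ε * (metric ε f y (R z) u + metric ε f y z (R u)))
    ?_).1
  rw [← sub_eq_zero] at hact
  rw [map_add, ← sub_eq_zero, ← neg_eq_zero, ← hact]
  module

lemma IsConvexOn.isCubicModel (hf : IsConvexOn ε f U) (hp : IsParallelOn ε f U)
    (hd : Module.finrank ℝ V = Module.finrank ℝ E + 1) (hy : y ∈ U) :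
    IsCubicModel ε (metric ε f y) (diffTensor ε f y) where
  symm := hf.metric_symm hy
  pos := hf.metric_pos y hy
  apply_symm := hf.diffTensor_symm hd hy
  adjoint := hf.diffTensor_adjoint hd hy
  curv_apply := hf.curv_diffTensor hp hd hy

end Model

/-! ### Propagation of a splitting -/

section Reparam

variable {E V : Type*} [NormedAddCommGroup E] [NormedSpace ℝ E]
  [NormedAddCommGroup V] [NormedSpace ℝ V] {ε : ℝ} {f f' : E → V} {U U' : Set E} {y : E} {τ : E → E}

/-- On `U'`, the parametrization `f'` is obtained from the parametrization `f` of the same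
hypersurface, defined on `U`, by the change of parameters `τ`. -/
structure IsReparam (τ : E → E) (f' : E → V) (U' : Set E) (f : E → V) (U : Set E) : Prop where
  contDiffOn : ContDiffOn ℝ ∞ τ U'
  mapsTo : Set.MapsTo τ U' U
  eq_comp : ∀ y ∈ U', f' y = f (τ y)

namespace IsReparam

lemma fderiv_eq (hτ : IsReparam τ f' U' f U) (hf : IsConvexOn ε f U) (hU' : IsOpen U')
    (hy : y ∈ U') (u : E) : fderiv ℝ f' y u = fderiv ℝ f (τ y) (fderiv ℝ τ y u) := by
  rw [fderiv_congr_on hU' hy hτ.eq_comp,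
    fderiv_fun_comp y (differentiableAt_of_contDiffOn hf.smooth hf.isOpen (hτ.mapsTo hy))
      (differentiableAt_of_contDiffOn hτ.contDiffOn hU' hy), ContinuousLinearMap.comp_apply]

lemma fderiv_fderiv_eq (hτ : IsReparam τ f' U' f U) (hf : IsConvexOn ε f U)
    (hf' : IsConvexOn ε f' U') (hy : y ∈ U') (z u : E) :
    fderiv ℝ (fderiv ℝ f') y z u =
      fderiv ℝ (fderiv ℝ f) (τ y) (fderiv ℝ τ y z) (fderiv ℝ τ y u)
        + fderiv ℝ f (τ y) (fderiv ℝ (fderiv ℝ τ) y z u) := by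
  have hU' := hf'.isOpen
  have d1' := differentiableAt_of_contDiffOn (contDiffOn_fderiv hf'.smooth hU') hU' hy
  have d1 := differentiableAt_of_contDiffOn (contDiffOn_fderiv hf.smooth hf.isOpen) hf.isOpen
    (hτ.mapsTo hy)
  have dτ := differentiableAt_of_contDiffOn hτ.contDiffOn hU' hy
  have dτ' := differentiableAt_of_contDiffOn (contDiffOn_fderiv hτ.contDiffOn hU') hU' hy
  have dτu : DifferentiableAt ℝ (fun y => fderiv ℝ τ y u) y := by fun_prop
  have dc : DifferentiableAt ℝ (fun y => fderiv ℝ f (τ y)) y := d1.comp y dτ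
  rw [← fderiv_eval_const d1', fderiv_congr_on hU' hy fun y hy => hτ.fderiv_eq hf hU' hy u,
    fderiv_eval dc dτu, fderiv_eval_const dτ', fderiv_fun_comp y d1 dτ,
    ContinuousLinearMap.comp_apply]

variable [FiniteDimensional ℝ E]

lemma bijective_fderiv (hτ : IsReparam τ f' U' f U) (hf : IsConvexOn ε f U)
    (hf' : IsConvexOn ε f' U') (hy : y ∈ U') : Function.Bijective (fderiv ℝ τ y) := by
  have hi : Function.Injective (fderiv ℝ τ y) := fun a b hab => hf'.immersion y hy (by
    rw [hτ.fderiv_eq hf hf'.isOpen hy, hτ.fderiv_eq hf hf'.isOpen hy, hab])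
  exact ⟨hi, LinearMap.injective_iff_surjective (f := (fderiv ℝ τ y).toLinearMap).1 hi⟩

variable [FiniteDimensional ℝ V]

lemma metric_eq (hτ : IsReparam τ f' U' f U) (hf : IsConvexOn ε f U) (hf' : IsConvexOn ε f' U')
    (hd : Module.finrank ℝ V = Module.finrank ℝ E + 1) (hy : y ∈ U') (z u : E) :
    metric ε f' y z u = metric ε f (τ y) (fderiv ℝ τ y z) (fderiv ℝ τ y u) := by
  have hinv := hf.isInvertible_frame hd (hτ.mapsTo hy)
  obtain ⟨a, ha⟩ := (hτ.bijective_fderiv hf hf' hy).2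
    (inducedConn f (τ y) (fderiv ℝ τ y z) (fderiv ℝ τ y u) + fderiv ℝ (fderiv ℝ τ) y z u)
  refine (gauss_unique hf.sign_mul_self (hf'.isInvertible_frame hd hy) (a := a) ?_).2
  rw [hτ.fderiv_fderiv_eq hf hf' hy, gauss_formula hf.sign_mul_self hinv,
    hτ.fderiv_eq hf hf'.isOpen hy, ha, map_add, hτ.eq_comp y hy]
  abel

lemma fderiv_metric (hτ : IsReparam τ f' U' f U) (hf : IsConvexOn ε f U)
    (hf' : IsConvexOn ε f' U') (hd : Module.finrank ℝ V = Module.finrank ℝ E + 1) (hy : y ∈ U')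
    (w u v : E) :
    fderiv ℝ (metric ε f') y w u v =
      fderiv ℝ (metric ε f) (τ y) (fderiv ℝ τ y w) (fderiv ℝ τ y u) (fderiv ℝ τ y v)
        + metric ε f (τ y) (fderiv ℝ (fderiv ℝ τ) y w u) (fderiv ℝ τ y v)
        + metric ε f (τ y) (fderiv ℝ τ y u) (fderiv ℝ (fderiv ℝ τ) y w v) := by
  have hU' := hf'.isOpen
  have dτ := differentiableAt_of_contDiffOn hτ.contDiffOn hU' hy
  have dτ' := differentiableAt_of_contDiffOn (contDiffOn_fderiv hτ.contDiffOn hU') hU' hy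
  have dτu (u : E) : DifferentiableAt ℝ (fun y => fderiv ℝ τ y u) y := by fun_prop
  have dh := differentiableAt_of_contDiffOn (hf.contDiffOn_metric hd) hf.isOpen (hτ.mapsTo hy)
  have dh' := differentiableAt_of_contDiffOn (hf'.contDiffOn_metric hd) hU' hy
  have dc : DifferentiableAt ℝ (fun y => metric ε f (τ y)) y := dh.comp y dτ
  rw [← fderiv_eval_const₂ dh', fderiv_congr_on hU' hy fun y hy => hτ.metric_eq hf hf' hd hy u v,
    fderiv_eval (dc.clm_apply (dτu u)) (dτu v), fderiv_eval dc (dτu u), fderiv_fun_comp y dh dτ,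
    fderiv_eval_const dτ', fderiv_eval_const dτ', ContinuousLinearMap.comp_apply, add_apply]

lemma leviCivita_eq (hτ : IsReparam τ f' U' f U) (hf : IsConvexOn ε f U)
    (hf' : IsConvexOn ε f' U') (hd : Module.finrank ℝ V = Module.finrank ℝ E + 1) (hy : y ∈ U')
    (z u : E) :
    fderiv ℝ τ y (leviCivita (metric ε f') y z u) =
      leviCivita (metric ε f) (τ y) (fderiv ℝ τ y z) (fderiv ℝ τ y u)
        + fderiv ℝ (fderiv ℝ τ) y z u := by
  have hb := hτ.bijective_fderiv hf hf' hy
  have hR := hf.isRiemannianOn hd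
  choose G hG using fun z u : E => hb.2 (leviCivita (metric ε f) (τ y) (fderiv ℝ τ y z)
    (fderiv ℝ τ y u) + fderiv ℝ (fderiv ℝ τ) y z u)
  rw [(hf'.isRiemannianOn hd).leviCivita_unique hy (G := G) (fun u v => hb.1 ?_) fun w u v => ?_,
    hG]
  · rw [hG, hG, hR.leviCivita_symm (hτ.mapsTo hy), fderiv_fderiv_symm hτ.contDiffOn hf'.isOpen hy]
  · rw [hτ.fderiv_metric hf hf' hd hy, hτ.metric_eq hf hf' hd hy, hτ.metric_eq hf hf' hd hy, hG, hG,
      hR.fderiv_apply (hτ.mapsTo hy)]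
    simp only [map_add, add_apply]
    ring

lemma gaussOp_eq (hτ : IsReparam τ f' U' f U) (hf : IsConvexOn ε f U) (hf' : IsConvexOn ε f' U')
    (hd : Module.finrank ℝ V = Module.finrank ℝ E + 1) (hy : y ∈ U') (z : E) :
    gaussOp ε f' y z = gaussOp ε f (τ y) (fderiv ℝ τ y z) := by
  have hinv := hf.isInvertible_frame hd (hτ.mapsTo hy)
  have hinv' := hf'.isInvertible_frame hd hy
  refine frame_hom_ext hinv' (fun u => ?_) ?_
  · rw [gaussOp_fderiv' hf.sign_mul_self hinv', hτ.fderiv_fderiv_eq hf hf' hy,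
      hτ.fderiv_eq hf hf'.isOpen hy, hτ.fderiv_eq hf hf'.isOpen hy, hτ.leviCivita_eq hf hf' hd hy,
      gaussOp_fderiv' hf.sign_mul_self hinv, map_add]
    abel
  · rw [gaussOp_self hinv', hτ.fderiv_eq hf hf'.isOpen hy, hτ.eq_comp y hy, gaussOp_self hinv]

end IsReparam

/-- `A = D_t - ∇̂_t` for a tangent vector `t` at `y`, and `A` commutes with `D_z - ∇̂_z` for all
tangent vectors `z` at `y`. Such an `A` is the same at all points of a connected hypersurface, and
its eigenspaces are the ambient spaces of the factors of a Calabi product. -/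
structure IsSplitAt (ε : ℝ) (f : E → V) (A : V →L[ℝ] V) (y : E) : Prop where
  exists_eq : ∃ t, gaussOp ε f y t = A
  commute : ∀ z, Commute A (gaussOp ε f y z)

lemma IsReparam.isSplitAt [FiniteDimensional ℝ E] [FiniteDimensional ℝ V]
    (hτ : IsReparam τ f' U' f U) (hf : IsConvexOn ε f U) (hf' : IsConvexOn ε f' U')
    (hd : Module.finrank ℝ V = Module.finrank ℝ E + 1) (hy : y ∈ U') {A : V →L[ℝ] V}
    (hs : IsSplitAt ε f A (τ y)) : IsSplitAt ε f' A y := by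
  obtain ⟨t, ht⟩ := hs.exists_eq
  obtain ⟨t', rfl⟩ := (hτ.bijective_fderiv hf hf' hy).2 t
  refine ⟨⟨t', (hτ.gaussOp_eq hf hf' hd hy t').trans ht⟩, fun z => ?_⟩
  rw [hτ.gaussOp_eq hf hf' hd hy]
  exact hs.commute _

end Reparam

section Segment

variable {F G : Type*} [NormedAddCommGroup F] [NormedSpace ℝ F] [NormedAddCommGroup G]
  [NormedSpace ℝ G] {g : F → G} {U : Set F} {a b : F}

lemma eq_zero_of_norm_fderiv_segment_le {c : F → ℝ} (hU : Convex ℝ U) (hUo : IsOpen U)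
    (hg : DifferentiableOn ℝ g U) (hc : ContinuousOn c U) (ha : a ∈ U) (hb : b ∈ U)
    (hle : ∀ y ∈ U, ‖fderiv ℝ g y (b - a)‖ ≤ c y * ‖g y‖) (h0 : g a = 0) : g b = 0 := by
  have hmaps : Set.MapsTo (AffineMap.lineMap a b : ℝ → F) (Set.Icc 0 1) U :=
    fun s hs => hU.lineMap_mem ha hb hs
  have hcont := (AffineMap.lineMap_continuous (p := a) (q := b) (R := ℝ)).continuousOn
    (s := Set.Icc 0 1)
  obtain ⟨C, hC⟩ := isCompact_Icc.exists_bound_of_continuousOn (hc.comp hcont hmaps)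
  have hzero := eq_zero_of_abs_deriv_le_mul_abs_self_of_eq_zero_right
    (f := g ∘ AffineMap.lineMap a b) (f' := fun s => fderiv ℝ g (AffineMap.lineMap a b s) (b - a))
    (K := C) (hg.continuousOn.comp hcont hmaps)
    (fun s hs => ((hg.differentiableAt (hUo.mem_nhds (hmaps ⟨hs.1, hs.2.le⟩))).hasFDerivAt
      |>.comp_hasDerivAt s AffineMap.hasDerivAt_lineMap).hasDerivWithinAt)
    (by simpa using h0)
    (fun s hs => (hle _ (hmaps ⟨hs.1, hs.2.le⟩)).trans <| mul_le_mul_of_nonneg_right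
      ((le_abs_self _).trans (hC s ⟨hs.1, hs.2.le⟩)) (norm_nonneg _)) 1 (by simp)
  simpa using hzero

lemma eq_of_fderiv_segment_eq_zero (hU : Convex ℝ U) (hUo : IsOpen U)
    (hg : DifferentiableOn ℝ g U) (ha : a ∈ U) (hb : b ∈ U)
    (h : ∀ y ∈ U, fderiv ℝ g y (b - a) = 0) : g b = g a :=
  sub_eq_zero.1 <| eq_zero_of_norm_fderiv_segment_le (g := fun y => g y - g a) (c := 0) hU hUo
    (hg.sub_const _) continuousOn_const ha hb (fun y hy => by simp [fderiv_sub_const, h y hy])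
    (sub_self _)

end Segment

section Propagation

lemma norm_lie_le {R : Type*} [NormedRing R] (a b : R) : ‖⁅a, b⁆‖ ≤ 2 * ‖a‖ * ‖b‖ :=
  calc ‖a * b - b * a‖ ≤ ‖a‖ * ‖b‖ + ‖b‖ * ‖a‖ :=
        (norm_sub_le _ _).trans (add_le_add (norm_mul_le _ _) (norm_mul_le _ _))
    _ = 2 * ‖a‖ * ‖b‖ := by ring

variable {E V : Type*} [NormedAddCommGroup E] [NormedSpace ℝ E]
  [NormedAddCommGroup V] [NormedSpace ℝ V] {ε : ℝ} {f : E → V} {U : Set E} {y : E} {A : V →L[ℝ] V}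

/-- The tangent vector `t` in the decomposition `A f = df t + c f`. -/
noncomputable def splitVec (f : E → V) (A : V →L[ℝ] V) (y : E) : E :=
  ((frame f y).inverse (A (f y))).1

/-- The coefficient `c` in the decomposition `A f = df t + c f`. -/
noncomputable def splitCoef (f : E → V) (A : V →L[ℝ] V) (y : E) : ℝ :=
  ((frame f y).inverse (A (f y))).2

lemma apply_eq_split (hinv : (frame f y).IsInvertible) :
    A (f y) = fderiv ℝ f y (splitVec f A y) + splitCoef f A y • f y :=
  exists_frame_coord hinv _

lemma IsSplitAt.splitCoef_eq_zero (hinv : (frame f y).IsInvertible) (hs : IsSplitAt ε f A y) :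
    splitCoef f A y = 0 := by
  obtain ⟨t, ht⟩ := hs.exists_eq
  refine (frame_eq_iff hinv (a := splitVec f A y) (b := t) (r := 0) ?_).2
  rw [← apply_eq_split hinv, ← ht, gaussOp_self hinv, zero_smul, add_zero]

lemma IsSplitAt.apply_self (hinv : (frame f y).IsInvertible) (hs : IsSplitAt ε f A y) :
    A (f y) = fderiv ℝ f y (splitVec f A y) := by
  rw [apply_eq_split hinv, hs.splitCoef_eq_zero hinv, zero_smul, add_zero]

/-- The defect of commutation of `A` with the operators `D_z - ∇̂_z`. -/
noncomputable def gaussLie (ε : ℝ) (f : E → V) (A : V →L[ℝ] V) (y : E) : E →L[ℝ] V →L[ℝ] V :=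
  (ContinuousLinearMap.mul ℝ (V →L[ℝ] V) A -
    (ContinuousLinearMap.mul ℝ (V →L[ℝ] V)).flip A).comp (gaussOp ε f y)

lemma gaussLie_apply (z : E) : gaussLie ε f A y z = ⁅A, gaussOp ε f y z⁆ := rfl

lemma gaussLie_eq_zero_iff : gaussLie ε f A y = 0 ↔ ∀ z, Commute A (gaussOp ε f y z) := by
  simp only [ContinuousLinearMap.ext_iff (f := gaussLie ε f A y), gaussLie_apply, zero_apply,
    Ring.lie_def, sub_eq_zero]
  rfl

variable [FiniteDimensional ℝ E] [FiniteDimensional ℝ V]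

namespace IsConvexOn

lemma contDiffOn_inverse_frame_apply (hf : IsConvexOn ε f U)
    (hd : Module.finrank ℝ V = Module.finrank ℝ E + 1) :
    ContDiffOn ℝ ∞ (fun y => (frame f y).inverse (A (f y))) U :=
  (hf.contDiffOn_inverse_frame hd).clm_apply (A.contDiff.comp_contDiffOn hf.smooth)

lemma contDiffOn_splitVec (hf : IsConvexOn ε f U)
    (hd : Module.finrank ℝ V = Module.finrank ℝ E + 1) : ContDiffOn ℝ ∞ (splitVec f A) U :=
  contDiff_fst.comp_contDiffOn (hf.contDiffOn_inverse_frame_apply hd)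

lemma contDiffOn_splitCoef (hf : IsConvexOn ε f U)
    (hd : Module.finrank ℝ V = Module.finrank ℝ E + 1) : ContDiffOn ℝ ∞ (splitCoef f A) U :=
  contDiff_snd.comp_contDiffOn (hf.contDiffOn_inverse_frame_apply hd)

lemma fderiv_splitVec_and_splitCoef (hf : IsConvexOn ε f U)
    (hd : Module.finrank ℝ V = Module.finrank ℝ E + 1) (hy : y ∈ U)
    (hc : ∀ z, Commute A (gaussOp ε f y z)) (w : E) :
    fderiv ℝ (splitVec f A) y w = -leviCivita (metric ε f) y w (splitVec f A y) ∧
      fderiv ℝ (splitCoef f A) y w = 0 := by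
  have hinv := hf.isInvertible_frame hd hy
  have d0 := differentiableAt_of_contDiffOn hf.smooth hf.isOpen hy
  have d1 := differentiableAt_of_contDiffOn (contDiffOn_fderiv hf.smooth hf.isOpen) hf.isOpen hy
  have dt := differentiableAt_of_contDiffOn (hf.contDiffOn_splitVec hd (A := A)) hf.isOpen hy
  have dc := differentiableAt_of_contDiffOn (hf.contDiffOn_splitCoef hd (A := A)) hf.isOpen hy
  have hAw : A (fderiv ℝ f y w) = gaussOp ε f y w (A (f y)) := by
    rw [← gaussOp_self (ε := ε) hinv]
    exact DFunLike.congr_fun (hc w).eq (f y)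
  have hdiff : fderiv ℝ (fun y => A (f y)) y w = A (fderiv ℝ f y w) :=
    DFunLike.congr_fun (A.hasFDerivAt.comp y d0.hasFDerivAt).fderiv w
  rw [fderiv_congr_on hf.isOpen hy fun y hy =>
      apply_eq_split (A := A) (hf.isInvertible_frame hd hy),
    fderiv_fun_add (d1.clm_apply dt) (dc.fun_smul d0), add_apply, fderiv_eval d1 dt,
    fderiv_fun_smul dc d0, hAw, apply_eq_split hinv, map_add,
    map_smul, gaussOp_fderiv' hf.sign_mul_self hinv, gaussOp_self hinv] at hdiff
  simp only [add_apply, smul_apply, ContinuousLinearMap.smulRight_apply] at hdiff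
  refine frame_eq_iff hinv ?_
  rw [map_neg, ← sub_eq_zero]
  rw [← sub_eq_zero] at hdiff
  rw [← hdiff]
  module

lemma gaussOp_eq_of_commute (hf : IsConvexOn ε f U)
    (hd : Module.finrank ℝ V = Module.finrank ℝ E + 1) (hy : y ∈ U)
    (hc : ∀ z, Commute A (gaussOp ε f y z)) {t : E} (ht : A (f y) = fderiv ℝ f y t) :
    gaussOp ε f y t = A := by
  have hinv := hf.isInvertible_frame hd hy
  refine frame_hom_ext hinv (fun u => ?_) ?_
  · have hAu := DFunLike.congr_fun (hc u).eq (f y)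
    simp only [mul_apply_eq_comp, gaussOp_self hinv, ht] at hAu
    rw [hAu, gaussOp_fderiv hinv, gaussOp_fderiv hinv, hf.diffTensor_symm hd hy, hf.metric_symm hy]
  · rw [ht, gaussOp_self hinv]

lemma contDiffOn_gaussLie (hf : IsConvexOn ε f U)
    (hd : Module.finrank ℝ V = Module.finrank ℝ E + 1) : ContDiffOn ℝ ∞ (gaussLie ε f A) U :=
  contDiffOn_const.clm_comp (hf.contDiffOn_gaussOp hd)

lemma fderiv_gaussLie (hf : IsConvexOn ε f U) (hp : IsParallelOn ε f U)
    (hd : Module.finrank ℝ V = Module.finrank ℝ E + 1) (hy : y ∈ U) (w z : E) :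
    fderiv ℝ (gaussLie ε f A) y w z = gaussLie ε f A y (leviCivita (metric ε f) y w z) +
      (⁅gaussLie ε f A y w, gaussOp ε f y z⁆ + ⁅gaussOp ε f y w, gaussLie ε f A y z⁆) := by
  have dN := differentiableAt_of_contDiffOn (hf.contDiffOn_gaussOp hd) hf.isOpen hy
  have hlie : fderiv ℝ (gaussLie ε f A) y w z = ⁅A, fderiv ℝ (gaussOp ε f) y w z⁆ := by
    change fderiv ℝ (fun y => (ContinuousLinearMap.comp _ (gaussOp ε f y))) y w z = _
    rw [fderiv_clm_comp (differentiableAt_const _) dN]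
    simp
    rfl
  rw [hlie, hf.fderiv_gaussOp hp hd hy]
  simp only [gaussLie_apply, Ring.lie_def]
  noncomm_ring

lemma norm_fderiv_gaussLie_le (hf : IsConvexOn ε f U) (hp : IsParallelOn ε f U)
    (hd : Module.finrank ℝ V = Module.finrank ℝ E + 1) (hy : y ∈ U) (w : E) :
    ‖fderiv ℝ (gaussLie ε f A) y w‖ ≤
      (‖leviCivita (metric ε f) y‖ + 4 * ‖gaussOp ε f y‖) * ‖w‖ * ‖gaussLie ε f A y‖ := by
  refine ContinuousLinearMap.opNorm_le_bound _ (by positivity) fun z => ?_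
  set N := gaussOp ε f y
  set L := leviCivita (metric ε f) y
  set H := gaussLie ε f A y
  calc ‖fderiv ℝ (gaussLie ε f A) y w z‖ = ‖H (L w z) + (⁅H w, N z⁆ + ⁅N w, H z⁆)‖ := by
        rw [hf.fderiv_gaussLie hp hd hy]
    _ ≤ ‖H‖ * (‖L‖ * ‖w‖ * ‖z‖)
        + (2 * (‖H‖ * ‖w‖) * (‖N‖ * ‖z‖) + 2 * (‖N‖ * ‖w‖) * (‖H‖ * ‖z‖)) := by
      refine (norm_add_le _ _).trans (add_le_add ?_ ((norm_add_le _ _).trans (add_le_add ?_ ?_)))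
      · exact H.le_opNorm_of_le (L.le_opNorm₂ w z)
      · exact (norm_lie_le _ _).trans (by gcongr <;> exact ContinuousLinearMap.le_opNorm _ _)
      · exact (norm_lie_le _ _).trans (by gcongr <;> exact ContinuousLinearMap.le_opNorm _ _)
    _ = (‖L‖ + 4 * ‖N‖) * ‖w‖ * ‖H‖ * ‖z‖ := by ring

lemma commute_of_convex (hf : IsConvexOn ε f U) (hp : IsParallelOn ε f U)
    (hd : Module.finrank ℝ V = Module.finrank ℝ E + 1) (hU : Convex ℝ U) {y₀ y₁ : E}
    (h₀ : y₀ ∈ U) (h₁ : y₁ ∈ U) (hc : ∀ z, Commute A (gaussOp ε f y₀ z)) (z : E) :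
    Commute A (gaussOp ε f y₁ z) :=
  gaussLie_eq_zero_iff.1 (eq_zero_of_norm_fderiv_segment_le hU hf.isOpen
    ((hf.contDiffOn_gaussLie hd).differentiableOn (by simp))
    (((hf.contDiffOn_leviCivita hd).continuousOn.norm.add
      (continuousOn_const.mul (hf.contDiffOn_gaussOp hd).continuousOn.norm)).mul continuousOn_const)
    h₀ h₁ (fun _ hy => hf.norm_fderiv_gaussLie_le hp hd hy _) (gaussLie_eq_zero_iff.2 hc)) z

lemma isSplitAt_of_convex (hf : IsConvexOn ε f U) (hp : IsParallelOn ε f U)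
    (hd : Module.finrank ℝ V = Module.finrank ℝ E + 1) (hU : Convex ℝ U) {y₀ y₁ : E}
    (h₀ : y₀ ∈ U) (h₁ : y₁ ∈ U) (hs : IsSplitAt ε f A y₀) : IsSplitAt ε f A y₁ := by
  have hc : ∀ y ∈ U, ∀ z, Commute A (gaussOp ε f y z) := fun y hy =>
    hf.commute_of_convex hp hd hU h₀ hy hs.commute
  have hconst : splitCoef f A y₁ = splitCoef f A y₀ :=
    eq_of_fderiv_segment_eq_zero hU hf.isOpen
      ((hf.contDiffOn_splitCoef hd).differentiableOn (by simp)) h₀ h₁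
      fun y hy => (hf.fderiv_splitVec_and_splitCoef hd hy (hc y hy) _).2
  refine ⟨⟨splitVec f A y₁, hf.gaussOp_eq_of_commute hd h₁ (hc y₁ h₁) ?_⟩, hc y₁ h₁⟩
  rw [apply_eq_split (hf.isInvertible_frame hd h₁), hconst,
    hs.splitCoef_eq_zero (hf.isInvertible_frame hd h₀), zero_smul, add_zero]

end IsConvexOn

end Propagation

/-! ### Factors of a splitting -/

section Factor

variable {E V E₁ V₁ : Type*} [NormedAddCommGroup E] [NormedSpace ℝ E]
  [NormedAddCommGroup V] [NormedSpace ℝ V]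
  [NormedAddCommGroup E₁] [NormedSpace ℝ E₁]
  [NormedAddCommGroup V₁] [NormedSpace ℝ V₁]
  {ε : ℝ} {f : E → V} {U : Set E}

/-- A factor of a product decomposition of the hypersurface `f`. The projection `ι ∘ ρ` of the
ambient space commutes with all operators `N_z` and is onto the ambient space of the factor,
`j : E₁ → E` is the inclusion of the tangent space of the factor and `π : E → E₁` the projection
onto it; `κ` is the constant for which `(z, c) ↦ (π z, κ c)` converts the Gauss formula of `f`
into that of the factor. -/
structure IsFactor (ε κ : ℝ) (f : E → V) (U : Set E) (ι : V₁ →L[ℝ] V) (ρ : V →L[ℝ] V₁)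
    (j : E₁ →L[ℝ] E) (π : E →L[ℝ] E₁) : Prop where
  ρ_ι : ∀ x, ρ (ι x) = x
  π_j : ∀ a, π (j a) = a
  commute : ∀ y ∈ U, ∀ z x, ι (ρ (gaussOp ε f y z x)) = gaussOp ε f y z (ι (ρ x))
  tangent : ∀ y ∈ U, ∀ a, ι (ρ (fderiv ℝ f y (j a))) = fderiv ℝ f y (j a)
  transversal : ∀ y ∈ U, ∀ u, fderiv ℝ f y u ≠ ι (ρ (f y))
  decomp : ∀ y ∈ U, ∀ (z : E) (c : ℝ), ι (ρ (fderiv ℝ f y z + (-ε * c) • f y)) =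
      fderiv ℝ f y z + (-ε * c) • f y →
    fderiv ℝ f y z + (-ε * c) • f y = fderiv ℝ f y (j (π z)) + (κ * c) • ι (ρ (f y))

/-- The hypersurface `ψ` of the factor is, up to the scale `s`, the projection to `V₁` of the
restriction of `f` to the slice `y₀ + j E₁`. -/
structure IsSlice (s : ℝ) (y₀ : E) (j : E₁ →L[ℝ] E) (ρ : V →L[ℝ] V₁) (f : E → V) (U : Set E)
    (ψ : E₁ → V₁) (U₁ : Set E₁) : Prop where
  isOpen : IsOpen U₁
  mapsTo : ∀ v ∈ U₁, y₀ + j v ∈ U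
  eq : ∀ v ∈ U₁, ψ v = s • ρ (f (y₀ + j v))
  ne_zero : s ≠ 0

variable {κ ε₁ s : ℝ} {ι : V₁ →L[ℝ] V} {ρ : V →L[ℝ] V₁} {j : E₁ →L[ℝ] E} {π : E →L[ℝ] E₁}
  {y₀ : E} {U₁ : Set E₁} {ψ : E₁ → V₁} {v : E₁}

lemma hasFDerivAt_slice (v : E₁) : HasFDerivAt (fun v => y₀ + j v) j v :=
  j.hasFDerivAt.const_add y₀

lemma fderiv_comp_slice {F : Type*} [NormedAddCommGroup F] [NormedSpace ℝ F] {g : E → F}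
    (hg : DifferentiableAt ℝ g (y₀ + j v)) (a : E₁) :
    fderiv ℝ (fun v => g (y₀ + j v)) v a = fderiv ℝ g (y₀ + j v) (j a) := by
  have := (hg.hasFDerivAt.comp v (hasFDerivAt_slice (y₀ := y₀) (j := j) v)).fderiv
  exact DFunLike.congr_fun this a

lemma differentiableAt_comp_slice {F : Type*} [NormedAddCommGroup F] [NormedSpace ℝ F] {g : E → F}
    (hg : DifferentiableAt ℝ g (y₀ + j v)) : DifferentiableAt ℝ (fun v => g (y₀ + j v)) v :=
  (hg.hasFDerivAt.comp v (hasFDerivAt_slice (y₀ := y₀) (j := j) v)).differentiableAt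

variable (hf : IsConvexOn ε f U) (hp : IsParallelOn ε f U)
    (hd : Module.finrank ℝ V = Module.finrank ℝ E + 1)
    (hF : IsFactor ε κ f U ι ρ j π) (hψ : IsSlice s y₀ j ρ f U ψ U₁)
    (hd₁ : Module.finrank ℝ V₁ = Module.finrank ℝ E₁ + 1)
    (hε₁ : ε₁ = 1 ∨ ε₁ = -1) (hκ : 0 < -ε₁ * κ)

include hf hψ in
lemma IsSlice.fderiv_apply (hv : v ∈ U₁) (a : E₁) :
    fderiv ℝ ψ v a = s • ρ (fderiv ℝ f (y₀ + j v) (j a)) := by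
  have d0 := differentiableAt_of_contDiffOn hf.smooth hf.isOpen (hψ.mapsTo v hv)
  have := ((s • ρ).hasFDerivAt.comp v
    (d0.hasFDerivAt.comp v (hasFDerivAt_slice (y₀ := y₀) (j := j) v))).fderiv
  rw [fderiv_congr_on hψ.isOpen hv hψ.eq]
  exact DFunLike.congr_fun this a

include hf hψ in
lemma IsSlice.contDiffOn : ContDiffOn ℝ ∞ ψ U₁ := by
  refine ContDiffOn.congr ?_ hψ.eq
  exact ContDiffOn.const_smul s (ρ.contDiff.comp_contDiffOn
    (hf.smooth.comp (contDiff_const.add j.contDiff).contDiffOn hψ.mapsTo))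

include hf hψ in
lemma IsSlice.fderiv_fderiv_apply (hv : v ∈ U₁) (a b : E₁) :
    fderiv ℝ (fderiv ℝ ψ) v a b =
      s • ρ (fderiv ℝ (fderiv ℝ f) (y₀ + j v) (j a) (j b)) := by
  have d1' := differentiableAt_of_contDiffOn (contDiffOn_fderiv (hψ.contDiffOn hf) hψ.isOpen)
    hψ.isOpen hv
  have d1 := differentiableAt_of_contDiffOn (contDiffOn_fderiv hf.smooth hf.isOpen) hf.isOpen
    (hψ.mapsTo v hv)
  have d1b : DifferentiableAt ℝ (fun y => fderiv ℝ f y (j b)) (y₀ + j v) :=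
    d1.clm_apply (differentiableAt_const _)
  rw [← fderiv_eval_const d1', fderiv_congr_on hψ.isOpen hv fun v hv =>
    hψ.fderiv_apply hf hv b]
  have := ((s • ρ).hasFDerivAt.comp v
    (d1b.hasFDerivAt.comp v (hasFDerivAt_slice (y₀ := y₀) (j := j) v))).fderiv
  rw [← fderiv_eval_const d1]
  exact DFunLike.congr_fun this a

include hf hF in
lemma IsFactor.fderiv_fderiv_tangent {y : E} (hy : y ∈ U) (z : E) (b : E₁) :
    ι (ρ (fderiv ℝ (fderiv ℝ f) y z (j b))) = fderiv ℝ (fderiv ℝ f) y z (j b) := by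
  have d1 := differentiableAt_of_contDiffOn (contDiffOn_fderiv hf.smooth hf.isOpen) hf.isOpen hy
  have d1b : DifferentiableAt ℝ (fun y => fderiv ℝ f y (j b)) y :=
    d1.clm_apply (differentiableAt_const _)
  have h1 := DFunLike.congr_fun (fderiv_congr_on hf.isOpen hy fun y hy => hF.tangent y hy b) z
  have h2 : fderiv ℝ (fun y => ι (ρ (fderiv ℝ f y (j b)))) y z =
      ι (ρ (fderiv ℝ (fun y => fderiv ℝ f y (j b)) y z)) :=
    DFunLike.congr_fun ((ι.comp ρ).hasFDerivAt.comp y d1b.hasFDerivAt).fderiv z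
  rw [fderiv_eval_const d1] at h1 h2
  exact h2.symm.trans h1

include hf hF hψ hd₁ in
lemma IsSlice.isInvertible_frame [FiniteDimensional ℝ E₁] [FiniteDimensional ℝ V₁]
    (hv : v ∈ U₁) : (frame ψ v).IsInvertible := by
  refine Centroaffine.isInvertible_frame hd₁ fun a r h => ?_
  have hy := hψ.mapsTo v hv
  rw [hψ.fderiv_apply hf hv, hψ.eq v hv, smul_comm r, ← smul_add,
    smul_eq_zero_iff_right hψ.ne_zero] at h
  have h1 := congrArg ι h
  rw [map_add, hF.tangent _ hy, map_smul, map_zero] at h1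
  have hr : r = 0 := by
    by_contra hr
    refine hF.transversal _ hy (-r⁻¹ • j a) ?_
    rw [map_smul, eq_neg_of_add_eq_zero_left h1, smul_neg, neg_smul, neg_neg, smul_smul,
      inv_mul_cancel₀ hr, one_smul]
  subst hr
  rw [zero_smul, add_zero] at h1
  have h2 := hf.immersion _ hy (h1.trans (map_zero _).symm)
  rw [← hF.π_j a, h2, map_zero]
  exact ⟨rfl, rfl⟩

variable [FiniteDimensional ℝ E] [FiniteDimensional ℝ V]

include hf hF hd in
lemma IsFactor.leviCivita_eq {y : E} (hy : y ∈ U) (z : E) (b : E₁) :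
    leviCivita (metric ε f) y z (j b) = j (π (leviCivita (metric ε f) y z (j b))) := by
  have hinv := hf.isInvertible_frame hd hy
  have h1 := hF.commute y hy z (fderiv ℝ f y (j b))
  rw [hF.tangent y hy, gaussOp_fderiv' hf.sign_mul_self hinv, map_sub, map_sub,
    hF.fderiv_fderiv_tangent hf hy] at h1
  have h2 := hF.decomp y hy (leviCivita (metric ε f) y z (j b)) 0
  simp only [mul_zero, zero_smul, add_zero] at h2
  exact hf.immersion y hy (h2 (by simpa using h1))

include hf hF hd in
lemma IsFactor.metric_inducedConn {y : E} (hy : y ∈ U) (a b c : E₁) :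
    metric ε f y (j (π (inducedConn f y (j a) (j b)))) (j c) =
      metric ε f y (inducedConn f y (j a) (j b)) (j c) := by
  have hinv := hf.isInvertible_frame hd hy
  obtain ⟨t, r, ht⟩ : ∃ t r, ι (ρ (f y)) = fderiv ℝ f y t + r • f y :=
    ⟨_, _, exists_frame_coord hinv _⟩
  have h1 := hF.commute y hy (j c) (f y)
  rw [gaussOp_self hinv, hF.tangent y hy, ht, map_add, map_smul, gaussOp_fderiv hinv,
    gaussOp_self hinv] at h1
  have h2 := (frame_eq_iff hinv (a := j c) (s := 0)
    (b := diffTensor ε f y (j c) t + r • j c) (r := -ε * metric ε f y (j c) t) (by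
      rw [zero_smul, add_zero, h1, map_add, map_smul]; abel)).2
  have h3 : metric ε f y t (j c) = 0 := by
    rw [hf.metric_symm hy]
    exact (mul_eq_zero.1 h2.symm).resolve_left (by rcases hf.sign with h | h <;> simp [h])
  have h4 := hF.fderiv_fderiv_tangent hf hy (j a) b
  rw [gauss_formula hf.sign_mul_self hinv] at h4
  have h5 := hF.decomp _ hy _ _ h4
  rw [ht, smul_add, smul_smul, ← map_smul, ← add_assoc, ← map_add] at h5
  conv_rhs => rw [(frame_eq_iff hinv h5).1]
  rw [map_add, add_apply, map_smul, smul_apply, h3, smul_zero, add_zero]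

variable [FiniteDimensional ℝ E₁] [FiniteDimensional ℝ V₁]

include hf hd hF hψ hd₁ in
lemma IsSlice.inducedConn_and_metric (hε₁' : ε₁ * ε₁ = 1) (hv : v ∈ U₁) (a b : E₁) :
    inducedConn ψ v a b = π (inducedConn f (y₀ + j v) (j a) (j b)) ∧
      metric ε₁ ψ v a b = -ε₁ * κ * metric ε f (y₀ + j v) (j a) (j b) := by
  have hy := hψ.mapsTo v hv
  have hinv := hf.isInvertible_frame hd hy
  refine gauss_unique hε₁' (hψ.isInvertible_frame hf hF hd₁ hv) ?_
  have h1 := hF.fderiv_fderiv_tangent hf hy (j a) b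
  rw [gauss_formula hf.sign_mul_self hinv] at h1
  rw [hψ.fderiv_fderiv_apply hf hv, gauss_formula hf.sign_mul_self hinv, hF.decomp _ hy _ _ h1,
    hψ.fderiv_apply hf hv, hψ.eq v hv, map_add, map_smul, hF.ρ_ι, smul_add, smul_comm _ s,
    ← mul_assoc, ← mul_assoc, neg_mul_neg, hε₁', one_mul]

include hf hd hF hψ hd₁ hε₁ hκ in
theorem IsSlice.isConvexOn : IsConvexOn ε₁ ψ U₁ := by
  have hε₁' : ε₁ * ε₁ = 1 := by rcases hε₁ with h | h <;> simp [h]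
  refine ⟨hε₁, hψ.isOpen, hψ.contDiffOn hf, fun v hv a b hab => ?_, fun v hv u hu => ?_,
    fun v hv u hu => ?_⟩
  · exact (frame_eq_iff (hψ.isInvertible_frame hf hF hd₁ hv)
      (s := 0) (r := 0) (by simpa using hab)).1
  · have := (frame_eq_iff (hψ.isInvertible_frame hf hF hd₁ hv) (a := u) (b := 0)
      (s := 0) (r := 1) (by simpa using hu)).2
    exact zero_ne_one this
  · rw [(hψ.inducedConn_and_metric hf hd hF hd₁ hε₁' hv u u).2]
    refine mul_pos hκ (hf.metric_pos _ (hψ.mapsTo v hv) _ fun h => hu ?_)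
    rw [← hF.π_j u, h, map_zero]

include hf hd hF hψ hd₁ hε₁ hκ in
lemma IsSlice.fderiv_metric_apply (hv : v ∈ U₁) (w a b : E₁) :
    fderiv ℝ (metric ε₁ ψ) v w a b =
      -ε₁ * κ * fderiv ℝ (metric ε f) (y₀ + j v) (j w) (j a) (j b) := by
  have hc := hψ.isConvexOn hf hd hF hd₁ hε₁ hκ
  have dh := differentiableAt_of_contDiffOn (hf.contDiffOn_metric hd) hf.isOpen (hψ.mapsTo v hv)
  have dh₁ := differentiableAt_of_contDiffOn (hc.contDiffOn_metric hd₁) hc.isOpen hv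
  have dab : DifferentiableAt ℝ (fun y => metric ε f y (j a) (j b)) (y₀ + j v) :=
    (dh.clm_apply (differentiableAt_const _)).clm_apply (differentiableAt_const _)
  have dab' : DifferentiableAt ℝ (fun v => metric ε f (y₀ + j v) (j a) (j b)) v :=
    differentiableAt_comp_slice dab
  rw [← fderiv_eval_const₂ dh₁, fderiv_congr_on hψ.isOpen hv fun v hv =>
    (hψ.inducedConn_and_metric hf hd hF hd₁ hc.sign_mul_self hv a b).2, fderiv_const_mul dab',
    smul_apply, fderiv_comp_slice dab, fderiv_eval_const₂ dh, smul_eq_mul]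

include hf hd hF hψ hd₁ hε₁ hκ in
lemma IsSlice.leviCivita_apply (hv : v ∈ U₁) (a b : E₁) :
    j (leviCivita (metric ε₁ ψ) v a b) = leviCivita (metric ε f) (y₀ + j v) (j a) (j b) := by
  have hc := hψ.isConvexOn hf hd hF hd₁ hε₁ hκ
  have hy := hψ.mapsTo v hv
  rw [(hc.isRiemannianOn hd₁).leviCivita_unique hv
    (G := fun a b => π (leviCivita (metric ε f) (y₀ + j v) (j a) (j b))),
    ← hF.leviCivita_eq hf hd hy]
  · intro a b
    rw [(hf.isRiemannianOn hd).leviCivita_symm hy]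
  · intro w a b
    rw [hψ.fderiv_metric_apply hf hd hF hd₁ hε₁ hκ hv,
      (hψ.inducedConn_and_metric hf hd hF hd₁ hc.sign_mul_self hv _ _).2,
      (hψ.inducedConn_and_metric hf hd hF hd₁ hc.sign_mul_self hv _ _).2,
      ← hF.leviCivita_eq hf hd hy, ← hF.leviCivita_eq hf hd hy,
      (hf.isRiemannianOn hd).fderiv_apply hy]
    ring

include hf hd hF hψ hd₁ hε₁ hκ in
lemma IsSlice.cubicForm_apply (hv : v ∈ U₁) (a b c : E₁) :
    cubicForm ε₁ ψ v a b c = -ε₁ * κ * cubicForm ε f (y₀ + j v) (j a) (j b) (j c) := by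
  have hc := hψ.isConvexOn hf hd hF hd₁ hε₁ hκ
  have hy := hψ.mapsTo v hv
  simp only [cubicForm]
  rw [hψ.fderiv_metric_apply hf hd hF hd₁ hε₁ hκ hv, hc.metric_symm hv b,
    (hψ.inducedConn_and_metric hf hd hF hd₁ hc.sign_mul_self hv _ _).2,
    (hψ.inducedConn_and_metric hf hd hF hd₁ hc.sign_mul_self hv _ _).2,
    (hψ.inducedConn_and_metric hf hd hF hd₁ hc.sign_mul_self hv _ _).1,
    (hψ.inducedConn_and_metric hf hd hF hd₁ hc.sign_mul_self hv _ _).1,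
    hF.metric_inducedConn hf hd hy, hF.metric_inducedConn hf hd hy,
    hf.metric_symm hy (j b)]
  ring

include hf hp hd hF hψ hd₁ hε₁ hκ in
theorem IsSlice.isParallelOn : IsParallelOn ε₁ ψ U₁ := by
  intro v hv z a b c
  have hy := hψ.mapsTo v hv
  have h := hp _ hy (j z) (j a) (j b) (j c)
  have dC : DifferentiableAt ℝ (fun y => cubicForm ε f y (j a) (j b) (j c)) (y₀ + j v) := by
    have dh := differentiableAt_of_contDiffOn (hf.contDiffOn_metric hd) hf.isOpen hy
    have dh' := differentiableAt_of_contDiffOn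
      (contDiffOn_fderiv (hf.contDiffOn_metric hd) hf.isOpen) hf.isOpen hy
    have dG := differentiableAt_of_contDiffOn (hf.contDiffOn_inducedConn hd) hf.isOpen hy
    simp only [cubicForm]
    fun_prop
  have dC' : DifferentiableAt ℝ (fun v => cubicForm ε f (y₀ + j v) (j a) (j b) (j c)) v :=
    differentiableAt_comp_slice dC
  simp only [covDerivCubicForm] at h ⊢
  rw [fderiv_congr_on hψ.isOpen hv fun v hv =>
      hψ.cubicForm_apply hf hd hF hd₁ hε₁ hκ hv a b c, fderiv_const_mul dC',
    smul_apply, fderiv_comp_slice dC, smul_eq_mul,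
    hψ.cubicForm_apply hf hd hF hd₁ hε₁ hκ hv,
    hψ.cubicForm_apply hf hd hF hd₁ hε₁ hκ hv,
    hψ.cubicForm_apply hf hd hF hd₁ hε₁ hκ hv,
    hψ.leviCivita_apply hf hd hF hd₁ hε₁ hκ hv,
    hψ.leviCivita_apply hf hd hF hd₁ hε₁ hκ hv,
    hψ.leviCivita_apply hf hd hF hd₁ hε₁ hκ hv, ← mul_sub, ← mul_sub, ← mul_sub, h,
    mul_zero]

end Factor

section EigenSplitting

variable {V V₁ V₂ : Type*} [NormedAddCommGroup V] [NormedSpace ℝ V]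
  [NormedAddCommGroup V₁] [NormedSpace ℝ V₁] [NormedAddCommGroup V₂] [NormedSpace ℝ V₂]
  {α β : ℝ} {A : V →L[ℝ] V}
  {ι₁ : V₁ →L[ℝ] V} {ρ₁ : V →L[ℝ] V₁} {ι₂ : V₂ →L[ℝ] V} {ρ₂ : V →L[ℝ] V₂}

/-- `V` is the direct sum of eigenspaces of `A` for the eigenvalues `α` and `β`; `ιᵢ` is the
inclusion of the `i`-th summand and `ρᵢ` the projection onto it. -/
structure IsEigenSplitting (α β : ℝ) (A : V →L[ℝ] V) (ι₁ : V₁ →L[ℝ] V) (ρ₁ : V →L[ℝ] V₁)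
    (ι₂ : V₂ →L[ℝ] V) (ρ₂ : V →L[ℝ] V₂) : Prop where
  ρ_ι₁ : ∀ x, ρ₁ (ι₁ x) = x
  ρ_ι₂ : ∀ x, ρ₂ (ι₂ x) = x
  add_eq : ∀ x, ι₁ (ρ₁ x) + ι₂ (ρ₂ x) = x
  apply_ι₁ : ∀ x, A (ι₁ x) = α • ι₁ x
  apply_ι₂ : ∀ x, A (ι₂ x) = β • ι₂ x

namespace IsEigenSplitting

lemma symm (h : IsEigenSplitting α β A ι₁ ρ₁ ι₂ ρ₂) : IsEigenSplitting β α A ι₂ ρ₂ ι₁ ρ₁ :=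
  ⟨h.ρ_ι₂, h.ρ_ι₁, fun x => (add_comm _ _).trans (h.add_eq x), h.apply_ι₂, h.apply_ι₁⟩

lemma ρ₁_ι₂ (h : IsEigenSplitting α β A ι₁ ρ₁ ι₂ ρ₂) (x : V₂) : ρ₁ (ι₂ x) = 0 := by
  have h₁ : ι₁ (ρ₁ (ι₂ x)) = 0 := by simpa [h.ρ_ι₂] using h.add_eq (ι₂ x)
  rw [← h.ρ_ι₁ (ρ₁ (ι₂ x)), h₁, map_zero]

lemma ρ₂_ι₁ (h : IsEigenSplitting α β A ι₁ ρ₁ ι₂ ρ₂) (x : V₁) : ρ₂ (ι₁ x) = 0 :=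
  h.symm.ρ₁_ι₂ x

lemma apply_eq (h : IsEigenSplitting α β A ι₁ ρ₁ ι₂ ρ₂) (x : V) :
    A x = α • ι₁ (ρ₁ x) + β • ι₂ (ρ₂ x) := by
  conv_lhs => rw [← h.add_eq x, map_add, h.apply_ι₁, h.apply_ι₂]

lemma sub_smul_ι₁_ρ₁ (h : IsEigenSplitting α β A ι₁ ρ₁ ι₂ ρ₂) (x : V) :
    (α - β) • ι₁ (ρ₁ x) = A x - β • x := by
  conv_rhs => rw [h.apply_eq, ← h.add_eq x]
  simp only [map_add, h.ρ_ι₁, h.ρ₁_ι₂, map_zero, h.ρ_ι₂, h.ρ₂_ι₁]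
  module

lemma apply_apply (h : IsEigenSplitting α β A ι₁ ρ₁ ι₂ ρ₂) (x : V) :
    A (A x) = (α + β) • A x - (α * β) • x := by
  conv_rhs => rw [← h.add_eq x]
  rw [h.apply_eq x]
  simp only [map_add, map_smul, h.apply_ι₁, h.apply_ι₂]
  module

lemma ι₁_ρ₁_comm (h : IsEigenSplitting α β A ι₁ ρ₁ ι₂ ρ₂) (hαβ : α ≠ β) {N : V →L[ℝ] V}
    (hN : Commute A N) (x : V) : ι₁ (ρ₁ (N x)) = N (ι₁ (ρ₁ x)) := by
  refine smul_right_injective V (sub_ne_zero.2 hαβ) ?_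
  simp only
  rw [← map_smul N, h.sub_smul_ι₁_ρ₁, h.sub_smul_ι₁_ρ₁, map_sub, map_smul]
  exact congrArg (· - β • N x) (DFunLike.congr_fun hN.eq x)

lemma ι₁_ρ₁_of_apply_eq (h : IsEigenSplitting α β A ι₁ ρ₁ ι₂ ρ₂) (hαβ : α ≠ β) {x : V}
    (hx : A x = α • x) : ι₁ (ρ₁ x) = x := by
  refine smul_right_injective V (sub_ne_zero.2 hαβ) ?_
  simp only
  rw [h.sub_smul_ι₁_ρ₁, hx, sub_smul]

/-- The isomorphism of the product of the two eigenspaces with the ambient space. -/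
def equiv (h : IsEigenSplitting α β A ι₁ ρ₁ ι₂ ρ₂) : (V₁ × V₂) ≃L[ℝ] V :=
  ContinuousLinearEquiv.equivOfInverse (ι₁.coprod ι₂) (ρ₁.prod ρ₂)
    (fun x => by ext <;> simp [h.ρ_ι₁, h.ρ_ι₂, h.ρ₁_ι₂, h.ρ₂_ι₁]) (fun x => by simp [h.add_eq])

lemma equiv_apply (h : IsEigenSplitting α β A ι₁ ρ₁ ι₂ ρ₂) (x : V₁ × V₂) :
    h.equiv x = ι₁ x.1 + ι₂ x.2 := rfl

end IsEigenSplitting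

variable [FiniteDimensional ℝ V]

lemma exists_clm_comp_eq_of_isIdempotentElem {P : V →L[ℝ] V} (hP : IsIdempotentElem P) :
    ∃ (k : ℕ) (ι : Eu k →L[ℝ] V) (ρ : V →L[ℝ] Eu k), (∀ x, ρ (ι x) = x) ∧ ∀ x, ι (ρ x) = P x := by
  let e : P.toLinearMap.range ≃ₗ[ℝ] Eu (Module.finrank ℝ P.toLinearMap.range) :=
    LinearEquiv.ofFinrankEq _ _ finrank_euclideanSpace_fin.symm
  refine ⟨_, (P.toLinearMap.range.subtype ∘ₗ e.symm.toLinearMap).toContinuousLinearMap,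
    (e.toLinearMap ∘ₗ P.toLinearMap.rangeRestrict).toContinuousLinearMap, fun x => ?_,
    fun x => ?_⟩
  · have h : P.toLinearMap.rangeRestrict (e.symm x : V) = e.symm x := by
      obtain ⟨w, hw⟩ := (e.symm x).2
      refine Subtype.ext ?_
      rw [← hw]
      exact DFunLike.congr_fun hP.eq w
    simpa using (congrArg e h).trans (e.apply_symm_apply x)
  · simp

lemma exists_isEigenSplitting (hA : ∀ x, A (A x) = (α + β) • A x - (α * β) • x) (hαβ : α ≠ β) :
    ∃ (k₁ k₂ : ℕ) (ι₁ : Eu k₁ →L[ℝ] V) (ρ₁ : V →L[ℝ] Eu k₁) (ι₂ : Eu k₂ →L[ℝ] V)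
      (ρ₂ : V →L[ℝ] Eu k₂), IsEigenSplitting α β A ι₁ ρ₁ ι₂ ρ₂ := by
  have hne : α - β ≠ 0 := sub_ne_zero.2 hαβ
  let P : V →L[ℝ] V := (α - β)⁻¹ • (A - β • 1)
  have hPA (x : V) : P x = (α - β)⁻¹ • (A x - β • x) := rfl
  have hP : IsIdempotentElem P := by
    ext x
    rw [_root_.mul_apply_eq_comp, hPA, hPA, map_smul, map_sub, map_smul, hA]
    match_scalars <;> field
  obtain ⟨k₁, ι₁, ρ₁, hρι₁, hP₁⟩ := exists_clm_comp_eq_of_isIdempotentElem hP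
  obtain ⟨k₂, ι₂, ρ₂, hρι₂, hP₂⟩ := exists_clm_comp_eq_of_isIdempotentElem hP.one_sub
  refine ⟨k₁, k₂, ι₁, ρ₁, ι₂, ρ₂, hρι₁, hρι₂, fun x => ?_, fun x => ?_, fun x => ?_⟩
  · rw [hP₁, hP₂, sub_apply, one_apply_eq_self, add_sub_cancel]
  · have h : P (ι₁ x) = ι₁ x := by rw [← hP₁, hρι₁]
    rw [← h, hPA, map_smul, map_sub, map_smul, hA]
    match_scalars <;> field
  · have h : (1 - P) (ι₂ x) = ι₂ x := by rw [← hP₂, hρι₂]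
    rwa [sub_apply, one_apply_eq_self, sub_eq_self, hPA, inv_smul_eq_iff₀ hne, smul_zero,
      sub_eq_zero] at h

end EigenSplitting

section Split

variable {E V V₁ V₂ : Type*} [NormedAddCommGroup E] [NormedSpace ℝ E]
  [NormedAddCommGroup V] [NormedSpace ℝ V]
  [NormedAddCommGroup V₁] [NormedSpace ℝ V₁] [NormedAddCommGroup V₂] [NormedSpace ℝ V₂]
  {ε α β : ℝ} {f : E → V} {U : Set E} {y : E} {A : V →L[ℝ] V}
  {ι₁ : V₁ →L[ℝ] V} {ρ₁ : V →L[ℝ] V₁} {ι₂ : V₂ →L[ℝ] V} {ρ₂ : V →L[ℝ] V₂}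

lemma IsSplitAt.gaussOp_splitVec (hinv : (frame f y).IsInvertible) (hs : IsSplitAt ε f A y) :
    gaussOp ε f y (splitVec f A y) = A := by
  obtain ⟨t, ht⟩ := hs.exists_eq
  have htA : fderiv ℝ f y (splitVec f A y) + (0 : ℝ) • f y = fderiv ℝ f y t + (0 : ℝ) • f y := by
    rw [zero_smul, add_zero, add_zero, ← hs.apply_self hinv, ← ht, gaussOp_self hinv]
  rw [(frame_eq_iff hinv htA).1, ht]

namespace IsEigenSplitting

lemma fderiv_ne_ι₁_ρ₁ (hι : IsEigenSplitting α β A ι₁ ρ₁ ι₂ ρ₂) (hβ : β ≠ 0)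
    (hinv : (frame f y).IsInvertible) (hs : IsSplitAt ε f A y) (u : E) :
    fderiv ℝ f y u ≠ ι₁ (ρ₁ (f y)) := by
  intro hu
  have h := hι.sub_smul_ι₁_ρ₁ (f y)
  rw [← hu, hs.apply_self hinv, ← map_smul, sub_eq_add_neg (fderiv ℝ f y _), ← neg_smul] at h
  have hβ₀ : 0 = -β := (frame_eq_iff hinv (by rwa [zero_smul, add_zero])).2
  exact neg_ne_zero.2 hβ hβ₀.symm

lemma ρ₁_ne_zero (hι : IsEigenSplitting α β A ι₁ ρ₁ ι₂ ρ₂) (hβ : β ≠ 0)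
    (hinv : (frame f y).IsInvertible) (hs : IsSplitAt ε f A y) : ρ₁ (f y) ≠ 0 := fun h =>
  hι.fderiv_ne_ι₁_ρ₁ hβ hinv hs 0 (by rw [h, map_zero, map_zero])

lemma one_le_finrank [FiniteDimensional ℝ V₁] (hι : IsEigenSplitting α β A ι₁ ρ₁ ι₂ ρ₂)
    (hβ : β ≠ 0) (hinv : (frame f y).IsInvertible) (hs : IsSplitAt ε f A y) :
    1 ≤ Module.finrank ℝ V₁ :=
  Module.finrank_pos_iff_exists_ne_zero.2 ⟨_, hι.ρ₁_ne_zero hβ hinv hs⟩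

lemma two_le_finrank [FiniteDimensional ℝ V₁] (hι : IsEigenSplitting α β A ι₁ ρ₁ ι₂ ρ₂)
    (hβ : β ≠ 0) (hαβ : α ≠ β) (hinv : (frame f y).IsInvertible) (hs : IsSplitAt ε f A y)
    {u : E} (hu : u ≠ 0) (hAu : A (fderiv ℝ f y u) = α • fderiv ℝ f y u) :
    2 ≤ Module.finrank ℝ V₁ := by
  have hinj (v : E) (hv : fderiv ℝ f y v = 0) : v = 0 :=
    (frame_eq_iff hinv (b := 0) (s := 0) (r := 0) (by rw [hv, map_zero])).1
  have hui := hι.ι₁_ρ₁_of_apply_eq hαβ hAu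
  have hli : LinearIndependent ℝ ![ρ₁ (fderiv ℝ f y u), ρ₁ (f y)] := by
    refine (LinearIndependent.pair_iff' fun h => hu (hinj u ?_)).2 fun a ha => ?_
    · rw [← hui, h, map_zero]
    · refine hι.fderiv_ne_ι₁_ρ₁ hβ hinv hs (a • u) ?_
      rw [← ha, map_smul, map_smul, hui]
  simpa using hli.fintype_card_le_finrank

end IsEigenSplitting

variable [FiniteDimensional ℝ E] [FiniteDimensional ℝ V]

namespace IsConvexOn

lemma diffTensor_splitVec_and_metric_splitVec (hf : IsConvexOn ε f U)
    (hd : Module.finrank ℝ V = Module.finrank ℝ E + 1) (hy : y ∈ U) (hs : IsSplitAt ε f A y)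
    (hA : A (A (f y)) = (α + β) • A (f y) - (α * β) • f y) :
    diffTensor ε f y (splitVec f A y) (splitVec f A y) = (α + β) • splitVec f A y ∧
      metric ε f y (splitVec f A y) (splitVec f A y) = ε * (α * β) := by
  have hinv := hf.isInvertible_frame hd hy
  rw [hs.apply_self hinv] at hA
  nth_rewrite 1 [← hs.gaussOp_splitVec hinv] at hA
  rw [gaussOp_fderiv hinv, ← map_smul, sub_eq_add_neg, ← neg_smul] at hA
  obtain ⟨hK, hh⟩ := frame_eq_iff hinv hA
  refine ⟨hK, ?_⟩
  linear_combination -ε * hh - metric ε f y (splitVec f A y) (splitVec f A y) * hf.sign_mul_self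

/-- Differentiating `e^{-(ε/β) u} ρ₁ f`, where `du = h(t, ·)`, gives the right-hand side below up
to the exponential factor. -/
lemma exists_fderiv_eq_ι₁_ρ₁ (hf : IsConvexOn ε f U)
    (hd : Module.finrank ℝ V = Module.finrank ℝ E + 1) (hy : y ∈ U) (hs : IsSplitAt ε f A y)
    (hι : IsEigenSplitting α β A ι₁ ρ₁ ι₂ ρ₂) (hβ : β ≠ 0) (hαβ : α ≠ β) (z : E) :
    ∃ z₁, metric ε f y (splitVec f A y) z₁ = 0 ∧ fderiv ℝ f y z₁ =
      ι₁ (ρ₁ (fderiv ℝ f y z - (ε / β * metric ε f y (splitVec f A y) z) • f y)) := by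
  have hinv := hf.isInvertible_frame hd hy
  have hne : α - β ≠ 0 := sub_ne_zero.2 hαβ
  obtain ⟨hK, hh⟩ :=
    hf.diffTensor_splitVec_and_metric_splitVec hd hy hs (hι.apply_apply (f y))
  have hadj := hf.diffTensor_adjoint hd hy (splitVec f A y) (splitVec f A y) z
  have hAz : A (fderiv ℝ f y z) = fderiv ℝ f y (diffTensor ε f y (splitVec f A y) z) +
      (-ε * metric ε f y (splitVec f A y) z) • f y := by
    rw [← gaussOp_fderiv hinv, hs.gaussOp_splitVec hinv]
  have hAf := hs.apply_self hinv
  set t := splitVec f A y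
  set s := metric ε f y t z
  rw [hK, map_smul, smul_apply, smul_eq_mul] at hadj
  refine ⟨(α - β)⁻¹ • (diffTensor ε f y t z - β • z - (ε / β * s) • t), ?_, ?_⟩
  · rw [map_smul, map_sub, map_sub, map_smul, map_smul, ← hadj, hh, smul_eq_mul, smul_eq_mul,
      smul_eq_mul, mul_eq_zero]
    right
    field_simp
    linear_combination -s * α * hf.sign_mul_self
  · rw [map_smul, inv_smul_eq_iff₀ hne, hι.sub_smul_ι₁_ρ₁, map_sub A, map_smul A, hAz, hAf]
    simp only [map_sub, map_smul]
    match_scalars <;> field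

end IsConvexOn

end Split

/-! ### Local product coordinates -/

section Charts

variable {F G : Type*} [NormedAddCommGroup F] [NormedSpace ℝ F]
  [NormedAddCommGroup G] [NormedSpace ℝ G]

lemma exists_clm_ker_eq_span [FiniteDimensional ℝ F] [FiniteDimensional ℝ G] {b : F} (hb : b ≠ 0)
    (hd : Module.finrank ℝ F = Module.finrank ℝ G + 1) :
    ∃ c : F →L[ℝ] G, ∀ x, c x = 0 → ∃ a : ℝ, x = a • b := by
  have hquot := (ℝ ∙ b).finrank_quotient_add_finrank
  rw [finrank_span_singleton hb, hd] at hquot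
  let e : (F ⧸ (ℝ ∙ b)) ≃ₗ[ℝ] G := LinearEquiv.ofFinrankEq _ _ (by omega)
  refine ⟨(e.toLinearMap ∘ₗ (ℝ ∙ b).mkQ).toContinuousLinearMap, fun x hx => ?_⟩
  have hx₀ : (ℝ ∙ b).mkQ x = 0 := by simpa using hx
  obtain ⟨a, ha⟩ := Submodule.mem_span_singleton.1 ((Submodule.Quotient.mk_eq_zero _).1 hx₀)
  exact ⟨a, ha.symm⟩

/-- A diffeomorphism between open subsets of two normed spaces. -/
structure IsSmoothChart (Ψ : OpenPartialHomeomorph F G) : Prop where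
  contDiffOn : ContDiffOn ℝ ∞ Ψ Ψ.source
  contDiffOn_symm : ContDiffOn ℝ ∞ Ψ.symm Ψ.target

namespace IsSmoothChart

variable {Ψ : OpenPartialHomeomorph F G}

lemma symm (hΨ : IsSmoothChart Ψ) : IsSmoothChart Ψ.symm :=
  ⟨hΨ.contDiffOn_symm, hΨ.contDiffOn⟩

lemma fderiv_fderiv_symm (hΨ : IsSmoothChart Ψ) {b : G} (hb : b ∈ Ψ.target) (x : G) :
    fderiv ℝ Ψ (Ψ.symm b) (fderiv ℝ Ψ.symm b x) = x := by
  have hΨb := (differentiableAt_of_contDiffOn hΨ.contDiffOn Ψ.open_source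
    (Ψ.map_target hb)).hasFDerivAt
  have hΨb' := (differentiableAt_of_contDiffOn hΨ.contDiffOn_symm Ψ.open_target hb).hasFDerivAt
  have hcomp : HasFDerivAt (Ψ ∘ Ψ.symm) (.id ℝ G) b :=
    (hasFDerivAt_id b).congr_of_eventuallyEq
      (Filter.eventually_of_mem (Ψ.open_target.mem_nhds hb) fun _ => Ψ.right_inv)
  exact DFunLike.congr_fun ((hΨb.comp b hΨb').unique hcomp) x

lemma fderiv_injective (hΨ : IsSmoothChart Ψ) {a : F} (ha : a ∈ Ψ.source) :
    Function.Injective (fderiv ℝ Ψ a) := by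
  have hleft := hΨ.symm.fderiv_fderiv_symm (b := a) ha
  exact Function.LeftInverse.injective hleft

lemma apply_symm_eq_of_fderiv_eq_zero {W Z : Type*} [NormedAddCommGroup W] [NormedSpace ℝ W]
    [NormedAddCommGroup Z] [NormedSpace ℝ Z] {φ : F → W} {π : G →L[ℝ] Z} (hΨ : IsSmoothChart Ψ)
    (hconv : Convex ℝ Ψ.target) (hφ : DifferentiableOn ℝ φ Ψ.source)
    (h : ∀ a ∈ Ψ.source, ∀ z, π (fderiv ℝ Ψ a z) = 0 → fderiv ℝ φ a z = 0) {b b' : G}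
    (hb : b ∈ Ψ.target) (hb' : b' ∈ Ψ.target) (hbb' : π b = π b') :
    φ (Ψ.symm b) = φ (Ψ.symm b') := by
  refine eq_of_fderiv_segment_eq_zero (g := φ ∘ Ψ.symm) hconv Ψ.open_target
    (hφ.comp (hΨ.contDiffOn_symm.differentiableOn (by simp)) Ψ.mapsTo_symm) hb' hb fun c hc => ?_
  have ha := Ψ.map_target hc
  rw [fderiv_comp c (hφ.differentiableAt (Ψ.open_source.mem_nhds ha))
    (differentiableAt_of_contDiffOn hΨ.contDiffOn_symm Ψ.open_target hc),
    ContinuousLinearMap.comp_apply]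
  refine h _ ha _ ?_
  rw [hΨ.fderiv_fderiv_symm hc, map_sub, hbb', sub_self]

lemma of_isInvertible [CompleteSpace F] (h : ContDiffOn ℝ ∞ Ψ Ψ.source)
    (hinv : ∀ a ∈ Ψ.source, (fderiv ℝ Ψ a).IsInvertible) : IsSmoothChart Ψ := by
  refine ⟨h, fun b hb => ContDiffAt.contDiffWithinAt ?_⟩
  have ha := Ψ.map_target hb
  obtain ⟨M, hM⟩ := hinv _ ha
  refine Ψ.contDiffAt_symm hb (f₀' := M) ?_ (h.contDiffAt (Ψ.open_source.mem_nhds ha))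
  rw [hM]
  exact (differentiableAt_of_contDiffOn h Ψ.open_source ha).hasFDerivAt

lemma exists_target_eq_ball (hΨ : IsSmoothChart Ψ) {y : F} (hy : y ∈ Ψ.source) :
    ∃ (Ψ' : OpenPartialHomeomorph F G) (δ : ℝ), ⇑Ψ' = Ψ ∧ IsSmoothChart Ψ' ∧ y ∈ Ψ'.source ∧
      Ψ'.source ⊆ Ψ.source ∧ Ψ'.target = Metric.ball (Ψ y) δ := by
  obtain ⟨δ, hδ, hball⟩ := Metric.isOpen_iff.1 Ψ.open_target (Ψ y) (Ψ.map_source hy)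
  let Ψ' := (Ψ.symm.restrOpen (Metric.ball (Ψ y) δ) Metric.isOpen_ball).symm
  have hsource : Ψ'.source ⊆ Ψ.source := fun a ha => ha.1
  have htarget : Ψ'.target = Metric.ball (Ψ y) δ := Set.inter_eq_right.2 hball
  exact ⟨Ψ', δ, rfl, ⟨hΨ.contDiffOn.mono hsource,
    hΨ.contDiffOn_symm.mono (htarget.trans_subset hball)⟩, ⟨hy, Metric.mem_ball_self hδ⟩, hsource,
    htarget⟩

end IsSmoothChart

lemma exists_isSmoothChart [FiniteDimensional ℝ F] [FiniteDimensional ℝ G] {Γ : F → G} {B : Set F}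
    {y : F} (hB : IsOpen B) (hΓ : ContDiffOn ℝ ∞ Γ B)
    (hd : Module.finrank ℝ F = Module.finrank ℝ G) (hy : y ∈ B)
    (hinj : ∀ z, fderiv ℝ Γ y z = 0 → z = 0) :
    ∃ (Ψ : OpenPartialHomeomorph F G) (δ : ℝ), ⇑Ψ = Γ ∧ IsSmoothChart Ψ ∧ y ∈ Ψ.source ∧
      Ψ.source ⊆ B ∧ Ψ.target = Metric.ball (Γ y) δ := by
  let M : F ≃L[ℝ] G := (LinearEquiv.ofInjectiveOfFinrankEq (fderiv ℝ Γ y).toLinearMap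
    ((injective_iff_map_eq_zero _).2 hinj) hd).toContinuousLinearEquiv
  have hΓy : HasFDerivAt Γ (M : F →L[ℝ] G) y :=
    (differentiableAt_of_contDiffOn hΓ hB hy).hasFDerivAt
  have hΓat := hΓ.contDiffAt (hB.mem_nhds hy)
  let W := B ∩ fderiv ℝ Γ ⁻¹' Set.range ((↑) : (F ≃L[ℝ] G) → F →L[ℝ] G)
  have hW : IsOpen W := (contDiffOn_fderiv hΓ hB).continuousOn.isOpen_inter_preimage hB
    ContinuousLinearEquiv.isOpen
  let Ψ₀ := (hΓat.toOpenPartialHomeomorph Γ hΓy (by simp)).restrOpen W hW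
  have hyΨ₀ : y ∈ Ψ₀.source :=
    ⟨hΓat.mem_toOpenPartialHomeomorph_source hΓy (by simp), hy, M, hΓy.fderiv.symm⟩
  have hB₀ : Ψ₀.source ⊆ B := fun a ha => ha.2.1
  have hΨ₀ : IsSmoothChart Ψ₀ := .of_isInvertible (hΓ.mono hB₀) fun a ha => ha.2.2
  obtain ⟨Ψ, δ, hΨΓ, hΨ, hyΨ, hsub, htarget⟩ := hΨ₀.exists_target_eq_ball hyΨ₀
  exact ⟨Ψ, δ, hΨΓ, hΨ, hyΨ, hsub.trans hB₀, htarget⟩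

end Charts

section Potential

variable {E V : Type*} [NormedAddCommGroup E] [NormedSpace ℝ E]
  [NormedAddCommGroup V] [NormedSpace ℝ V] {ε : ℝ} {f : E → V} {U U' : Set E} {y : E}
  {A : V →L[ℝ] V} {u : E → ℝ}

lemma IsConvexOn.mono (hf : IsConvexOn ε f U) (hU' : IsOpen U') (h : U' ⊆ U) :
    IsConvexOn ε f U' :=
  ⟨hf.sign, hU', hf.smooth.mono h, fun y hy => hf.immersion y (h hy),
    fun y hy => hf.transversal y (h hy), fun y hy => hf.metric_pos y (h hy)⟩

/-- The one-form `h(t, ·)`, where `t = splitVec f A`. -/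
noncomputable def splitForm (ε : ℝ) (f : E → V) (A : V →L[ℝ] V) (y : E) : E →L[ℝ] ℝ :=
  metric ε f y (splitVec f A y)

/-- `u` is a smooth potential of the one-form `splitForm ε f A` on `U`. -/
structure IsPotentialOn (ε : ℝ) (f : E → V) (A : V →L[ℝ] V) (u : E → ℝ) (U : Set E) : Prop where
  contDiffOn : ContDiffOn ℝ ∞ u U
  hasFDerivAt : ∀ y ∈ U, HasFDerivAt u (splitForm ε f A y) y

namespace IsConvexOn

variable [FiniteDimensional ℝ E] [FiniteDimensional ℝ V]

lemma contDiffOn_splitForm (hf : IsConvexOn ε f U)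
    (hd : Module.finrank ℝ V = Module.finrank ℝ E + 1) : ContDiffOn ℝ ∞ (splitForm ε f A) U :=
  (hf.contDiffOn_metric hd).clm_apply (hf.contDiffOn_splitVec hd)

lemma fderiv_splitForm (hf : IsConvexOn ε f U) (hd : Module.finrank ℝ V = Module.finrank ℝ E + 1)
    (hy : y ∈ U) (hs : IsSplitAt ε f A y) (w z : E) :
    fderiv ℝ (splitForm ε f A) y w z = splitForm ε f A y (leviCivita (metric ε f) y w z) := by
  rw [← fderiv_eval_const (differentiableAt_of_contDiffOn (hf.contDiffOn_splitForm hd)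
      hf.isOpen hy)]
  unfold splitForm
  rw [hf.fderiv_metric_eval hd hy
      (differentiableAt_of_contDiffOn (hf.contDiffOn_splitVec hd) hf.isOpen hy),
    (hf.fderiv_splitVec_and_splitCoef hd hy hs.commute w).1, neg_add_cancel, map_zero, zero_apply,
    zero_add]

lemma exists_isPotentialOn (hf : IsConvexOn ε f U)
    (hd : Module.finrank ℝ V = Module.finrank ℝ E + 1) (hU : Convex ℝ U)
    (hs : ∀ y ∈ U, IsSplitAt ε f A y) : ∃ u, IsPotentialOn ε f A u U := by
  have hθ := hf.contDiffOn_splitForm hd (A := A)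
  have hclosed : ∀ y ∈ U, ∀ w z, fderiv ℝ (splitForm ε f A) y w z =
      fderiv ℝ (splitForm ε f A) y z w := fun y hy w z => by
    rw [hf.fderiv_splitForm hd hy (hs y hy), hf.fderiv_splitForm hd hy (hs y hy),
      (hf.isRiemannianOn hd).leviCivita_symm hy]
  obtain ⟨u, hu⟩ := hU.exists_forall_hasFDerivAt_of_fderiv_symmetric hf.isOpen
    (hθ.differentiableOn (by simp)) hclosed
  refine ⟨u, (contDiffOn_infty_iff_fderiv_of_isOpen hf.isOpen).2 ⟨fun y hy =>
    (hu y hy).differentiableAt.differentiableWithinAt, hθ.congr fun y hy => (hu y hy).fderiv⟩, hu⟩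

end IsConvexOn

end Potential

section Rescaled

variable {X E V W : Type*} [NormedAddCommGroup E] [NormedSpace ℝ E]
  [NormedAddCommGroup V] [NormedSpace ℝ V] [NormedAddCommGroup W] [NormedSpace ℝ W]
  {f : E → V} {U : Set E} {y : E} {u : E → ℝ} {c : ℝ} {ρ : V →L[ℝ] W}

/-- The function `e^{-cu} ρ f`, through which the corresponding factor of a Calabi product with
`e^{cu} ψ = ρ f` is recovered. -/
noncomputable def rescaled (c : ℝ) (u : X → ℝ) (ρ : V →L[ℝ] W) (f : X → V) (y : X) : W :=
  Real.exp (-(c * u y)) • ρ (f y)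

lemma exp_smul_rescaled {u : X → ℝ} {f : X → V} {y : X} :
    Real.exp (c * u y) • rescaled c u ρ f y = ρ (f y) := by
  rw [rescaled, smul_smul, ← Real.exp_add, add_neg_cancel, Real.exp_zero, one_smul]

lemma contDiffOn_rescaled (hu : ContDiffOn ℝ ∞ u U) (hf : ContDiffOn ℝ ∞ f U) :
    ContDiffOn ℝ ∞ (rescaled c u ρ f) U :=
  (contDiffOn_const.mul hu).neg.exp.smul (ρ.contDiff.comp_contDiffOn hf)

lemma fderiv_rescaled {θ : E →L[ℝ] ℝ} (hu : HasFDerivAt u θ y) (hf : DifferentiableAt ℝ f y)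
    (z : E) : fderiv ℝ (rescaled c u ρ f) y z =
      Real.exp (-(c * u y)) • ρ (fderiv ℝ f y z - (c * θ z) • f y) := by
  have h : HasFDerivAt (rescaled c u ρ f) _ y :=
    (hu.const_mul c).fun_neg.exp.smul (ρ.hasFDerivAt.comp y hf.hasFDerivAt)
  rw [h.fderiv]
  simp only [add_apply, smul_apply, ContinuousLinearMap.smulRight_apply, neg_apply,
    ContinuousLinearMap.comp_apply, map_sub, map_smul, smul_eq_mul]
  module

end Rescaled

section LocalProduct

variable {E V E₁ V₁ E₂ V₂ : Type*} [NormedAddCommGroup E] [NormedSpace ℝ E]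
  [NormedAddCommGroup V] [NormedSpace ℝ V]
  [NormedAddCommGroup E₁] [NormedSpace ℝ E₁] [NormedAddCommGroup V₁] [NormedSpace ℝ V₁]
  [NormedAddCommGroup E₂] [NormedSpace ℝ E₂] [NormedAddCommGroup V₂] [NormedSpace ℝ V₂]
  {ε α β c c₁ c₂ : ℝ} {f : E → V} {U : Set E} {y : E} {A : V →L[ℝ] V} {u : E → ℝ}
  {ι₁ : V₁ →L[ℝ] V} {ρ₁ : V →L[ℝ] V₁} {ι₂ : V₂ →L[ℝ] V} {ρ₂ : V →L[ℝ] V₂}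
  {π₁ : V₁ →L[ℝ] E₁} {π₂ : V₂ →L[ℝ] E₂}

/-- `g (u, p, r) = e^{c₁ u} ψ₁(p) + e^{c₂ u} ψ₂(r)` on `I × U₁ × U₂`, where `ιᵢ` maps the values
of `ψᵢ` into the ambient space. -/
def IsScaledProduct (c₁ c₂ : ℝ) (ι₁ : V₁ →L[ℝ] V) (ι₂ : V₂ →L[ℝ] V) (I : Set ℝ) (U₁ : Set E₁)
    (U₂ : Set E₂) (ψ₁ : E₁ → V₁) (ψ₂ : E₂ → V₂) (g : ℝ × E₁ × E₂ → V) : Prop :=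
  ∀ u ∈ I, ∀ p ∈ U₁, ∀ r ∈ U₂,
    g (u, p, r) = Real.exp (c₁ * u) • ι₁ (ψ₁ p) + Real.exp (c₂ * u) • ι₂ (ψ₂ r)

/-- The coordinates in which `f` becomes a scaled product. -/
noncomputable def productCoord (c₁ c₂ : ℝ) (ρ₁ : V →L[ℝ] V₁) (ρ₂ : V →L[ℝ] V₂) (π₁ : V₁ →L[ℝ] E₁)
    (π₂ : V₂ →L[ℝ] E₂) (u : E → ℝ) (f : E → V) (y : E) : ℝ × E₁ × E₂ :=
  (u y, π₁ (rescaled c₁ u ρ₁ f y), π₂ (rescaled c₂ u ρ₂ f y))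

lemma contDiffOn_productCoord (hu : ContDiffOn ℝ ∞ u U) (hf : ContDiffOn ℝ ∞ f U) :
    ContDiffOn ℝ ∞ (productCoord c₁ c₂ ρ₁ ρ₂ π₁ π₂ u f) U :=
  hu.prodMk ((π₁.contDiff.comp_contDiffOn (contDiffOn_rescaled hu hf)).prodMk
    (π₂.contDiff.comp_contDiffOn (contDiffOn_rescaled hu hf)))

lemma fderiv_productCoord (hf : IsConvexOn ε f U) (hu : IsPotentialOn ε f A u U) (hy : y ∈ U)
    (z : E) :
    fderiv ℝ (productCoord c₁ c₂ ρ₁ ρ₂ π₁ π₂ u f) y z =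
      (splitForm ε f A y z, π₁ (fderiv ℝ (rescaled c₁ u ρ₁ f) y z),
        π₂ (fderiv ℝ (rescaled c₂ u ρ₂ f) y z)) := by
  have hφ₁ := (differentiableAt_of_contDiffOn (contDiffOn_rescaled (c := c₁) (ρ := ρ₁)
    hu.contDiffOn hf.smooth) hf.isOpen hy).hasFDerivAt
  have hφ₂ := (differentiableAt_of_contDiffOn (contDiffOn_rescaled (c := c₂) (ρ := ρ₂)
    hu.contDiffOn hf.smooth) hf.isOpen hy).hasFDerivAt
  exact DFunLike.congr_fun ((hu.hasFDerivAt y hy).prodMk ((π₁.hasFDerivAt.comp y hφ₁).prodMk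
    (π₂.hasFDerivAt.comp y hφ₂))).fderiv z

namespace IsEigenSplitting

lemma eq_zero_of_fderiv_rescaled_eq_zero (hι : IsEigenSplitting α β A ι₁ ρ₁ ι₂ ρ₂)
    (hf : IsConvexOn ε f U) (hu : IsPotentialOn ε f A u U) (hy : y ∈ U) {z : E}
    (hz : splitForm ε f A y z = 0) (hz₁ : fderiv ℝ (rescaled c₁ u ρ₁ f) y z = 0)
    (hz₂ : fderiv ℝ (rescaled c₂ u ρ₂ f) y z = 0) : z = 0 := by
  have hfy := differentiableAt_of_contDiffOn hf.smooth hf.isOpen hy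
  rw [fderiv_rescaled (hu.hasFDerivAt y hy) hfy, hz, mul_zero, zero_smul, sub_zero,
    smul_eq_zero_iff_right (Real.exp_pos _).ne'] at hz₁ hz₂
  refine hf.immersion y hy ?_
  rw [← hι.add_eq (fderiv ℝ f y z), hz₁, hz₂, map_zero, map_zero, map_zero, add_zero]

variable [FiniteDimensional ℝ E] [FiniteDimensional ℝ V]

lemma exists_fderiv_rescaled_eq (hι : IsEigenSplitting α β A ι₁ ρ₁ ι₂ ρ₂) (hβ : β ≠ 0)
    (hαβ : α ≠ β) (hf : IsConvexOn ε f U) (hd : Module.finrank ℝ V = Module.finrank ℝ E + 1)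
    (hu : IsPotentialOn ε f A u U) (hy : y ∈ U) (hs : IsSplitAt ε f A y) (z : E) :
    ∃ z₁, splitForm ε f A y z₁ = 0 ∧
      fderiv ℝ (rescaled (ε / β) u ρ₁ f) y z₁ = fderiv ℝ (rescaled (ε / β) u ρ₁ f) y z ∧
      fderiv ℝ (rescaled c u ρ₂ f) y z₁ = 0 := by
  obtain ⟨z₁, hz₁, hdz₁⟩ := hf.exists_fderiv_eq_ι₁_ρ₁ hd hy hs hι hβ hαβ z
  have hfy := differentiableAt_of_contDiffOn hf.smooth hf.isOpen hy
  have hθ : splitForm ε f A y z₁ = 0 := hz₁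
  refine ⟨z₁, hθ, ?_, ?_⟩
  · rw [fderiv_rescaled (hu.hasFDerivAt y hy) hfy, fderiv_rescaled (hu.hasFDerivAt y hy) hfy, hθ,
      mul_zero, zero_smul, sub_zero, hdz₁, hι.ρ_ι₁]
    rfl
  · rw [fderiv_rescaled (hu.hasFDerivAt y hy) hfy, hθ, mul_zero, zero_smul, sub_zero, hdz₁,
      hι.ρ₂_ι₁, smul_zero]

lemma fderiv_rescaled_eq_zero (hι : IsEigenSplitting α β A ι₁ ρ₁ ι₂ ρ₂)
    (hβ : β ≠ 0) (hαβ : α ≠ β) (hf : IsConvexOn ε f U)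
    (hd : Module.finrank ℝ V = Module.finrank ℝ E + 1)
    (hu : IsPotentialOn ε f A u U) (hy : y ∈ U) (hs : IsSplitAt ε f A y)
    (h : ∀ z, splitForm ε f A y z = 0 → π₁ (fderiv ℝ (rescaled (ε / β) u ρ₁ f) y z) = 0 →
      fderiv ℝ (rescaled c u ρ₂ f) y z = 0 → z = 0) {z : E}
    (hz : π₁ (fderiv ℝ (rescaled (ε / β) u ρ₁ f) y z) = 0) :
    fderiv ℝ (rescaled (ε / β) u ρ₁ f) y z = 0 := by
  obtain ⟨z₁, hθ, hz₁, hz₂⟩ := hι.exists_fderiv_rescaled_eq (c := c) hβ hαβ hf hd hu hy hs z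
  rw [← hz₁, h z₁ hθ (by rw [hz₁, hz]) hz₂, map_zero]

lemma exists_clm_rescaled [FiniteDimensional ℝ V₁] [FiniteDimensional ℝ E₁]
    (hι : IsEigenSplitting α β A ι₁ ρ₁ ι₂ ρ₂) (hβ : β ≠ 0)
    (hαβ : α ≠ β) (hf : IsConvexOn ε f U) (hd : Module.finrank ℝ V = Module.finrank ℝ E + 1)
    (hd₁ : Module.finrank ℝ V₁ = Module.finrank ℝ E₁ + 1)
    (hu : IsPotentialOn ε f A u U) (hy : y ∈ U) (hs : IsSplitAt ε f A y) :
    ∃ c₁ : V₁ →L[ℝ] E₁, ∀ z, c₁ (fderiv ℝ (rescaled (ε / β) u ρ₁ f) y z) = 0 →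
      fderiv ℝ (rescaled (ε / β) u ρ₁ f) y z = 0 := by
  have hinv := hf.isInvertible_frame hd hy
  have hfy := differentiableAt_of_contDiffOn hf.smooth hf.isOpen hy
  obtain ⟨c₁, hc₁⟩ := exists_clm_ker_eq_span (G := E₁) (hι.ρ₁_ne_zero hβ hinv hs) hd₁
  refine ⟨c₁, fun z hz => ?_⟩
  rw [fderiv_rescaled (hu.hasFDerivAt y hy) hfy] at hz ⊢
  rw [map_smul, smul_eq_zero_iff_right (Real.exp_pos _).ne'] at hz
  obtain ⟨a, ha⟩ := hc₁ _ hz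
  obtain ⟨z₁, -, hdz₁⟩ := hf.exists_fderiv_eq_ι₁_ρ₁ hd hy hs hι hβ hαβ z
  have hdz₁' : fderiv ℝ f y z₁ = a • ι₁ (ρ₁ (f y)) := by
    rw [hdz₁, ← map_smul, ← ha]
    rfl
  rcases eq_or_ne a 0 with rfl | ha₀
  · rw [ha, zero_smul, smul_zero]
  · refine absurd ?_ (hι.fderiv_ne_ι₁_ρ₁ hβ hinv hs (a⁻¹ • z₁))
    rw [map_smul, hdz₁', inv_smul_smul₀ ha₀]

lemma exists_isSmoothChart_productCoord [FiniteDimensional ℝ V₁] [FiniteDimensional ℝ E₁]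
    [FiniteDimensional ℝ V₂] [FiniteDimensional ℝ E₂]
    (hι : IsEigenSplitting α β A ι₁ ρ₁ ι₂ ρ₂) (hα : α ≠ 0)
    (hβ : β ≠ 0) (hαβ : α ≠ β) (hf : IsConvexOn ε f U)
    (hd : Module.finrank ℝ V = Module.finrank ℝ E + 1)
    (hd₁ : Module.finrank ℝ V₁ = Module.finrank ℝ E₁ + 1)
    (hd₂ : Module.finrank ℝ V₂ = Module.finrank ℝ E₂ + 1)
    (hu : IsPotentialOn ε f A u U) (hy : y ∈ U) (hs : IsSplitAt ε f A y) :
    ∃ (π₁ : V₁ →L[ℝ] E₁) (π₂ : V₂ →L[ℝ] E₂) (Ψ : OpenPartialHomeomorph E (ℝ × E₁ × E₂)) (δ : ℝ),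
      ⇑Ψ = productCoord (ε / β) (ε / α) ρ₁ ρ₂ π₁ π₂ u f ∧ IsSmoothChart Ψ ∧ y ∈ Ψ.source ∧
        Ψ.source ⊆ U ∧ Ψ.target = Metric.ball (Ψ y) δ := by
  obtain ⟨π₁, hπ₁⟩ := hι.exists_clm_rescaled hβ hαβ hf hd hd₁ hu hy hs
  obtain ⟨π₂, hπ₂⟩ := hι.symm.exists_clm_rescaled hα hαβ.symm hf hd hd₂ hu hy hs
  have hdim : Module.finrank ℝ E = Module.finrank ℝ (ℝ × E₁ × E₂) := by
    have hV := hι.equiv.toLinearEquiv.finrank_eq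
    rw [Module.finrank_prod] at hV
    rw [Module.finrank_prod, Module.finrank_prod, Module.finrank_self]
    omega
  obtain ⟨Ψ, δ, hΨ⟩ := exists_isSmoothChart (Γ := productCoord (ε / β) (ε / α) ρ₁ ρ₂ π₁ π₂ u f)
    hf.isOpen (contDiffOn_productCoord hu.contDiffOn hf.smooth) hdim hy fun z hz => by
      simp only [fderiv_productCoord hf hu hy, Prod.mk_eq_zero] at hz
      exact hι.eq_zero_of_fderiv_rescaled_eq_zero hf hu hy hz.1 (hπ₁ z hz.2.1) (hπ₂ z hz.2.2)
  exact ⟨π₁, π₂, Ψ, δ, hΨ.1, hΨ.2.1, hΨ.2.2.1, hΨ.2.2.2.1, hΨ.1 ▸ hΨ.2.2.2.2⟩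

lemma rescaled_symm_eq {G : Type*} [NormedAddCommGroup G] [NormedSpace ℝ G]
    (hι : IsEigenSplitting α β A ι₁ ρ₁ ι₂ ρ₂) (hβ : β ≠ 0) (hαβ : α ≠ β) (hf : IsConvexOn ε f U)
    (hd : Module.finrank ℝ V = Module.finrank ℝ E + 1) (hu : IsPotentialOn ε f A u U)
    (hs : ∀ y ∈ U, IsSplitAt ε f A y) {Ψ : OpenPartialHomeomorph E G} (hΨ : IsSmoothChart Ψ)
    (hsub : Ψ.source ⊆ U) (hconv : Convex ℝ Ψ.target) {π : G →L[ℝ] E₁}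
    (hπ : ∀ a ∈ Ψ.source, ∀ z,
      π (fderiv ℝ Ψ a z) = π₁ (fderiv ℝ (rescaled (ε / β) u ρ₁ f) a z))
    (hinj : ∀ a ∈ Ψ.source, ∀ z, splitForm ε f A a z = 0 →
      π₁ (fderiv ℝ (rescaled (ε / β) u ρ₁ f) a z) = 0 →
      fderiv ℝ (rescaled c u ρ₂ f) a z = 0 → z = 0)
    {b b' : G} (hb : b ∈ Ψ.target) (hb' : b' ∈ Ψ.target) (hbb' : π b = π b') :
    rescaled (ε / β) u ρ₁ f (Ψ.symm b) = rescaled (ε / β) u ρ₁ f (Ψ.symm b') := by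
  refine hΨ.apply_symm_eq_of_fderiv_eq_zero (φ := rescaled (ε / β) u ρ₁ f) hconv
    (((contDiffOn_rescaled hu.contDiffOn hf.smooth).differentiableOn (by simp)).mono hsub)
    (fun a ha z hz => ?_) hb hb' hbb'
  rw [hπ a ha] at hz
  exact hι.fderiv_rescaled_eq_zero hβ hαβ hf hd hu (hsub ha) (hs a (hsub ha)) (hinj a ha) hz

lemma isScaledProduct_comp_symm (hι : IsEigenSplitting α β A ι₁ ρ₁ ι₂ ρ₂) (hα : α ≠ 0)
    (hβ : β ≠ 0) (hαβ : α ≠ β) (hf : IsConvexOn ε f U)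
    (hd : Module.finrank ℝ V = Module.finrank ℝ E + 1) (hu : IsPotentialOn ε f A u U)
    (hs : ∀ y ∈ U, IsSplitAt ε f A y) {Ψ : OpenPartialHomeomorph E (ℝ × E₁ × E₂)}
    (hΨ : IsSmoothChart Ψ) (hcoe : ⇑Ψ = productCoord (ε / β) (ε / α) ρ₁ ρ₂ π₁ π₂ u f)
    (hsub : Ψ.source ⊆ U) {I : Set ℝ} {U₁ : Set E₁} {U₂ : Set E₂}
    (htgt : Ψ.target = I ×ˢ U₁ ×ˢ U₂) (hconv : Convex ℝ Ψ.target) {b₀ : ℝ × E₁ × E₂}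
    (hb₀ : b₀ ∈ Ψ.target) :
    IsScaledProduct (ε / β) (ε / α) ι₁ ι₂ I U₁ U₂
      (fun p => rescaled (ε / β) u ρ₁ f (Ψ.symm (b₀.1, p, b₀.2.2)))
      (fun r => rescaled (ε / α) u ρ₂ f (Ψ.symm (b₀.1, b₀.2.1, r))) (f ∘ Ψ.symm) := by
  have hdΨ : ∀ a ∈ Ψ.source, ∀ z, fderiv ℝ Ψ a z = (splitForm ε f A a z,
      π₁ (fderiv ℝ (rescaled (ε / β) u ρ₁ f) a z), π₂ (fderiv ℝ (rescaled (ε / α) u ρ₂ f) a z)) :=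
    fun a ha z => by rw [hcoe, fderiv_productCoord hf hu (hsub ha)]
  have hinj : ∀ a ∈ Ψ.source, ∀ z, splitForm ε f A a z = 0 →
      π₁ (fderiv ℝ (rescaled (ε / β) u ρ₁ f) a z) = 0 →
      π₂ (fderiv ℝ (rescaled (ε / α) u ρ₂ f) a z) = 0 → z = 0 := fun a ha z h₀ h₁ h₂ =>
    hΨ.fderiv_injective ha (by rw [hdΨ a ha, h₀, h₁, h₂, map_zero]; rfl)
  intro x hx p hp r hr
  rw [htgt] at hb₀
  have hmem : (x, p, r) ∈ Ψ.target := htgt ▸ ⟨hx, hp, hr⟩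
  have hφ₁ : rescaled (ε / β) u ρ₁ f (Ψ.symm (b₀.1, p, b₀.2.2)) =
      rescaled (ε / β) u ρ₁ f (Ψ.symm (x, p, r)) :=
    hι.rescaled_symm_eq hβ hαβ hf hd hu hs hΨ hsub hconv (c := ε / α)
      (π := .fst ℝ E₁ E₂ ∘L .snd ℝ ℝ (E₁ × E₂)) (fun a ha z => by rw [hdΨ a ha]; rfl)
      (fun a ha z h₀ h₁ h₂ => hinj a ha z h₀ h₁ (by rw [h₂, map_zero]))
      (htgt ▸ ⟨hb₀.1, hp, hb₀.2.2⟩) hmem rfl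
  have hφ₂ : rescaled (ε / α) u ρ₂ f (Ψ.symm (b₀.1, b₀.2.1, r)) =
      rescaled (ε / α) u ρ₂ f (Ψ.symm (x, p, r)) :=
    hι.symm.rescaled_symm_eq hα hαβ.symm hf hd hu hs hΨ hsub hconv (c := ε / β)
      (π := .snd ℝ E₁ E₂ ∘L .snd ℝ ℝ (E₁ × E₂)) (fun a ha z => by rw [hdΨ a ha]; rfl)
      (fun a ha z h₀ h₂ h₁ => hinj a ha z h₀ (by rw [h₁, map_zero]) h₂)
      (htgt ▸ ⟨hb₀.1, hb₀.2.1, hr⟩) hmem rfl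
  have hux : x = u (Ψ.symm (x, p, r)) :=
    congrArg Prod.fst ((Ψ.right_inv hmem).symm.trans (congrFun hcoe _))
  simp only [hφ₁, hφ₂]
  rw [← map_smul, ← map_smul, congrArg (ε / β * ·) hux, congrArg (ε / α * ·) hux,
    exp_smul_rescaled, exp_smul_rescaled, hι.add_eq, Function.comp_apply]

lemma exists_local_product [FiniteDimensional ℝ V₁] [FiniteDimensional ℝ E₁]
    [FiniteDimensional ℝ V₂] [FiniteDimensional ℝ E₂]
    (hι : IsEigenSplitting α β A ι₁ ρ₁ ι₂ ρ₂) (hα : α ≠ 0) (hβ : β ≠ 0) (hαβ : α ≠ β)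
    (hf : IsConvexOn ε f U) (hd : Module.finrank ℝ V = Module.finrank ℝ E + 1)
    (hd₁ : Module.finrank ℝ V₁ = Module.finrank ℝ E₁ + 1)
    (hd₂ : Module.finrank ℝ V₂ = Module.finrank ℝ E₂ + 1) (hs : ∀ y ∈ U, IsSplitAt ε f A y)
    (hy : y ∈ U) :
    ∃ (Ψ : OpenPartialHomeomorph E (ℝ × E₁ × E₂)) (I : Set ℝ) (U₁ : Set E₁) (U₂ : Set E₂)
      (ψ₁ : E₁ → V₁) (ψ₂ : E₂ → V₂), IsSmoothChart Ψ ∧ y ∈ Ψ.source ∧ Ψ.source ⊆ U ∧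
        Ψ.target = I ×ˢ U₁ ×ˢ U₂ ∧
        IsScaledProduct (ε / β) (ε / α) ι₁ ι₂ I U₁ U₂ ψ₁ ψ₂ (f ∘ Ψ.symm) := by
  obtain ⟨r, hr, hrU⟩ := Metric.isOpen_iff.1 hf.isOpen y hy
  have hf' := hf.mono Metric.isOpen_ball hrU
  have hs' := fun y hy => hs y (hrU hy)
  obtain ⟨u, hu⟩ := hf'.exists_isPotentialOn hd (convex_ball y r) hs'
  obtain ⟨π₁, π₂, Ψ, δ, hcoe, hΨ, hyΨ, hsub, hball⟩ := hι.exists_isSmoothChart_productCoord hα hβ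
    hαβ hf' hd hd₁ hd₂ hu (Metric.mem_ball_self hr) (hs y hy)
  have htgt : Ψ.target = Metric.ball (Ψ y).1 δ ×ˢ Metric.ball (Ψ y).2.1 δ ×ˢ
      Metric.ball (Ψ y).2.2 δ := by rw [hball, ball_prod_same, ball_prod_same]
  exact ⟨Ψ, _, _, _, _, _, hΨ, hyΨ, hsub.trans hrU, htgt,
    hι.isScaledProduct_comp_symm hα hβ hαβ hf' hd hu hs' hΨ hcoe hsub htgt
      (hball ▸ convex_ball _ _) (Ψ.map_source hyΨ)⟩

end IsEigenSplitting

end LocalProduct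

section ProductFactors

variable {E V E₁ V₁ E₂ V₂ : Type*} [NormedAddCommGroup E] [NormedSpace ℝ E]
  [NormedAddCommGroup V] [NormedSpace ℝ V]
  [NormedAddCommGroup E₁] [NormedSpace ℝ E₁] [NormedAddCommGroup V₁] [NormedSpace ℝ V₁]
  [NormedAddCommGroup E₂] [NormedSpace ℝ E₂] [NormedAddCommGroup V₂] [NormedSpace ℝ V₂]
  {ε α β c₁ c₂ : ℝ} {f : E → V} {U : Set E} {y : E} {A : V →L[ℝ] V}
  {ι₁ : V₁ →L[ℝ] V} {ρ₁ : V →L[ℝ] V₁} {ι₂ : V₂ →L[ℝ] V} {ρ₂ : V →L[ℝ] V₂}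
  {L : E ≃L[ℝ] ℝ × E₁ × E₂} {I : Set ℝ} {U₁ : Set E₁} {U₂ : Set E₂} {ψ₁ : E₁ → V₁} {ψ₂ : E₂ → V₂}

lemma fderiv_eq_of_scaling (hf : DifferentiableAt ℝ f y) {w : E} {g : ℝ}
    (h : ∀ᶠ θ in nhds (0 : ℝ), ρ₁ (f (y + θ • w)) = Real.exp (g * θ) • ρ₁ (f y)) :
    ρ₁ (fderiv ℝ f y w) = g • ρ₁ (f y) := by
  have hline : HasDerivAt (fun θ : ℝ => y + θ • w) w 0 := by
    simpa using ((hasDerivAt_id (0 : ℝ)).smul_const w).const_add y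
  have hfy : HasFDerivAt f (fderiv ℝ f y) (y + (0 : ℝ) • w) := by simpa using hf.hasFDerivAt
  have hexp : HasDerivAt (fun θ : ℝ => Real.exp (g * θ) • ρ₁ (f y)) (g • ρ₁ (f y)) 0 := by
    simpa using (((hasDerivAt_id (0 : ℝ)).const_mul g).exp).smul_const (ρ₁ (f y))
  exact (ρ₁.hasFDerivAt.comp_hasDerivAt (0 : ℝ) (hfy.comp_hasDerivAt (0 : ℝ) hline)).unique
    (hexp.congr_of_eventuallyEq h)

/-- In the linear coordinates `L`, the set `U` is the product `I × U₁ × U₂`, and on it `f` is a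
scaled product. -/
structure IsLinearProduct (c₁ c₂ : ℝ) (ι₁ : V₁ →L[ℝ] V) (ι₂ : V₂ →L[ℝ] V)
    (L : E ≃L[ℝ] ℝ × E₁ × E₂) (I : Set ℝ) (U₁ : Set E₁) (U₂ : Set E₂) (ψ₁ : E₁ → V₁)
    (ψ₂ : E₂ → V₂) (f : E → V) (U : Set E) : Prop where
  eq_preimage : U = L ⁻¹' (I ×ˢ U₁ ×ˢ U₂)
  isScaledProduct : IsScaledProduct c₁ c₂ ι₁ ι₂ I U₁ U₂ ψ₁ ψ₂ (f ∘ L.symm)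

/-- The interchange of the two factors. -/
def swapFactors (L : E ≃L[ℝ] ℝ × E₁ × E₂) : E ≃L[ℝ] ℝ × E₂ × E₁ :=
  L.trans ((ContinuousLinearEquiv.refl ℝ ℝ).prodCongr (ContinuousLinearEquiv.prodComm ℝ E₁ E₂))

/-- The inclusion of the first factor in the linear coordinates `L`. -/
def inclFst (L : E ≃L[ℝ] ℝ × E₁ × E₂) : E₁ →L[ℝ] E :=
  (L.symm : ℝ × E₁ × E₂ →L[ℝ] E) ∘L .inr ℝ ℝ (E₁ × E₂) ∘L .inl ℝ E₁ E₂

/-- The projection to the first factor in the linear coordinates `L`. -/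
def projFst (L : E ≃L[ℝ] ℝ × E₁ × E₂) : E →L[ℝ] E₁ :=
  .fst ℝ E₁ E₂ ∘L .snd ℝ ℝ (E₁ × E₂) ∘L (L : E →L[ℝ] ℝ × E₁ × E₂)

lemma apply_inclFst (a : E₁) : L (inclFst L a) = (0, a, 0) :=
  L.apply_symm_apply _

namespace IsLinearProduct

lemma symm (h : IsLinearProduct c₁ c₂ ι₁ ι₂ L I U₁ U₂ ψ₁ ψ₂ f U) :
    IsLinearProduct c₂ c₁ ι₂ ι₁ (swapFactors L) I U₂ U₁ ψ₂ ψ₁ f U := by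
  refine ⟨?_, fun u hu r hr p hp => ?_⟩
  · rw [h.eq_preimage]
    ext y
    exact and_congr_right fun _ => and_comm
  · rw [add_comm]
    exact h.isScaledProduct u hu p hp r hr

lemma ρ₁_apply (h : IsLinearProduct c₁ c₂ ι₁ ι₂ L I U₁ U₂ ψ₁ ψ₂ f U)
    (hι : IsEigenSplitting α β A ι₁ ρ₁ ι₂ ρ₂) (hy : y ∈ U) :
    ρ₁ (f y) = Real.exp (c₁ * (L y).1) • ψ₁ (L y).2.1 := by
  rw [h.eq_preimage] at hy
  have hfy := h.isScaledProduct _ hy.1 _ hy.2.1 _ hy.2.2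
  rw [Function.comp_apply, L.symm_apply_apply] at hfy
  rw [hfy, map_add, map_smul, map_smul, hι.ρ_ι₁, hι.ρ₁_ι₂, smul_zero, add_zero]

lemma ρ₁_fderiv (h : IsLinearProduct c₁ c₂ ι₁ ι₂ L I U₁ U₂ ψ₁ ψ₂ f U)
    (hι : IsEigenSplitting α β A ι₁ ρ₁ ι₂ ρ₂) (hf : IsConvexOn ε f U) (hy : y ∈ U) {z : E}
    (hz : (L z).2.1 = 0) : ρ₁ (fderiv ℝ f y z) = (c₁ * (L z).1) • ρ₁ (f y) := by
  refine fderiv_eq_of_scaling (differentiableAt_of_contDiffOn hf.smooth hf.isOpen hy) ?_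
  have hline : ContinuousAt (fun θ : ℝ => y + θ • z) 0 := by fun_prop
  filter_upwards [hline.eventually (hf.isOpen.mem_nhds (by simpa using hy))] with θ hθ
  rw [h.ρ₁_apply hι hθ, h.ρ₁_apply hι hy, smul_smul, ← Real.exp_add]
  simp only [map_add, map_smul, Prod.fst_add, Prod.snd_add, Prod.smul_fst, Prod.smul_snd, hz,
    smul_zero, add_zero, smul_eq_mul]
  ring_nf

lemma ι₁_ρ₁_fderiv_inclFst (h : IsLinearProduct c₁ c₂ ι₁ ι₂ L I U₁ U₂ ψ₁ ψ₂ f U)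
    (hι : IsEigenSplitting α β A ι₁ ρ₁ ι₂ ρ₂) (hf : IsConvexOn ε f U) (hy : y ∈ U) (a : E₁) :
    ι₁ (ρ₁ (fderiv ℝ f y (inclFst L a))) = fderiv ℝ f y (inclFst L a) := by
  have hL : swapFactors L (inclFst L a) = (0, 0, a) :=
    congrArg (fun b : ℝ × E₁ × E₂ => (b.1, b.2.2, b.2.1)) (apply_inclFst a)
  have hρ₂ := h.symm.ρ₁_fderiv hι.symm hf hy (z := inclFst L a) (by rw [hL])
  have hadd := hι.add_eq (fderiv ℝ f y (inclFst L a))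
  rwa [hρ₂, hL, mul_zero, zero_smul, map_zero, add_zero] at hadd

lemma ι₁_ρ₁_add_smul (h : IsLinearProduct c₁ c₂ ι₁ ι₂ L I U₁ U₂ ψ₁ ψ₂ f U)
    (hι : IsEigenSplitting α β A ι₁ ρ₁ ι₂ ρ₂) (hf : IsConvexOn ε f U) (hy : y ∈ U) (z : E)
    (s : ℝ) : ι₁ (ρ₁ (fderiv ℝ f y z + s • f y)) =
      fderiv ℝ f y (inclFst L (projFst L z)) + (c₁ * (L z).1 + s) • ι₁ (ρ₁ (f y)) := by
  have hL : L (z - inclFst L (projFst L z)) = ((L z).1, 0, (L z).2.2) := by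
    rw [map_sub, apply_inclFst]
    exact Prod.ext (sub_zero _) (Prod.ext (sub_self _) (sub_zero _))
  have hρ₁ := h.ρ₁_fderiv hι hf hy (z := z - inclFst L (projFst L z)) (by rw [hL])
  rw [hL, map_sub, map_sub, sub_eq_iff_eq_add] at hρ₁
  rw [map_add, hρ₁, map_smul, map_add, map_add, h.ι₁_ρ₁_fderiv_inclFst hι hf hy, map_smul,
    map_smul]
  module

lemma isSlice (h : IsLinearProduct c₁ c₂ ι₁ ι₂ L I U₁ U₂ ψ₁ ψ₂ f U)
    (hι : IsEigenSplitting α β A ι₁ ρ₁ ι₂ ρ₂) (hU : IsOpen U) (hy : y ∈ U) :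
    IsSlice (Real.exp (-(c₁ * (L y).1))) (y - inclFst L (projFst L y)) (inclFst L) ρ₁ f U
      ψ₁ U₁ := by
  have hL : ∀ v, L (y - inclFst L (projFst L y) + inclFst L v) = ((L y).1, v, (L y).2.2) :=
    fun v => by
      rw [map_add, map_sub, apply_inclFst, apply_inclFst]
      refine Prod.ext ?_ (Prod.ext ?_ ?_)
      · exact (add_zero _).trans (sub_zero _)
      · exact (congrArg (· + v) (sub_self _)).trans (zero_add v)
      · exact (add_zero _).trans (sub_zero _)
  have hmem : ∀ v, y - inclFst L (projFst L y) + inclFst L v ∈ U ↔ v ∈ U₁ := fun v => by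
    rw [h.eq_preimage] at hy ⊢
    rw [Set.mem_preimage, hL]
    exact ⟨fun hv => hv.2.1, fun hv => ⟨hy.1, hv, hy.2.2⟩⟩
  refine ⟨?_, fun v => (hmem v).2, fun v hv => ?_, (Real.exp_pos _).ne'⟩
  · rw [← Set.ext hmem]
    exact hU.preimage (continuous_const.add (inclFst L).continuous)
  · rw [h.ρ₁_apply hι ((hmem v).2 hv), hL, smul_smul, ← Real.exp_add, neg_add_cancel,
      Real.exp_zero, one_smul]

variable [FiniteDimensional ℝ E] [FiniteDimensional ℝ V]

lemma isFactor (h : IsLinearProduct c₁ c₂ ι₁ ι₂ L I U₁ U₂ ψ₁ ψ₂ f U) (hc₂ : c₂ ≠ 0)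
    (hι : IsEigenSplitting α β A ι₁ ρ₁ ι₂ ρ₂) (hα : α ≠ 0) (hβ : β ≠ 0) (hαβ : α ≠ β)
    (hf : IsConvexOn ε f U) (hd : Module.finrank ℝ V = Module.finrank ℝ E + 1)
    (hs : ∀ y ∈ U, IsSplitAt ε f A y) :
    IsFactor ε (ε * c₁ / c₂ - ε) f U ι₁ ρ₁ (inclFst L) (projFst L) where
  ρ_ι := hι.ρ_ι₁
  π_j a := congrArg (fun b : ℝ × E₁ × E₂ => b.2.1) (apply_inclFst a)
  commute y hy z x := hι.ι₁_ρ₁_comm hαβ ((hs y hy).commute z) x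
  tangent y hy := h.ι₁_ρ₁_fderiv_inclFst hι hf hy
  transversal y hy := hι.fderiv_ne_ι₁_ρ₁ hβ (hf.isInvertible_frame hd hy) (hs y hy)
  decomp y hy z c hX := by
    have hX₂ : ι₂ (ρ₂ (fderiv ℝ f y z + (-ε * c) • f y)) = 0 := by
      have hadd := hι.add_eq (fderiv ℝ f y z + (-ε * c) • f y)
      rwa [hX, add_eq_left] at hadd
    have hσ : c₂ * (L z).1 + -ε * c = 0 := by
      rw [h.symm.ι₁_ρ₁_add_smul hι.symm hf hy] at hX₂
      by_contra hne
      refine hι.symm.fderiv_ne_ι₁_ρ₁ hα (hf.isInvertible_frame hd hy) (hs y hy)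
        (-(c₂ * (L z).1 + -ε * c)⁻¹ • inclFst (swapFactors L) (projFst (swapFactors L) z)) ?_
      rw [map_smul, eq_neg_of_add_eq_zero_left hX₂, neg_smul_neg]
      exact inv_smul_smul₀ hne _
    rw [← hX, h.ι₁_ρ₁_add_smul hι hf hy, show (L z).1 = ε * c / c₂ by field_simp; linarith]
    congr 2
    ring

lemma isConvexOn_and_isParallelOn [FiniteDimensional ℝ E₁] [FiniteDimensional ℝ V₁]
    (h : IsLinearProduct (ε / β) (ε / α) ι₁ ι₂ L I U₁ U₂ ψ₁ ψ₂ f U)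
    (hι : IsEigenSplitting α β A ι₁ ρ₁ ι₂ ρ₂) (hα : α ≠ 0) (hβ : β ≠ 0) (hαβ : α ≠ β)
    (hf : IsConvexOn ε f U) (hp : IsParallelOn ε f U)
    (hd : Module.finrank ℝ V = Module.finrank ℝ E + 1)
    (hd₁ : Module.finrank ℝ V₁ = Module.finrank ℝ E₁ + 1)
    (hs : ∀ y ∈ U, IsSplitAt ε f A y) (hU : U.Nonempty) {ε₁ : ℝ} (hε₁ : ε₁ = 1 ∨ ε₁ = -1)
    (hκ : 0 < ε₁ * ε * (β - α) / β) : IsConvexOn ε₁ ψ₁ U₁ ∧ IsParallelOn ε₁ ψ₁ U₁ := by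
  obtain ⟨y, hy⟩ := hU
  have hε : ε ≠ 0 := left_ne_zero_of_mul_eq_one hf.sign_mul_self
  have hF := h.isFactor (div_ne_zero hε hα) hι hα hβ hαβ hf hd hs
  have hψ := h.isSlice hι hf.isOpen hy
  have hκ₁ : 0 < -ε₁ * (ε * (ε / β) / (ε / α) - ε) := by
    convert hκ using 1
    field_simp
    ring
  exact ⟨hψ.isConvexOn hf hd hF hd₁ hε₁ hκ₁, hψ.isParallelOn hf hp hd hF hd₁ hε₁ hκ₁⟩

end IsLinearProduct

end ProductFactors

/-! ### The case `k₀ = 1` -/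

section CaseC

variable {E : Type*} [NormedAddCommGroup E] [NormedSpace ℝ E]
  {ε : ℝ} {h : E →L[ℝ] E →L[ℝ] ℝ} {K : E →L[ℝ] E →L[ℝ] E} {n m : ℕ} {e : Fin n → E}

namespace IsCubicModel

lemma cubic_nonpos (hM : IsCubicModel ε h K) (hK : ∀ u, h u u = 1 → h (K u u) u ≤ 0) (u : E) :
    h (K u u) u ≤ 0 := by
  rcases eq_or_ne u 0 with rfl | hu
  · simp
  have hpos : 0 < √(h u u) := Real.sqrt_pos.2 (hM.pos u hu)
  have hsq : √(h u u) * √(h u u) = h u u := Real.mul_self_sqrt (hM.pos u hu).le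
  obtain ⟨s, hs⟩ : ∃ s, s = √(h u u) := ⟨_, rfl⟩
  rw [← hs] at hpos hsq
  have hunit := hK (s⁻¹ • u) (by
    simp only [map_smul, smul_apply, smul_eq_mul, ← hsq]
    field_simp)
  simp only [map_smul, smul_apply, smul_eq_mul, ← mul_assoc] at hunit
  exact nonpos_of_mul_nonpos_right hunit (by positivity)

lemma apply_eq_zero_of_cubic_eq_zero (hM : IsCubicModel ε h K) (hK : ∀ u, h (K u u) u = 0)
    (a b : E) : K a b = 0 := by
  have hpolar (u v : E) : h (K v v) u = 0 := by
    have hadd := hK (u + v)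
    have hsub := hK (u - v)
    have huvv : h (K u v) v = h (K v v) u := by rw [hM.apply_symm u v, hM.inner_apply_right_comm]
    simp only [map_add, map_sub, add_apply, sub_apply, hM.apply_symm v u] at hadd hsub
    linarith [hK u, hK v, hM.inner_apply_right_comm u u v]
  have hdiag (v : E) : K v v = 0 := hM.eq_zero (hpolar _ v)
  have hab := hdiag (a + b)
  simp only [map_add, add_apply, hdiag, hM.apply_symm b a, zero_add, add_zero] at hab
  rwa [← two_smul ℝ, smul_eq_zero_iff_right two_ne_zero] at hab

lemma apply_eq_zero_of_sup_nullV (hM : IsCubicModel ε h K) {D : Submodule ℝ E}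
    {l : ℝ} {e₁ v u : E} (hv : h v v = 1)
    (hsum : Submodule.span ℝ {v} ⊔ nullV h K l e₁ D v = D) (hu : u ∈ D) (hvu : h v u = 0) :
    K v u = 0 := by
  rw [← hsum] at hu
  obtain ⟨x, hx, b, ⟨⟨-, hvb⟩, hPb⟩, rfl⟩ := Submodule.mem_sup.1 hu
  obtain ⟨a, rfl⟩ := Submodule.mem_span_singleton.1 hx
  replace hvb : h v b = 0 := hvb
  replace hPb : K v (K v b - (l / 2) • h v b • e₁) = 0 := hPb
  rw [hvb, zero_smul, smul_zero, sub_zero] at hPb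
  rw [map_add, hvb, add_zero, map_smul, hv, smul_eq_mul, mul_one] at hvu
  rw [hvu, zero_smul, zero_add]
  exact hM.eq_zero (by rw [hM.adjoint, hPb, map_zero])

end IsCubicModel

lemma eq_sum_of_orthonormal [FiniteDimensional ℝ E]
    (ho : ∀ i j, h (e i) (e j) = if i = j then 1 else 0)
    (hn : Module.finrank ℝ E = n) (z : E) : z = ∑ i, h (e i) z • e i := by
  have hli : LinearIndependent ℝ e := by
    refine Fintype.linearIndependent_iff.2 fun g hg i => ?_
    simpa [ho] using congrArg (h (e i)) hg
  have hspan := hli.span_eq_top_of_card_eq_finrank' (by simpa using hn.symm)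
  obtain ⟨c, rfl⟩ := (Submodule.mem_span_range_iff_exists_fun ℝ).1
    (hspan ▸ Submodule.mem_top : z ∈ Submodule.span ℝ (Set.range e))
  exact Finset.sum_congr rfl fun i _ => by simp [ho]

lemma mem_D2 {i : Fin n} (h₁ : 1 ≤ (i : ℕ)) (h₂ : (i : ℕ) < m) : e i ∈ D2 m e :=
  Submodule.subset_span ⟨i, ⟨h₁, h₂⟩, rfl⟩

lemma inner_eq_zero_of_mem_D2 {v z : E} (hv : v ∈ D2 m e)
    (hz : ∀ i : Fin n, 1 ≤ (i : ℕ) → (i : ℕ) < m → h (e i) z = 0) : h v z = 0 := by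
  induction hv using Submodule.span_induction with
  | mem x hx => obtain ⟨i, hi, rfl⟩ := hx; exact hz i hi.1 hi.2
  | zero => simp
  | add x y _ _ hx hy => rw [map_add, add_apply, hx, hy, add_zero]
  | smul a x _ hx => rw [map_smul, smul_apply, hx, smul_zero]

lemma exists_orthogonal_projection_D2 (ho : ∀ i j, h (e i) (e j) = if i = j then 1 else 0)
    (z : E) : ∃ d ∈ D2 m e, ∀ v ∈ D2 m e, h v (z - d) = 0 := by
  refine ⟨∑ i ∈ Finset.univ.filter fun i : Fin n => 1 ≤ (i : ℕ) ∧ (i : ℕ) < m, h (e i) z • e i,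
    Submodule.sum_mem _ fun i hi => Submodule.smul_mem _ _
      (mem_D2 (Finset.mem_filter.1 hi).2.1 (Finset.mem_filter.1 hi).2.2),
    fun v hv => inner_eq_zero_of_mem_D2 hv fun i h₁ h₂ => ?_⟩
  simp [ho, h₁, h₂]

namespace IsCaseC

variable [NeZero n] {lam : Fin n → ℝ}

lemma apply_D2 (hc : IsCaseC ε h K m e lam) {v : E} (hv : v ∈ D2 m e) :
    K (e 0) v = (lam 0 / 2) • v := by
  induction hv using Submodule.span_induction with
  | mem x hx =>
    obtain ⟨i, hi, rfl⟩ := hx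
    rw [hc.typical.eigen, hc.eig_D2 i hi.1 hi.2]
  | zero => simp
  | add x y _ _ hx hy => rw [map_add, hx, hy, smul_add]
  | smul a x _ hx => rw [map_smul, hx, smul_comm]

lemma lam_ne_zero (hc : IsCaseC ε h K m e lam) (hM : IsCubicModel ε h K) (hK : K ≠ 0) :
    lam 0 ≠ 0 := by
  intro hl
  have hnonpos := hM.cubic_nonpos fun u hu => (hc.typical.isMax u hu).trans_eq (by
    rw [hc.typical.eigen, hl, zero_smul, map_zero, zero_apply])
  refine hK (ContinuousLinearMap.ext fun a => ContinuousLinearMap.ext fun b =>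
    hM.apply_eq_zero_of_cubic_eq_zero (fun u => (hnonpos u).antisymm ?_) a b)
  simpa using hnonpos (-u)

variable [FiniteDimensional ℝ E]

lemma apply_of_orthogonal (hc : IsCaseC ε h K m e lam) (hn : Module.finrank ℝ E = n)
    {y : E} (h₀ : h (e 0) y = 0) (hD : ∀ v ∈ D2 m e, h v y = 0) :
    K (e 0) y = ((lam 0 - √(lam 0 ^ 2 - 4 * ε)) / 2) • y := by
  rw [eq_sum_of_orthonormal hc.typical.orthonormal hn y, map_sum, Finset.smul_sum]
  refine Finset.sum_congr rfl fun i _ => ?_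
  rw [map_smul, hc.typical.eigen]
  by_cases h₁ : 1 ≤ (i : ℕ)
  · by_cases h₂ : (i : ℕ) < m
    · rw [hD _ (mem_D2 h₁ h₂), zero_smul, zero_smul, smul_zero]
    · rw [hc.eig_D3 i (not_lt.1 h₂), smul_comm]
  · rw [show i = 0 from Fin.ext (by rw [Fin.val_zero]; omega), h₀, zero_smul, zero_smul,
      smul_zero]

lemma isTypicalSplitting (hc : IsCaseC ε h K m e lam) (hM : IsCubicModel ε h K)
    (hn : Module.finrank ℝ E = n) (hK : K ≠ 0) :
    IsTypicalSplitting ε h K (e 0) (D2 m e) (lam 0) ((lam 0 - √(lam 0 ^ 2 - 4 * ε)) / 2) where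
  unit := by rw [hc.typical.orthonormal, if_pos rfl]
  apply_self := hc.typical.eigen 0
  ne_zero := hc.lam_ne_zero hM hK
  discr_pos := hc.discr_pos
  inner_mem d hd := by
    rw [hM.symm]
    refine inner_eq_zero_of_mem_D2 hd fun i h₁ _ => ?_
    rw [hc.typical.orthonormal, if_neg]
    rintro rfl
    simp at h₁
  apply_mem _ hd := hc.apply_D2 hd
  apply_orth _ h₀ hD := hc.apply_of_orthogonal hn h₀ hD
  exists_proj := exists_orthogonal_projection_D2 hc.typical.orthonormal

theorem exists_isSplitVector (hc : IsCaseC ε h K m e lam) (hM : IsCubicModel ε h K)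
    (hn : Module.finrank ℝ E = n) (hK : K ≠ 0) {v : Fin 1 → E}
    (hdec : IsD2Decomposition h K (lam 0) (e 0) (D2 m e) v) :
    ∃ t, IsSplitVector ε h K t ∧ 0 < h t t ∧ ε < h t t ∧
      ∃ u ≠ 0, h t u = 0 ∧ K t u = h t t • u := by
  have hT := hc.isTypicalSplitting hM hn hK
  have hv := hdec.mem 0
  have hvv := hdec.unit 0
  have hsum := hdec.sum
  rw [ciSup_unique] at hsum
  have hnull : ∀ u ∈ D2 m e, h (v 0) u = 0 → K (v 0) u = 0 := fun u hu =>
    hM.apply_eq_zero_of_sup_nullV hvv hsum hu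
  have hle := hM.sq_div_four_le_inner hT hv hvv
  have htv : h (v 0) (K (v 0) (v 0)) = 0 := hM.inner_apply_self_eq_zero hT hv hv
  refine ⟨K (v 0) (v 0), hM.isSplitVector_apply_self hT hv hvv hnull, ?_, ?_, v 0, ?_, ?_, ?_⟩
  · exact lt_of_lt_of_le (by have := hT.ne_zero; positivity) hle
  · linarith [hT.discr_pos]
  · intro h0
    simp [h0] at hvv
  · rw [hM.symm, htv]
  · rw [hM.apply_symm, hM.apply_eq_of_forall_apply_eq_zero hT hv hvv hnull, htv, zero_smul,
      zero_add]

end IsCaseC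

end CaseC

namespace IsConvexOn

variable {E V : Type*} [NormedAddCommGroup E] [NormedSpace ℝ E] [FiniteDimensional ℝ E]
  [NormedAddCommGroup V] [NormedSpace ℝ V] [FiniteDimensional ℝ V]
  {ε : ℝ} {f : E → V} {U : Set E} {y t : E}

lemma isSplitAt_gaussOp (hf : IsConvexOn ε f U)
    (hd : Module.finrank ℝ V = Module.finrank ℝ E + 1) (hy : y ∈ U)
    (ht : IsSplitVector ε (metric ε f y) (diffTensor ε f y) t) :
    IsSplitAt ε f (gaussOp ε f y t) y := by
  have hinv := hf.isInvertible_frame hd hy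
  refine ⟨⟨t, rfl⟩, fun z => ContinuousLinearMap.ext fun x => ?_⟩
  obtain ⟨u, s, rfl⟩ : ∃ (u : E) (s : ℝ), x = fderiv ℝ f y u + s • f y :=
    ⟨_, _, exists_frame_coord hinv x⟩
  have hinner :
      metric ε f y t (diffTensor ε f y z u) = metric ε f y z (diffTensor ε f y t u) := by
    rw [← hf.diffTensor_adjoint hd hy, ← hf.diffTensor_adjoint hd hy, hf.diffTensor_symm hd hy z t]
  simp only [_root_.mul_apply_eq_comp, map_add, map_smul, gaussOp_fderiv hinv,
    gaussOp_self hinv, hinner, sub_eq_iff_eq_add.1 (ht.commute z u), map_sub,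
    hf.diffTensor_symm hd hy z t, hf.metric_symm hy z t]
  module

lemma gaussOp_gaussOp (hf : IsConvexOn ε f U)
    (hd : Module.finrank ℝ V = Module.finrank ℝ E + 1) (hy : y ∈ U)
    (ht : IsSplitVector ε (metric ε f y) (diffTensor ε f y) t) (x : V) :
    gaussOp ε f y t (gaussOp ε f y t x) =
      (metric ε f y t t + ε) • gaussOp ε f y t x - (metric ε f y t t * ε) • x := by
  have hinv := hf.isInvertible_frame hd hy
  obtain ⟨u, s, rfl⟩ : ∃ (u : E) (s : ℝ), x = fderiv ℝ f y u + s • f y :=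
    ⟨_, _, exists_frame_coord hinv x⟩
  have hinner : metric ε f y t (diffTensor ε f y t u) =
      (metric ε f y t t + ε) * metric ε f y t u := by
    rw [← hf.diffTensor_adjoint hd hy, ht.apply_self, map_smul, smul_apply, smul_eq_mul]
  simp only [map_add, map_smul, gaussOp_fderiv hinv, gaussOp_self hinv, hinner, ht.apply_apply,
    ht.apply_self, map_sub]
  module

theorem exists_isSplitAt_of_isCaseC (hf : IsConvexOn ε f U) (hp : IsParallelOn ε f U)
    (hd : Module.finrank ℝ V = Module.finrank ℝ E + 1) (hy : y ∈ U)
    (hC : ∃ u v w, cubicForm ε f y u v w ≠ 0) {n m : ℕ} [NeZero n] {e : Fin n → E}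
    {lam : Fin n → ℝ} (hn : Module.finrank ℝ E = n)
    (hc : IsCaseC ε (metric ε f y) (diffTensor ε f y) m e lam) {v : Fin 1 → E}
    (hdec : IsD2Decomposition (metric ε f y) (diffTensor ε f y) (lam 0) (e 0) (D2 m e) v) :
    ∃ (A : V →L[ℝ] V) (α : ℝ), IsSplitAt ε f A y ∧ 0 < α ∧ ε < α ∧
      (∀ x, A (A x) = (α + ε) • A x - (α * ε) • x) ∧
      ∃ u ≠ 0, A (fderiv ℝ f y u) = α • fderiv ℝ f y u := by
  have hK : diffTensor ε f y ≠ 0 := fun h0 => by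
    obtain ⟨a, b, c, hC⟩ := hC
    rw [hf.cubicForm_eq hd hy, h0] at hC
    simp at hC
  obtain ⟨t, ht, hpos, hlt, u, hu, htu, hKu⟩ :=
    hc.exists_isSplitVector (hf.isCubicModel hp hd hy) hn hK hdec
  refine ⟨gaussOp ε f y t, metric ε f y t t, hf.isSplitAt_gaussOp hd hy ht, hpos, hlt,
    hf.gaussOp_gaussOp hd hy ht, u, hu, ?_⟩
  rw [gaussOp_fderiv (hf.isInvertible_frame hd hy), htu, hKu, mul_zero, zero_smul, add_zero,
    map_smul]

end IsConvexOn

/-! ### Calabi products -/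

section LocalConstancy

variable {E V : Type*} [NormedAddCommGroup E] [NormedSpace ℝ E] [FiniteDimensional ℝ E]
  [NormedAddCommGroup V] [NormedSpace ℝ V] [FiniteDimensional ℝ V]
  {ε : ℝ} {f : E → V} {U : Set E} {A : V →L[ℝ] V} {y : E}

lemma IsConvexOn.eventually_isSplitAt_iff (hf : IsConvexOn ε f U) (hp : IsParallelOn ε f U)
    (hd : Module.finrank ℝ V = Module.finrank ℝ E + 1) (hy : y ∈ U) :
    ∀ᶠ y' in nhds y, IsSplitAt ε f A y' ↔ IsSplitAt ε f A y := by
  obtain ⟨r, hr, hrU⟩ := Metric.isOpen_iff.1 hf.isOpen y hy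
  have hf' := hf.mono Metric.isOpen_ball hrU
  have hp' : IsParallelOn ε f (Metric.ball y r) := fun z hz => hp z (hrU hz)
  have hc : y ∈ Metric.ball y r := Metric.mem_ball_self hr
  filter_upwards [Metric.ball_mem_nhds y hr] with y' hy'
  exact ⟨hf'.isSplitAt_of_convex hp' hd (convex_ball y r) hy' hc,
    hf'.isSplitAt_of_convex hp' hd (convex_ball y r) hc hy'⟩

end LocalConstancy

section SplitOperator

lemma finrank_eu_succ (n : ℕ) :
    Module.finrank ℝ (Eu (n + 1)) = Module.finrank ℝ (Eu n) + 1 := by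
  simp

variable {n : ℕ} {M : Type*} [TopologicalSpace M] [ChartedSpace (Eu n) M]
  {ε : ℝ} {x : M → Eu (n + 1)} {A : Eu (n + 1) →L[ℝ] Eu (n + 1)}
  {φ φ' : OpenPartialHomeomorph M (Eu n)} {q : M}

/-- `A` splits the hypersurface `x` at every point, see `IsSplitAt` (expressed in all smooth charts
of `M`). -/
def IsSplitOperator (ε : ℝ) (x : M → Eu (n + 1)) (A : Eu (n + 1) →L[ℝ] Eu (n + 1)) : Prop :=
  ∀ φ ∈ IsManifold.maximalAtlas (𝓡 n) ∞ M, ∀ y ∈ φ.target, IsSplitAt ε (x ∘ φ.symm) A y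

lemma isReparam_chart_change (hφ : φ ∈ IsManifold.maximalAtlas (𝓡 n) ∞ M)
    (hφ' : φ' ∈ IsManifold.maximalAtlas (𝓡 n) ∞ M) :
    IsReparam (φ ∘ φ'.symm) (x ∘ φ'.symm) (φ'.symm.trans φ).source (x ∘ φ.symm) φ.target where
  contDiffOn := contMDiffOn_iff_contDiffOn.1 <| (contMDiffOn_of_mem_maximalAtlas hφ).comp
    ((contMDiffOn_symm_of_mem_maximalAtlas hφ').mono fun _ hy => hy.1) fun _ hy => hy.2
  mapsTo _ hy := φ.map_source hy.2
  eq_comp _ hy := congrArg x (φ.left_inv hy.2).symm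

lemma isSplitAt_chart_change (hx : IsConvexHypersurface ε x)
    (hφ : φ ∈ IsManifold.maximalAtlas (𝓡 n) ∞ M) (hφ' : φ' ∈ IsManifold.maximalAtlas (𝓡 n) ∞ M)
    (hq : q ∈ φ.source) (hq' : q ∈ φ'.source) (h : IsSplitAt ε (x ∘ φ.symm) A (φ q)) :
    IsSplitAt ε (x ∘ φ'.symm) A (φ' q) := by
  refine (isReparam_chart_change hφ hφ').isSplitAt (hx φ hφ)
    ((hx φ' hφ').mono (φ'.symm.trans φ).open_source fun _ hy => hy.1) (finrank_eu_succ n) ?_ ?_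
  · exact ⟨φ'.map_source hq', by simpa [φ'.left_inv hq'] using hq⟩
  · simpa [φ'.left_inv hq'] using h

variable [IsManifold (𝓡 n) ∞ M]

lemma isLocallyConstant_isSplitAt (hx : IsConvexHypersurface ε x)
    (hp : HasParallelCubicForm ε x) : IsLocallyConstant fun q : M =>
      IsSplitAt ε (x ∘ (chartAt (Eu n) q).symm) A (chartAt (Eu n) q q) := by
  refine (IsLocallyConstant.iff_eventually_eq _).2 fun q => ?_
  have hchart (q : M) : chartAt (Eu n) q ∈ IsManifold.maximalAtlas (𝓡 n) ∞ M :=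
    IsManifold.chart_mem_maximalAtlas q
  have hq := mem_chart_source (Eu n) q
  have hiff := ((chartAt (Eu n) q).continuousAt hq).eventually
    ((hx _ (hchart q)).eventually_isSplitAt_iff (A := A) (hp _ (hchart q)) (finrank_eu_succ n)
      ((chartAt (Eu n) q).map_source hq))
  filter_upwards [(chartAt (Eu n) q).open_source.mem_nhds hq, hiff] with q' hq' hiff'
  have hq'' := mem_chart_source (Eu n) q'
  exact propext ⟨fun h => hiff'.1 (isSplitAt_chart_change hx (hchart q') (hchart q) hq'' hq' h),
    fun h => isSplitAt_chart_change hx (hchart q) (hchart q') hq' hq'' (hiff'.2 h)⟩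

theorem isSplitOperator_of_isSplitAt [ConnectedSpace M] (hx : IsConvexHypersurface ε x)
    (hp : HasParallelCubicForm ε x) {p : M}
    (h : IsSplitAt ε (x ∘ (chartAt (Eu n) p).symm) A (chartAt (Eu n) p p)) :
    IsSplitOperator ε x A := by
  intro φ hφ y hy
  have hchart := ((isLocallyConstant_isSplitAt hx hp).apply_eq_of_preconnectedSpace
    p (φ.symm y)).mp h
  simpa only [φ.right_inv hy] using isSplitAt_chart_change hx (IsManifold.chart_mem_maximalAtlas _)
    hφ (mem_chart_source (Eu n) _) (φ.map_target hy) hchart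

end SplitOperator

section SmoothParam

variable {F F' : Type*} [NormedAddCommGroup F] [NormedSpace ℝ F]
  [NormedAddCommGroup F'] [NormedSpace ℝ F']
  {n : ℕ} {M : Type*} [TopologicalSpace M] [ChartedSpace (Eu n) M]
  {Φ : OpenPartialHomeomorph F M}

/-- A diffeomorphism from an open subset of a normed space onto an open subset of `M`. -/
structure IsSmoothParam (n : ℕ) {M : Type*} [TopologicalSpace M] [ChartedSpace (Eu n) M]
    (Φ : OpenPartialHomeomorph F M) : Prop where
  contMDiffOn : ContMDiffOn 𝓘(ℝ, F) (𝓡 n) ∞ Φ Φ.source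
  contMDiffOn_symm : ContMDiffOn (𝓡 n) 𝓘(ℝ, F) ∞ Φ.symm Φ.target

namespace IsSmoothParam

lemma comp_linear (hΦ : IsSmoothParam n Φ) (L : F' ≃L[ℝ] F) :
    IsSmoothParam n (L.toHomeomorph.transOpenPartialHomeomorph Φ) where
  contMDiffOn := hΦ.contMDiffOn.comp L.contDiff.contMDiff.contMDiffOn fun _ h => h
  contMDiffOn_symm := L.symm.contDiff.contMDiff.comp_contMDiffOn hΦ.contMDiffOn_symm

variable [IsManifold (𝓡 n) ∞ M]

lemma symm_mem_maximalAtlas {Φ : OpenPartialHomeomorph (Eu n) M} (hΦ : IsSmoothParam n Φ) :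
    Φ.symm ∈ IsManifold.maximalAtlas (𝓡 n) ∞ M :=
  Φ.symm.mem_maximalAtlas_of_contMDiffOn hΦ.contMDiffOn_symm hΦ.contMDiffOn

end IsSmoothParam

lemma IsSmoothChart.isSmoothParam_trans
    {Ψ : OpenPartialHomeomorph (Eu n) F} {φ : OpenPartialHomeomorph M (Eu n)}
    (hΨ : IsSmoothChart Ψ) (hφ : φ ∈ IsManifold.maximalAtlas (𝓡 n) ∞ M) :
    IsSmoothParam n (φ.trans Ψ).symm where
  contMDiffOn := (contMDiffOn_symm_of_mem_maximalAtlas hφ).comp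
    (hΨ.contDiffOn_symm.contMDiffOn.mono fun _ h => h.1) fun _ h => h.2
  contMDiffOn_symm := hΨ.contDiffOn.contMDiffOn.comp
    ((contMDiffOn_of_mem_maximalAtlas hφ).mono fun _ h => h.1) fun _ h => h.2

end SmoothParam

section ProductChart

variable {n n₁ n₂ : ℕ} {M : Type*} [TopologicalSpace M] [ChartedSpace (Eu n) M]
  {V₁ V₂ : Type*} [NormedAddCommGroup V₁] [NormedSpace ℝ V₁] [NormedAddCommGroup V₂]
  [NormedSpace ℝ V₂] {ε α β c₁ c₂ : ℝ} {x : M → Eu (n + 1)}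
  {ι₁ : V₁ →L[ℝ] Eu (n + 1)} {ι₂ : V₂ →L[ℝ] Eu (n + 1)} {I : Set ℝ}
  {U₁ : Set (Eu n₁)} {U₂ : Set (Eu n₂)} {ψ₁ : Eu n₁ → V₁} {ψ₂ : Eu n₂ → V₂}
  {Φ : OpenPartialHomeomorph (ℝ × Eu n₁ × Eu n₂) M}

/-- In the parametrization `Φ` of an open subset of `M` by `I × U₁ × U₂`, the hypersurface `x` is
the product `e^{c₁ u} ψ₁(p) + e^{c₂ u} ψ₂(r)`. -/
structure IsProductParam (c₁ c₂ : ℝ) (ι₁ : V₁ →L[ℝ] Eu (n + 1)) (ι₂ : V₂ →L[ℝ] Eu (n + 1))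
    (I : Set ℝ) (U₁ : Set (Eu n₁)) (U₂ : Set (Eu n₂)) (ψ₁ : Eu n₁ → V₁) (ψ₂ : Eu n₂ → V₂)
    (x : M → Eu (n + 1)) (Φ : OpenPartialHomeomorph (ℝ × Eu n₁ × Eu n₂) M) : Prop where
  isSmoothParam : IsSmoothParam n Φ
  source_eq : Φ.source = I ×ˢ U₁ ×ˢ U₂
  isScaledProduct : IsScaledProduct c₁ c₂ ι₁ ι₂ I U₁ U₂ ψ₁ ψ₂ (x ∘ Φ)

variable [IsManifold (𝓡 n) ∞ M]

lemma IsProductParam.exists_isLinearProduct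
    (h : IsProductParam c₁ c₂ ι₁ ι₂ I U₁ U₂ ψ₁ ψ₂ x Φ) (hn : n₁ + n₂ + 1 = n) :
    ∃ φ ∈ IsManifold.maximalAtlas (𝓡 n) ∞ M, φ.source = Φ.target ∧
      ∃ L : Eu n ≃L[ℝ] ℝ × Eu n₁ × Eu n₂,
        IsLinearProduct c₁ c₂ ι₁ ι₂ L I U₁ U₂ ψ₁ ψ₂ (x ∘ φ.symm) φ.target := by
  let L : Eu n ≃L[ℝ] ℝ × Eu n₁ × Eu n₂ :=
    ContinuousLinearEquiv.ofFinrankEq (by simp [← hn]; ring)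
  refine ⟨_, (h.isSmoothParam.comp_linear L).symm_mem_maximalAtlas, rfl, L,
    congrArg (L ⁻¹' ·) h.source_eq, fun u hu p hp r hr => ?_⟩
  rw [← h.isScaledProduct u hu p hp r hr]
  exact congrArg (x ∘ Φ) (L.apply_symm_apply _)

variable [FiniteDimensional ℝ V₁] [FiniteDimensional ℝ V₂] {A : Eu (n + 1) →L[ℝ] Eu (n + 1)}
  {ρ₁ : Eu (n + 1) →L[ℝ] V₁} {ρ₂ : Eu (n + 1) →L[ℝ] V₂}

lemma exists_isProductParam (hx : IsConvexHypersurface ε x) (hA : IsSplitOperator ε x A)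
    (hι : IsEigenSplitting α β A ι₁ ρ₁ ι₂ ρ₂) (hα : α ≠ 0) (hβ : β ≠ 0) (hαβ : α ≠ β)
    (hn₁ : Module.finrank ℝ V₁ = n₁ + 1) (hn₂ : Module.finrank ℝ V₂ = n₂ + 1) (q : M) :
    ∃ (I : Set ℝ) (U₁ : Set (Eu n₁)) (U₂ : Set (Eu n₂)) (ψ₁ : Eu n₁ → V₁) (ψ₂ : Eu n₂ → V₂)
      (Φ : OpenPartialHomeomorph (ℝ × Eu n₁ × Eu n₂) M), q ∈ Φ.target ∧
        IsProductParam (ε / β) (ε / α) ι₁ ι₂ I U₁ U₂ ψ₁ ψ₂ x Φ := by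
  have hφ := IsManifold.chart_mem_maximalAtlas (I := 𝓡 n) (n := ∞) q
  have hq := mem_chart_source (Eu n) q
  have hd₁ : Module.finrank ℝ V₁ = Module.finrank ℝ (Eu n₁) + 1 := by simpa using hn₁
  have hd₂ : Module.finrank ℝ V₂ = Module.finrank ℝ (Eu n₂) + 1 := by simpa using hn₂
  obtain ⟨Ψ, I, U₁, U₂, ψ₁, ψ₂, hΨ, hqΨ, hsub, htarget, hprod⟩ :=
    hι.exists_local_product hα hβ hαβ (hx _ hφ) (finrank_eu_succ n) hd₁ hd₂ (hA _ hφ)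
      ((chartAt (Eu n) q).map_source hq)
  have hinter : Ψ.target ∩ Ψ.symm ⁻¹' (chartAt (Eu n) q).target = Ψ.target :=
    Set.inter_eq_left.2 fun b hb => hsub (Ψ.map_target hb)
  exact ⟨I, U₁, U₂, ψ₁, ψ₂, ((chartAt (Eu n) q).trans Ψ).symm, ⟨hq, hqΨ⟩,
    hΨ.isSmoothParam_trans hφ, hinter.trans htarget, hprod⟩

lemma IsProductParam.isConvexOn_and_isParallelOn (hx : IsConvexHypersurface ε x)
    (hp : HasParallelCubicForm ε x) (hA : IsSplitOperator ε x A)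
    (hι : IsEigenSplitting α ε A ι₁ ρ₁ ι₂ ρ₂) (hα : 0 < α) (hαε : ε < α)
    (hn₁ : Module.finrank ℝ V₁ = n₁ + 1) (hn₂ : Module.finrank ℝ V₂ = n₂ + 1)
    (hn : n₁ + n₂ + 1 = n) (h : IsProductParam (ε / ε) (ε / α) ι₁ ι₂ I U₁ U₂ ψ₁ ψ₂ x Φ)
    (hΦ : Φ.target.Nonempty) :
    (IsConvexOn (-1) ψ₁ U₁ ∧ IsParallelOn (-1) ψ₁ U₁) ∧
      (IsConvexOn ε ψ₂ U₂ ∧ IsParallelOn ε ψ₂ U₂) := by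
  obtain ⟨φ, hφ, hsource, L, hL⟩ := h.exists_isLinearProduct hn
  have hf := hx φ hφ
  have hεε := hf.sign_mul_self
  have hε : ε ≠ 0 := left_ne_zero_of_mul_eq_one hεε
  have hne : φ.target.Nonempty := by
    rw [← φ.image_source_eq_target, hsource]
    exact hΦ.image φ
  refine ⟨hL.isConvexOn_and_isParallelOn hι hα.ne' hε hαε.ne' hf (hp φ hφ) (finrank_eu_succ n)
    (by simpa using hn₁) (hA φ hφ) hne (Or.inr rfl) ?_,
    hL.symm.isConvexOn_and_isParallelOn hι.symm hε hα.ne' hαε.ne hf (hp φ hφ) (finrank_eu_succ n)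
    (by simpa using hn₂) (hA φ hφ) hne hf.sign ?_⟩
  · rw [mul_div_right_comm, mul_div_assoc, div_self hε]
    linarith
  · rw [hεε, one_mul]
    exact div_pos (sub_pos.2 hαε) hα

end ProductChart

section CalabiProduct

variable {n n₁ n₂ : ℕ} {M : Type*} [TopologicalSpace M] [ChartedSpace (Eu n) M]
  [IsManifold (𝓡 n) ∞ M] {ε α : ℝ} {x : M → Eu (n + 1)} {A : Eu (n + 1) →L[ℝ] Eu (n + 1)}

lemma exists_equiv_eq_smul {V : Type*} [NormedAddCommGroup V] [NormedSpace ℝ V] {b : V}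
    (hb : b ≠ 0) (hV : Module.finrank ℝ V = 1) : ∃ g : ℝ ≃L[ℝ] V, ∀ c, g c = c • b :=
  have := Module.finite_of_finrank_eq_succ hV
  ⟨(LinearEquiv.ofInjectiveOfFinrankEq (LinearMap.toSpanSingleton ℝ V b)
    (smul_left_injective ℝ hb) (by simp [hV])).toContinuousLinearEquiv, fun _ => rfl⟩

lemma neg_div_ne_zero_and_ne_neg_one (hε : ε ≠ 0) (hα : 0 < α) (hαε : ε < α) :
    -(ε / α) ≠ 0 ∧ -(ε / α) ≠ -1 :=
  ⟨neg_ne_zero.2 (div_ne_zero hε hα.ne'), neg_injective.ne ((div_lt_one hα).2 hαε).ne⟩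

theorem isCalabiProductNear {ι₁ : Eu (n₁ + 1) →L[ℝ] Eu (n + 1)}
    {ρ₁ : Eu (n + 1) →L[ℝ] Eu (n₁ + 1)} {ι₂ : Eu (n₂ + 1) →L[ℝ] Eu (n + 1)}
    {ρ₂ : Eu (n + 1) →L[ℝ] Eu (n₂ + 1)} (hx : IsConvexHypersurface ε x)
    (hp : HasParallelCubicForm ε x) (hε : ε ≠ 0) (hA : IsSplitOperator ε x A)
    (hι : IsEigenSplitting α ε A ι₁ ρ₁ ι₂ ρ₂) (hα : 0 < α) (hαε : ε < α)
    (hn₁ : 1 ≤ n₁) (hn₂ : 1 ≤ n₂) (hn : n₁ + n₂ + 1 = n) (q : M) : IsCalabiProductNear x q := by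
  obtain ⟨I, U₁, U₂, ψ₁, ψ₂, Φ, hq, hΦ⟩ :=
    exists_isProductParam (n₁ := n₁) (n₂ := n₂) hx hA hι hα.ne' hε hαε.ne' (by simp) (by simp) q
  obtain ⟨hψ₁, hψ₂⟩ := hΦ.isConvexOn_and_isParallelOn hx hp hA hι hα hαε (by simp) (by simp) hn
    ⟨q, hq⟩
  obtain ⟨hlam, hlam'⟩ := neg_div_ne_zero_and_ne_neg_one hε hα hαε
  refine ⟨n₁, n₂, hn₁, hn₂, hn, -(ε / α), hlam, hlam', I, U₁, U₂, ψ₁, ψ₂, hι.equiv, Φ, ⟨_, hψ₁⟩,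
    ⟨_, hψ₂⟩, hΦ.source_eq, hq, hΦ.isSmoothParam.contMDiffOn, hΦ.isSmoothParam.contMDiffOn_symm,
    fun u hu p hp r hr => (hΦ.isScaledProduct u hu p hp r hr).trans ?_⟩
  rw [hι.equiv_apply, map_smul, map_smul, div_self hε, one_mul, neg_neg]

theorem isCalabiProductWithPointNear {ι₁ : Eu (n₁ + 1) →L[ℝ] Eu (n + 1)}
    {ρ₁ : Eu (n + 1) →L[ℝ] Eu (n₁ + 1)} {ι₂ : Eu 1 →L[ℝ] Eu (n + 1)}
    {ρ₂ : Eu (n + 1) →L[ℝ] Eu 1} (hx : IsConvexHypersurface ε x)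
    (hp : HasParallelCubicForm ε x) (hε : ε ≠ 0) (hA : IsSplitOperator ε x A)
    (hι : IsEigenSplitting α ε A ι₁ ρ₁ ι₂ ρ₂) (hα : 0 < α) (hαε : ε < α)
    (hn₁ : 1 ≤ n₁) (hn : n₁ + 1 = n) (q : M) : IsCalabiProductWithPointNear x q := by
  obtain ⟨I, U₁, U₂, ψ₁, ψ₂, Φ, hq, hΦ⟩ :=
    exists_isProductParam (n₁ := n₁) (n₂ := 0) hx hA hι hα.ne' hε hαε.ne' (by simp) (by simp) q
  obtain ⟨hψ₁, hψ₂⟩ := hΦ.isConvexOn_and_isParallelOn hx hp hA hι hα hαε (by simp) (by simp)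
    (by simpa using hn) ⟨q, hq⟩
  obtain ⟨hlam, hlam'⟩ := neg_div_ne_zero_and_ne_neg_one hε hα hαε
  have hU₂ (r : Eu 0) : r ∈ U₂ := by
    have hmem : Φ.symm q ∈ I ×ˢ U₁ ×ˢ U₂ := hΦ.source_eq ▸ Φ.map_target hq
    exact Subsingleton.elim (Φ.symm q).2.2 r ▸ hmem.2.2
  have hψ₂₀ : ψ₂ 0 ≠ 0 := fun h => hψ₂.1.transversal 0 (hU₂ 0) 0 (by rw [map_zero, h])
  obtain ⟨g, hg⟩ := exists_equiv_eq_smul hψ₂₀ (by simp)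
  let J : (ℝ × Eu n₁) ≃L[ℝ] ℝ × Eu n₁ × Eu 0 :=
    (ContinuousLinearEquiv.refl ℝ ℝ).prodCongr
      (ContinuousLinearEquiv.prodUnique ℝ (Eu n₁) (Eu 0)).symm
  have hJ := hΦ.isSmoothParam.comp_linear J
  refine ⟨n₁, hn₁, hn, -(ε / α), hlam, hlam', I, U₁, ψ₁,
    ((ContinuousLinearEquiv.refl ℝ _).prodCongr g).trans hι.equiv,
    J.toHomeomorph.transOpenPartialHomeomorph Φ, ⟨_, hψ₁⟩, ?_, hq, hJ.contMDiffOn,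
    hJ.contMDiffOn_symm, fun u hu p hp =>
      (hΦ.isScaledProduct u hu p hp (J (u, p)).2.2 (hU₂ _)).trans ?_⟩
  · refine (congrArg (J ⁻¹' ·) hΦ.source_eq).trans (Set.ext fun b => ?_)
    exact and_congr_right fun _ => and_iff_left (hU₂ _)
  · rw [Subsingleton.elim (J (u, p)).2.2 0, ContinuousLinearEquiv.trans_apply, hι.equiv_apply,
      div_self hε, one_mul, neg_neg, ← map_smul, ← map_smul, ← hg]
    rfl

end CalabiProduct

section EigenDimensions

variable {E V : Type*} [NormedAddCommGroup E] [NormedSpace ℝ E] [FiniteDimensional ℝ E]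
  [NormedAddCommGroup V] [NormedSpace ℝ V] [FiniteDimensional ℝ V]
  {ε α β : ℝ} {f : E → V} {U : Set E} {A : V →L[ℝ] V} {y u : E}

lemma IsConvexOn.exists_isEigenSplitting (hf : IsConvexOn ε f U)
    (hd : Module.finrank ℝ V = Module.finrank ℝ E + 1) (hy : y ∈ U) (hs : IsSplitAt ε f A y)
    (hA : ∀ x, A (A x) = (α + β) • A x - (α * β) • x) (hα : α ≠ 0) (hβ : β ≠ 0) (hαβ : α ≠ β)
    (hu : u ≠ 0) (hAu : A (fderiv ℝ f y u) = α • fderiv ℝ f y u) :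
    ∃ (n₁ n₂ : ℕ) (ι₁ : Eu (n₁ + 1) →L[ℝ] V) (ρ₁ : V →L[ℝ] Eu (n₁ + 1))
      (ι₂ : Eu (n₂ + 1) →L[ℝ] V) (ρ₂ : V →L[ℝ] Eu (n₂ + 1)),
      IsEigenSplitting α β A ι₁ ρ₁ ι₂ ρ₂ ∧ 1 ≤ n₁ ∧ n₁ + n₂ + 1 = Module.finrank ℝ E := by
  have hinv := hf.isInvertible_frame hd hy
  obtain ⟨k₁, k₂, ι₁, ρ₁, ι₂, ρ₂, hι⟩ := Centroaffine.exists_isEigenSplitting hA hαβ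
  have hk₁ : 2 ≤ k₁ := by simpa using hι.two_le_finrank hβ hαβ hinv hs hu hAu
  have hk₂ : 1 ≤ k₂ := by simpa using hι.symm.one_le_finrank hα hinv hs
  have hk : k₁ + k₂ = Module.finrank ℝ V := by simpa using hι.equiv.toLinearEquiv.finrank_eq
  obtain ⟨n₁, rfl⟩ := Nat.exists_eq_add_of_le' (Nat.one_le_of_lt hk₁)
  obtain ⟨n₂, rfl⟩ := Nat.exists_eq_add_of_le' hk₂
  exact ⟨n₁, n₂, ι₁, ρ₁, ι₂, ρ₂, hι, by omega, by omega⟩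

end EigenDimensions

end Centroaffine

theorem theorem7p1 {n : ℕ} [NeZero n] {M : Type*} [TopologicalSpace M]
    [ChartedSpace (Centroaffine.Eu n) M] [IsManifold (𝓡 n) ∞ M] [ConnectedSpace M]
    (ε : ℝ) (x : M → Centroaffine.Eu (n + 1))
    (hx : Centroaffine.IsConvexHypersurface ε x)
    (hpar : Centroaffine.HasParallelCubicForm ε x)
    (hC : Centroaffine.HasNonvanishingCubicForm ε x)
    (m : ℕ) (hm : 2 ≤ m) (hmn : m + 1 ≤ n)
    (p : M) (e : Fin n → Centroaffine.Eu n) (lam : Fin n → ℝ)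
    (hcase : Centroaffine.IsCaseC ε (Centroaffine.metricAt ε x p)
      (Centroaffine.diffTensorAt ε x p) m e lam)
    (k₀ : ℕ) (v : Fin k₀ → Centroaffine.Eu n)
    (hdec : Centroaffine.IsD2Decomposition (Centroaffine.metricAt ε x p)
      (Centroaffine.diffTensorAt ε x p) (lam 0) (e 0) (Centroaffine.D2 m e) v)
    (hk₀ : k₀ = 1) :
    (∀ q : M, Centroaffine.IsCalabiProductNear x q) ∨
      (∀ q : M, Centroaffine.IsCalabiProductWithPointNear x q) := by
  subst hk₀
  have hφ := IsManifold.chart_mem_maximalAtlas (I := 𝓡 n) (n := ∞) p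
  have hy := (chartAt (Centroaffine.Eu n) p).map_source (mem_chart_source _ p)
  have hf := hx _ hφ
  have hε : ε ≠ 0 := left_ne_zero_of_mul_eq_one hf.sign_mul_self
  have hd := Centroaffine.finrank_eu_succ n
  obtain ⟨A, α, hs, hα, hαε, hAA, u, hu, hAu⟩ := hf.exists_isSplitAt_of_isCaseC
    (hpar _ hφ) hd hy (hC _ hφ _ hy) finrank_euclideanSpace_fin hcase hdec
  have hA := Centroaffine.isSplitOperator_of_isSplitAt hx hpar hs
  obtain ⟨n₁, n₂, ι₁, ρ₁, ι₂, ρ₂, hι, hn₁, hn⟩ :=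
    hf.exists_isEigenSplitting hd hy hs hAA hα.ne' hε hαε.ne' hu hAu
  rw [finrank_euclideanSpace_fin] at hn
  rcases n₂.eq_zero_or_pos with rfl | hn₂
  · exact Or.inr <| Centroaffine.isCalabiProductWithPointNear hx hpar hε hA hι hα hαε hn₁ hn
  · exact Or.inl <| Centroaffine.isCalabiProductNear hx hpar hε hA hι hα hαε hn₁ hn₂ hn
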